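/- **Setting.** Let $I=\{t\in\mathbb R:\tfrac14\le|t|\le4\}$, let $\|F\|_{C^N(I)}=\max_{k\le N}\sup_{t\in I}|F^{(k)}(t)|$, and fix an integer $N\ge2$. Let $\gamma$ be a real curve that is *non-flat near zero and near infinity*, in the following sense. There are $\delta,R>0$ and profiles $Q_0,Q_\infty\in C^N(I)$ such that, with $(V,s_k,Q)=(\{0<|t|<\delta\},2^{-k},Q_0)$ and also with $(V,s_k,Q)=(\{|t|>R\},2^{k},Q_\infty)$: (a) $\gamma\in C^N(V)$ and $\gamma'\ne0$ on $V$; (b) $\sup_{\alpha>0}\#\{k\in\mathbb N:|s_k\gamma'(s_k)|\in[\alpha,2\alpha]\}<\infty$; (c) $\frac{\gamma(s_kt)}{s_k\gamma'(s_k)}=Q(t)+Q_k(t)$ on $I$ with $\|Q_k\|_{C^N(I)}\to0$ as $k\to\infty$; (d) $\inf_{t\in I}|Q''(t)|>0$. For $j\in\mathbb Z$ write $Q^{(j)}=Q_0$ if $j>0$ and $Q^{(j)}=Q_\infty$ if $j\leq 0$. Let $\rho\in C_0^\infty(\mathbb R)$ be nonnegative and even, with $\operatorname{supp}\rho\subseteq\{\frac14<|t|<1\}$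 and $\int\rho=1$. Let $\phi$ be a nonnegative even Schwartz function supported in $\{\frac12\le|t|\le2\}$ with $\sum_{n\in\mathbb Z}\phi(t/2^n)=1$ for $t\ne0$. Put $$m_j(\xi,\eta)=\int_{\mathbb R}e^{-i\frac{\xi}{2^j}t}e^{i\eta\gamma(t/2^j)}\rho(t)\,dt,\qquad m_{j,m,n}(\xi,\eta)=m_j(\xi,\eta)\,\phi\Big(\frac{\xi}{2^{m+j}}\Big)\phi\Big(\frac{\gamma'(2^{-j})\eta}{2^{n+j}}\Big).$$ For $C\in\mathbb N$ let $\Delta_C=\{(m,n)\in\mathbb Z^2:m,n\ge0,\ |m-n|\le C\}$ and $F_C=\mathbb Z^2\setminus(\{m<0,\,n<0\}\cup\Delta_C)$, and let $m_j^{H\not\Delta}=\sum_{(m,n)\in F_C}m_{j,m,n}$. With $\hat f(\xi)=\frac1{\sqrt{2\pi}}\int f(x)e^{-ix\xi}dx$ and a measurable function $j:\mathbb R\to\mathbb Z$, set for Schwartz functions $f,g$ $$\mathcal M_{m,n}^{H\not\Delta}(f,g)(x)=\int_{\mathbb R}\int_{\mathbb R}\hat f(\xi)\hat g(\eta)\,m_{j(x),m,n}(\xi,\eta)\,e^{i\xi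 x}e^{i\eta x}\,d\xi\,d\eta,$$ $$\mathcal M_\Gamma^{H\not\Delta}(f,g)(x)=\int_{\mathbb R}\int_{\mathbb R}\hat f(\xi)\hat g(\eta)\,m^{H\not\Delta}_{j(x)}(\xi,\eta)\,e^{i\xi x}e^{i\eta x}\,d\xi\,d\eta.$$ For $c>0$ let the $c$-grand shifted Hardy–Littlewood maximal function be $$M^{[c]}f(x)=\sup_{|\omega|\le c}\ \sup_{I\ni x}\frac1{|I|}\int_{I+\omega|I|}|f(y)|\,dy\qquad(I\text{ a bounded interval}).$$ Finally $a_+=\max\{a,0\}$. **Theorem.** There are $j_0\in\mathbb N$ and an integer $C_0\ge1$, depending only on $\gamma$, such that the following holds for all $\phi,\rho$ as above. The double integrals above converge absolutely for every value of $j$ with $|j|>j_0$. Moreover, for every integer $C\ge C_0$ and every measurable $j:\mathbb R\to\mathbb Z$ with $|j(x)|>j_0$ for all $x$: 1. For all $(m,n)\in F_C$, all Schwartz functions $f,g$ and all $x\in\mathbb R$, $$|\mathcal M^{H\not\Delta}_{m,n}(f,g)(x)|\le \frac{A}{2^{\max\{m,n\}}}\,M^{[2^m]}f(x)\;M^{[2^{n+1}\|Q^{(j(x))}\|_{C^2(I)}]}g(x),$$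 where $A$ depends only on $\gamma,\phi,\rho$. 2. Let $1<p,q\le\infty$ and $1\le r\le\infty$ with $\frac1p+\frac1q=\frac1r$. There is a constant $A$, depending only on $\gamma,\phi,\rho,p,q$, such that for all Schwartz functions $f,g$ $$\|\mathcal M^{H\not\Delta}_{m,n}(f,g)\|_{L^r}\le \frac{A}{2^{\max\{m,n\}}}(m_++10)(n_++10)\,\|f\|_{L^p}\|g\|_{L^q}\quad\text{for all }(m,n)\in F_C,$$ and $$\|\mathcal M^{H\not\Delta}_\Gamma(f,g)\|_{L^r}\le A\,\|f\|_{L^p}\|g\|_{L^q}.$$ -/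

import Mathlib

open MeasureTheory Filter Topology Set
open scoped ENNReal NNReal SchwartzMap ContDiff

namespace BilinearMax

noncomputable section

/-- The symmetric annulus `I = {t : 1/4 ≤ |t| ≤ 4}`. -/
def annulus : Set ℝ := {t | 1 / 4 ≤ |t| ∧ |t| ≤ 4}

/-- The norm of `C^N(I)`: the maximum over `k ≤ N` of `sup_{t ∈ I} |F^{(k)}(t)|`
(finite for `F ∈ C^N(I)`, since `I` is compact). -/
def cNorm (N : ℕ) (F : ℝ → ℝ) : ℝ :=
  ⨆ k : Fin (N + 1), ⨆ t : annulus, |iteratedDerivWithin (k : ℕ) F annulus (t : ℝ)|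

/-- The non-flatness conditions for `γ` on the region `V`, read off along the dyadic scales
`s 0, s 1, s 2, …`, with limiting profile `Q`. -/
structure IsNonFlat (N : ℕ) (γ : ℝ → ℝ) (V : Set ℝ) (s : ℕ → ℝ) (Q : ℝ → ℝ) : Prop where
  /-- smoothness -/
  contDiffOn : ContDiffOn ℝ N γ V
  /-- no critical points -/
  deriv_ne_zero : ∀ t ∈ V, deriv γ t ≠ 0
  /-- variation: boundedly many scales `j` have `|s_j γ'(s_j)|` of a given dyadic size -/
  variation : ∃ B : ℕ, ∀ α : ℝ, 0 < α →
    {j : ℕ | α ≤ |s j * deriv γ (s j)| ∧ |s j * deriv γ (s j)| ≤ 2 * α}.encard ≤ B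
  /-- the profile is of class `C^N` on `I` -/
  contDiffOn_profile : ContDiffOn ℝ N Q annulus
  /-- asymptotics: `γ(s_j t) / (s_j γ'(s_j)) = Q(t) + Q_j(t)` with `‖Q_j‖_{C^N(I)} → 0` -/
  tendsto_profile :
    Tendsto (fun j : ℕ => cNorm N (fun t => γ (s j * t) / (s j * deriv γ (s j)) - Q t))
      atTop (𝓝 0)
  /-- non-flatness of the profile: `inf_{t ∈ I} |Q''(t)| > 0` -/
  nonflat : ∃ c : ℝ, 0 < c ∧ ∀ t ∈ annulus, c ≤ |iteratedDerivWithin 2 Q annulus t|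

/-- `γ` is a `C^N` non-flat curve near the origin, with profile `Q`. -/
def IsNonFlatNearZero (N : ℕ) (γ Q : ℝ → ℝ) : Prop :=
  ∃ δ : ℝ, 0 < δ ∧ IsNonFlat N γ {t | 0 < |t| ∧ |t| < δ} (fun j => (2 : ℝ) ^ (-(j : ℤ))) Q

/-- `γ` is a `C^N` non-flat curve near infinity, with profile `Q`. -/
def IsNonFlatNearInfinity (N : ℕ) (γ Q : ℝ → ℝ) : Prop :=
  ∃ R : ℝ, 0 < R ∧ IsNonFlat N γ {t | R < |t|} (fun j => (2 : ℝ) ^ (j : ℤ)) Q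

/-- The profile which governs `γ` at the scale `2^{-j}`: the one at the origin for `j > 0`,
the one at infinity for `j ≤ 0`. -/
def profileAt (Q₀ Qinf : ℝ → ℝ) (j : ℤ) : ℝ → ℝ := if 0 < j then Q₀ else Qinf

/-- The frequency cutoffs `φ`: a nonnegative even Schwartz function supported in
`{1/2 ≤ |t| ≤ 2}` with `∑_{n ∈ ℤ} φ(t / 2^n) = 1` for `t ≠ 0`. -/
structure IsFrequencyCutoff (φ : 𝓢(ℝ, ℝ)) : Prop where
  nonneg : ∀ t, 0 ≤ φ t
  even : ∀ t, φ (-t) = φ t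
  support_subset : tsupport φ ⊆ {t : ℝ | 1 / 2 ≤ |t| ∧ |t| ≤ 2}
  hasSum : ∀ t : ℝ, t ≠ 0 → HasSum (fun n : ℤ => φ (t / (2 : ℝ) ^ n)) 1

/-- The averaging kernels `ρ`: nonnegative, even, smooth, supported in `{1/4 < |t| < 1}`,
of integral one. -/
structure IsAveragingKernel (ρ : ℝ → ℝ) : Prop where
  contDiff : ContDiff ℝ ∞ ρ
  nonneg : ∀ t, 0 ≤ ρ t
  even : ∀ t, ρ (-t) = ρ t
  support_subset : tsupport ρ ⊆ {t : ℝ | 1 / 4 < |t| ∧ |t| < 1}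
  integral_eq_one : ∫ t, ρ t = 1

/-- The Fourier transform, normalized by `1/√(2π)`. -/
def fourierHat (f : ℝ → ℂ) (ξ : ℝ) : ℂ :=
  (1 / Real.sqrt (2 * Real.pi) : ℝ) * ∫ x, f x * Complex.exp (-(Complex.I * x * ξ))

/-- The multiplier
`m_j(ξ, η) = ∫ e^{-i (ξ / 2^j) t} e^{i η γ(t / 2^j)} ρ(t) dt`. -/
def symbol (γ ρ : ℝ → ℝ) (j : ℤ) (ξ η : ℝ) : ℂ :=
  ∫ t : ℝ, Complex.exp (-(Complex.I * ((ξ / (2 : ℝ) ^ j * t : ℝ) : ℂ))) *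
    Complex.exp (Complex.I * ((η * γ (t / (2 : ℝ) ^ j) : ℝ) : ℂ)) * (ρ t : ℂ)

/-- The localized multiplier
`m_{j,m,n}(ξ, η) = m_j(ξ, η) φ(ξ / 2^{m+j}) φ(γ'(2^{-j}) η / 2^{n+j})`. -/
def symbolPiece (γ ρ : ℝ → ℝ) (φ : ℝ → ℝ) (j m n : ℤ) (ξ η : ℝ) : ℂ :=
  symbol γ ρ j ξ η * (φ (ξ / (2 : ℝ) ^ (m + j)) : ℂ) *
    (φ (deriv γ ((2 : ℝ) ^ (-j)) * η / (2 : ℝ) ^ (n + j)) : ℂ)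

/-- The low frequency index set `(ℤ₋)²`. -/
def lowIndices : Set (ℤ × ℤ) := {a | a.1 < 0 ∧ a.2 < 0}

/-- The indices close to the diagonal: `m, n ≥ 0` and `|m - n| ≤ C`. -/
def diagIndices (C : ℕ) : Set (ℤ × ℤ) := {a | 0 ≤ a.1 ∧ 0 ≤ a.2 ∧ |a.1 - a.2| ≤ (C : ℤ)}

/-- The high frequency indices far from the diagonal: `ℤ² \ ((ℤ₋)² ∪ Δ)`. -/
def farIndices (C : ℕ) : Set (ℤ × ℤ) := (lowIndices ∪ diagIndices C)ᶜ

/-- The far high frequency multiplier, the sum of `m_{j,m,n}` over the far indices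
(at each `(ξ, η)` only finitely many terms are nonzero). -/
def farSymbol (γ ρ : ℝ → ℝ) (φ : ℝ → ℝ) (C : ℕ) (j : ℤ) (ξ η : ℝ) : ℂ :=
  ∑' a : farIndices C, symbolPiece γ ρ φ j a.1.1 a.1.2 ξ η

/-- The integrand `f̂(ξ) ĝ(η) μ(ξ, η) e^{iξx} e^{iηx}` of a bilinear multiplier operator. -/
def multiplierIntegrand (μ : ℝ → ℝ → ℂ) (f g : ℝ → ℂ) (x ξ η : ℝ) : ℂ :=
  fourierHat f ξ * fourierHat g η * μ ξ η *
    Complex.exp (Complex.I * ξ * x) * Complex.exp (Complex.I * η * x)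

/-- The linearized operator
`(f, g) ↦ ∬ f̂(ξ) ĝ(η) μ_{j(x)}(ξ, η) e^{iξx} e^{iηx} dξ dη` of a family `μ_j` of multipliers. -/
def linearizedOp (μ : ℤ → ℝ → ℝ → ℂ) (j : ℝ → ℤ) (f g : ℝ → ℂ) (x : ℝ) : ℂ :=
  ∫ ξ : ℝ, ∫ η : ℝ, multiplierIntegrand (μ (j x)) f g x ξ η

/-- The piece `𝓜_{m,n}(f, g)`. -/
def farPiece (γ ρ φ : ℝ → ℝ) (j : ℝ → ℤ) (m n : ℤ) (f g : ℝ → ℂ) (x : ℝ) : ℂ :=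
  linearizedOp (fun i => symbolPiece γ ρ φ i m n) j f g x

/-- The global component of high frequencies far from the diagonal. -/
def farOp (γ ρ φ : ℝ → ℝ) (C : ℕ) (j : ℝ → ℤ) (f g : ℝ → ℂ) (x : ℝ) : ℂ :=
  linearizedOp (farSymbol γ ρ φ C) j f g x

/-- The `w`-shifted Hardy-Littlewood maximal function: the supremum over the intervals
`I = [a, b]` containing `x` of the average of `|f|` over `I + w |I|`. -/
def shiftedMaximal (w : ℝ) (f : ℝ → ℂ) (x : ℝ) : ℝ≥0∞ :=
  ⨆ (a : ℝ) (b : ℝ) (_ : a < b ∧ a ≤ x ∧ x ≤ b),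
    (∫⁻ y in Icc (a + w * (b - a)) (b + w * (b - a)), ‖f y‖ₑ) / ENNReal.ofReal (b - a)

/-- The `c`-grand shifted Hardy-Littlewood maximal function
`M^{[c]} f = sup_{|w| ≤ c} M^{(w)} f`. -/
def grandMaximal (c : ℝ) (f : ℝ → ℂ) (x : ℝ) : ℝ≥0∞ :=
  ⨆ (w : ℝ) (_ : |w| ≤ c), shiftedMaximal w f x

end

end BilinearMax

/-! Put `σ = 2^{-j} γ'(2^{-j})` and `q(t) = γ(2^{-j} t) / σ`. The symbol is `∫ exp(-i a t + i e
q(t)) ρ(t) dt` with `a = 2^{-j} ξ` and `e = σ η`, and on the piece `(m, n)` one has `|a| ~ 2^m`,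
`|e| ~ 2^n`. Since `|q'|` is bounded above and below uniformly in `j`, one term of the phase
derivative `-a + e q'` dominates away from the diagonal.

Dividing by the whole phase derivative would couple `ξ` and `η`, so integration by parts divides by
the dominant term only. With `J_k = ∫ exp(..) ρ q'^k` this expresses `J_0` as a boundary-free
integral plus `(e/a) J_1`. Iterating gives a series with terms `a^{-k-1} e^k ∫ exp(..) (ρ q'^k)'`
(`hasSum_wave_left`; `hasSum_wave_right` uses negative powers of `q'` when `e` dominates). Every
term is a function of `ξ` times a function of `η` times a `t`-integral, only one derivative falls on
`ρ q'^k`, and the one unmatched inverse power of `a` or `e` is the gain `2^{-max(m,n)}`. The series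
is geometric once `|m - n|` exceeds a `C₀` depending on the bounds for the curve. An index of `F_C`
with `|m - n| ≤ C₀` has exactly one negative entry, so its maximum is at most `C₀` and no gain is
needed.

Undoing the Fourier transforms under the `t`-integral bounds the operator by an average over `t` of
`f` averaged at width `2^{-m-j}` around `x - 2^{-j} t`, times `g` averaged at width `2^{-n} |σ|`
around `x + σ q(t)` (`enorm_tsum_waves_le`). Relative to the widths these shifts are at most `2^m`
and `2^{n+1} ‖Q‖`, which is the pointwise estimate. For the norms, `t` is frozen and the supremum
over `j` is taken in each factor separately. A maximal function with boundedly many scales per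
dyadic block and shifts of at most `2^M` radii loses only a factor linear in `M`
(`scaleMaximal_weak_type`); the variation hypothesis (b) supplies the count for `g`. Hölder in `x`
and Minkowski in `t` finish.

There is no decay as the smaller index tends to `-∞`, so for the full operator all negative indices
are first collapsed into one low-pass cutoff; the remaining double series of norms converges.

The lower bound for `|q'|` is not assumed. It follows from `γ' ≠ 0` and `Q'' ≠ 0`
(`ScaleData.profile_deriv_ne_zero`). -/

namespace BilinearMax
-- Shifted maximal functions over sparse scales: weak and strong type.
noncomputable section

/-- The average of `F` over the ball of radius `ℓ` around `y`. -/
def avgBall (ℓ : ℝ) (F : ℝ → ℝ≥0∞) (y : ℝ) : ℝ≥0∞ :=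
  (∫⁻ z in Metric.closedBall y ℓ, F z) / ENNReal.ofReal (2 * ℓ)

/-- The maximal function over countably many scales, each with its own shift. -/
def scaleMaximal {ι : Type*} (ℓ τ : ι → ℝ) (F : ℝ → ℝ≥0∞) (x : ℝ) : ℝ≥0∞ :=
  ⨆ i, avgBall (ℓ i) F (x + τ i)

/-- Cutting the range into dyadic blocks makes the count linear in `M`, hence logarithmic in the
ratio of the radii. This is the source of the factors `m_+ + 10` and `n_+ + 10`. -/
lemma encard_scales_le {ι : Type*} {ℓ : ι → ℝ} {B : ℕ}
    (hcount : ∀ α : ℝ, 0 < α → {i | α ≤ ℓ i ∧ ℓ i ≤ 2 * α}.encard ≤ B) (M : ℕ) {α : ℝ}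
    (hα : 0 < α) : {i | α ≤ ℓ i ∧ ℓ i ≤ 2 ^ M * α}.encard ≤ (M * B : ℕ) + B := by
  induction M with
  | zero =>
    refine (Set.encard_le_encard ?_).trans ((hcount α hα).trans ?_)
    · rintro i ⟨h1, h2⟩
      exact ⟨h1, by simp at h2; linarith⟩
    · simp
  | succ M ih =>
    have hs : {i | α ≤ ℓ i ∧ ℓ i ≤ 2 ^ (M + 1) * α} ⊆
        {i | α ≤ ℓ i ∧ ℓ i ≤ 2 ^ M * α} ∪
          {i | 2 ^ M * α ≤ ℓ i ∧ ℓ i ≤ 2 * (2 ^ M * α)} := by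
      rintro i ⟨h1, h2⟩
      rcases le_total (ℓ i) (2 ^ M * α) with h | h
      · exact Or.inl ⟨h1, h⟩
      · exact Or.inr ⟨h, by rw [pow_succ] at h2; linarith⟩
    refine (Set.encard_le_encard hs).trans ((Set.encard_union_le _ _).trans ?_)
    refine (add_le_add ih (hcount _ (by positivity))).trans ?_
    push_cast
    rw [add_mul, one_mul]

/-- A Vitali argument for the translated balls `B(x + τ i, ℓ i)`. If such a ball meets a selected
ball of radius `r` and `ℓ i ≤ 2 r`, there are two cases. When `ℓ i < r / 2^M`, the shift is at most
`r` and `x` lies in the fourfold selected ball. Otherwise `ℓ i` is one of at most `(M + 2) B`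
scales, and each of them costs one translate of the threefold ball. -/
lemma scaleMaximal_weak_type {ι : Type*} {ℓ τ : ι → ℝ} {B M : ℕ} (hℓ : ∀ i, 0 < ℓ i)
    (hcount : ∀ α : ℝ, 0 < α → {i | α ≤ ℓ i ∧ ℓ i ≤ 2 * α}.encard ≤ B)
    (hτ : ∀ i, |τ i| ≤ 2 ^ M * ℓ i) (F : ℝ → ℝ≥0∞) {c : ℝ≥0∞} (hc0 : c ≠ 0) (hc : c ≠ ⊤) :
    c * volume {x | c < scaleMaximal ℓ τ F x} ≤
      ((8 + 6 * B * (M + 2) : ℕ) : ℝ≥0∞) * ∫⁻ x, F x := by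
  set K : ℕ := 8 + 6 * B * (M + 2) with hK
  have hKpos : (K : ℝ≥0∞) ≠ 0 := by
    simp [hK]
  by_cases hF : ∫⁻ x, F x = ⊤
  · rw [hF, ENNReal.mul_top hKpos]
    exact le_top
  set t : Set (ℝ × ι) := {a | c < avgBall (ℓ a.2) F (a.1 + τ a.2)} with ht
  set Bl : ℝ × ι → Set ℝ := fun a => Metric.closedBall (a.1 + τ a.2) (ℓ a.2) with hBl
  have key : ∀ a ∈ t, c * ENNReal.ofReal (2 * ℓ a.2) ≤ ∫⁻ z in Bl a, F z := by
    intro a ha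
    have h1 : c ≤ (∫⁻ z in Bl a, F z) / ENNReal.ofReal (2 * ℓ a.2) := le_of_lt ha
    exact (ENNReal.le_div_iff_mul_le (Or.inl (by simpa using hℓ a.2))
      (Or.inl ENNReal.ofReal_ne_top)).1 h1
  -- The covering lemma needs bounded radii, which finiteness of `∫ F` provides.
  have hR : ∀ a ∈ t, ℓ a.2 ≤ ((∫⁻ x, F x) / c).toReal := by
    intro a ha
    have h1 : c * ENNReal.ofReal (2 * ℓ a.2) ≤ ∫⁻ z, F z :=
      (key a ha).trans (setLIntegral_le_lintegral _ _)
    have h2 : ENNReal.ofReal (2 * ℓ a.2) ≤ (∫⁻ x, F x) / c := by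
      rw [ENNReal.le_div_iff_mul_le (Or.inl hc0) (Or.inl hc), mul_comm]
      exact h1
    have h3 := (ENNReal.ofReal_le_iff_le_toReal (ENNReal.div_ne_top hF hc0)).1 h2
    linarith [hℓ a.2]
  obtain ⟨u, hut, hdis, hcov⟩ := Vitali.exists_disjoint_subfamily_covering_enlargement Bl t
    (fun a => ℓ a.2) 2 (by norm_num) (fun a _ => (hℓ a.2).le) _ hR
    (fun a _ => ⟨a.1 + τ a.2, Metric.mem_closedBall_self (hℓ a.2).le⟩)
  have hucount : u.Countable := by
    refine hdis.countable_of_nonempty_interior fun a _ => ?_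
    exact ⟨a.1 + τ a.2, interior_mono Metric.ball_subset_closedBall
      (by rw [Metric.isOpen_ball.interior_eq]; exact Metric.mem_ball_self (hℓ a.2))⟩
  set I : ℝ × ι → Set ι := fun b => {i | ℓ b.2 / 2 ^ M ≤ ℓ i ∧
    ℓ i ≤ 2 ^ (M + 1) * (ℓ b.2 / 2 ^ M)} with hI
  -- All points `x` that the selected ball `b` has to account for: those of the small scales, then
  -- those of the comparable scales, translated back by `τ i`.
  set Z : ℝ × ι → Set ℝ := fun b => Metric.closedBall (b.1 + τ b.2) (4 * ℓ b.2) ∪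
    ⋃ i ∈ I b, Metric.closedBall (b.1 + τ b.2 - τ i) (3 * ℓ b.2) with hZ
  have hsub : {x | c < scaleMaximal ℓ τ F x} ⊆ ⋃ b ∈ u, Z b := by
    intro x hx
    obtain ⟨i, hi⟩ := lt_iSup_iff.1 (show c < ⨆ i, avgBall (ℓ i) F (x + τ i) from hx)
    obtain ⟨b, hbu, ⟨z, hz1, hz2⟩, hle⟩ := hcov (x, i) hi
    refine mem_iUnion₂.2 ⟨b, hbu, ?_⟩
    simp only [hBl, Metric.mem_closedBall, Real.dist_eq] at hz1 hz2
    simp only at hle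
    have hd : |x + τ i - (b.1 + τ b.2)| ≤ 3 * ℓ b.2 := by
      have := abs_sub_le (x + τ i) z (b.1 + τ b.2)
      rw [abs_sub_comm (x + τ i) z] at this
      linarith
    have h2M : (0 : ℝ) < 2 ^ M := by positivity
    by_cases hcase : ℓ b.2 / 2 ^ M ≤ ℓ i
    · refine Or.inr (mem_iUnion₂.2 ⟨i, ⟨hcase, ?_⟩, ?_⟩)
      · rw [pow_succ]
        field_simp
        linarith
      · rw [Metric.mem_closedBall, Real.dist_eq]
        convert hd using 2
        ring
    · left
      rw [not_le, lt_div_iff₀ h2M] at hcase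
      have := hτ i
      rw [Metric.mem_closedBall, Real.dist_eq]
      have h5 := abs_sub (x + τ i - (b.1 + τ b.2)) (τ i)
      have h6 : x + τ i - (b.1 + τ b.2) - τ i = x - (b.1 + τ b.2) := by ring
      rw [h6] at h5
      linarith
  have hZle : ∀ b, volume (Z b) ≤ (K : ℝ≥0∞) * ENNReal.ofReal (ℓ b.2) := by
    intro b
    have hIcard : (I b).encard ≤ ((M + 1) * B : ℕ) + B :=
      encard_scales_le hcount (M + 1) (div_pos (hℓ b.2) (by positivity))
    have hIfin : (I b).Finite := by
      refine Set.finite_of_encard_le_coe (k := (M + 1) * B + B) ?_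
      exact_mod_cast hIcard
    have hIcard' : (hIfin.toFinset.card : ℝ≥0∞) ≤ ((M + 2) * B : ℕ) := by
      have h := hIcard
      rw [hIfin.encard_eq_coe_toFinset_card] at h
      have h' : hIfin.toFinset.card ≤ (M + 1) * B + B := by exact_mod_cast h
      exact_mod_cast h'.trans (by ring_nf; rfl)
    have h1 : volume (⋃ i ∈ I b, Metric.closedBall (b.1 + τ b.2 - τ i) (3 * ℓ b.2)) ≤
        ((M + 2) * B : ℕ) * (6 * ENNReal.ofReal (ℓ b.2)) := by
      have : (⋃ i ∈ I b, Metric.closedBall (b.1 + τ b.2 - τ i) (3 * ℓ b.2)) =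
          ⋃ i ∈ hIfin.toFinset, Metric.closedBall (b.1 + τ b.2 - τ i) (3 * ℓ b.2) := by
        simp
      rw [this]
      refine (measure_biUnion_finset_le _ _).trans ?_
      simp only [Real.volume_closedBall, Finset.sum_const, nsmul_eq_mul]
      refine mul_le_mul' hIcard' (le_of_eq ?_)
      rw [show (2 : ℝ) * (3 * ℓ b.2) = 6 * ℓ b.2 by ring,
        ENNReal.ofReal_mul (by norm_num)]
      simp
    refine (measure_union_le _ _).trans ((add_le_add (le_of_eq (Real.volume_closedBall _ _)) h1).trans
      (le_of_eq ?_))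
    rw [show (2 : ℝ) * (4 * ℓ b.2) = 8 * ℓ b.2 by ring, ENNReal.ofReal_mul (by norm_num), hK]
    push_cast
    simp only [ENNReal.ofReal_ofNat]
    ring
  have := hucount.to_subtype
  calc c * volume {x | c < scaleMaximal ℓ τ F x}
      ≤ c * ∑' b : u, volume (Z b) := by
        gcongr
        refine (measure_mono hsub).trans ?_
        exact measure_biUnion_le _ hucount _
    _ = ∑' b : u, c * volume (Z b) := ENNReal.tsum_mul_left.symm
    _ ≤ ∑' b : u, (K : ℝ≥0∞) * ∫⁻ z in Bl b, F z := by
        refine ENNReal.tsum_le_tsum fun b => ?_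
        calc c * volume (Z b) ≤ c * ((K : ℝ≥0∞) * ENNReal.ofReal (ℓ b.1.2)) := by
              gcongr; exact hZle b
          _ = (K : ℝ≥0∞) * (c * ENNReal.ofReal (ℓ b.1.2)) := by ring
          _ ≤ _ := by
            gcongr
            refine le_trans ?_ (key b (hut b.2))
            gcongr
            linarith [hℓ b.1.2]
    _ = (K : ℝ≥0∞) * ∑' b : u, ∫⁻ z in Bl b, F z := ENNReal.tsum_mul_left
    _ = (K : ℝ≥0∞) * ∫⁻ z in ⋃ b ∈ u, Bl b, F z := by
        rw [lintegral_biUnion hucount (fun b _ => Metric.isClosed_closedBall.measurableSet) hdis]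
    _ ≤ (K : ℝ≥0∞) * ∫⁻ x, F x := by
        gcongr
        exact Measure.restrict_le_self

lemma measurable_avgBall (ℓ : ℝ) {F : ℝ → ℝ≥0∞} (hF : Measurable F) :
    Measurable (avgBall ℓ F) := by
  unfold avgBall
  refine Measurable.div_const ?_ _
  have h : ∀ y, ∫⁻ z in Metric.closedBall y ℓ, F z =
      ∫⁻ z, {p : ℝ × ℝ | dist p.2 p.1 ≤ ℓ}.indicator (fun p => F p.2) (y, z) := by
    intro y
    rw [← lintegral_indicator Metric.isClosed_closedBall.measurableSet]
    rfl
  simp_rw [h]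
  refine Measurable.lintegral_prod_right' (f := fun p : ℝ × ℝ =>
    {p : ℝ × ℝ | dist p.2 p.1 ≤ ℓ}.indicator (fun p => F p.2) p) ?_
  refine (hF.comp measurable_snd).indicator ?_
  exact measurableSet_le (by fun_prop) measurable_const

lemma measurable_scaleMaximal {ι : Type*} [Countable ι] (ℓ τ : ι → ℝ) {F : ℝ → ℝ≥0∞}
    (hF : Measurable F) : Measurable (scaleMaximal ℓ τ F) :=
  Measurable.iSup fun i => (measurable_avgBall (ℓ i) hF).comp (measurable_id.add_const _)

lemma avgBall_le_of_le {ℓ : ℝ} {F : ℝ → ℝ≥0∞} {c : ℝ≥0∞} (h : ∀ᵐ z, F z ≤ c)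
    (y : ℝ) : avgBall ℓ F y ≤ c := by
  refine ENNReal.div_le_of_le_mul ?_
  calc ∫⁻ z in Metric.closedBall y ℓ, F z ≤ ∫⁻ _ in Metric.closedBall y ℓ, c :=
        lintegral_mono_ae (ae_restrict_of_ae h)
    _ = c * ENNReal.ofReal (2 * ℓ) := by simp [Real.volume_closedBall]

lemma avgBall_le_add {ℓ : ℝ} {F G : ℝ → ℝ≥0∞} (hG : Measurable G) {c : ℝ≥0∞}
    (h : ∀ z, F z ≤ G z + c) (y : ℝ) : avgBall ℓ F y ≤ avgBall ℓ G y + c := by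
  have h1 : avgBall ℓ F y ≤ avgBall ℓ (fun z => G z + c) y := by
    unfold avgBall
    gcongr
    exact h _
  refine h1.trans ?_
  have h2 := avgBall_le_of_le (ℓ := ℓ) (F := fun _ => c) (c := c) (by simp) y
  unfold avgBall at *
  rw [lintegral_add_left hG, ENNReal.add_div]
  gcongr

lemma lintegral_Ioi_indicator_rpow {p : ℝ} (hp : 1 < p) {a : ℝ} (ha : 0 ≤ a) :
    ∫⁻ t in Ioi (0 : ℝ), (Iio a).indicator (fun t => ENNReal.ofReal (t ^ (p - 2))) t =
      ENNReal.ofReal (a ^ (p - 1) / (p - 1)) := by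
  rw [setLIntegral_indicator measurableSet_Iio, inter_comm, Ioi_inter_Iio,
    ← ofReal_integral_eq_lintegral_ofReal]
  · rw [← integral_Ioc_eq_integral_Ioo, ← intervalIntegral.integral_of_le ha,
      integral_rpow (Or.inl (by linarith))]
    congr 1
    rw [show p - 2 + 1 = p - 1 by ring, Real.zero_rpow (by linarith), sub_zero]
  · have := (intervalIntegral.intervalIntegrable_rpow' (a := 0) (b := a)
      (r := p - 2) (by linarith))
    rw [intervalIntegrable_iff_integrableOn_Ioo_of_le ha] at this
    exact this
  · filter_upwards [ae_restrict_mem measurableSet_Ioo] with t ht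
    exact Real.rpow_nonneg ht.1.le _

/-- Marcinkiewicz interpolation between the weak type bound and the trivial `L^∞` bound: at height
`t` the part of `G` below `t / 2` contributes at most `t / 2` to the maximal function, and the weak
type bound is applied to the rest. -/
lemma scaleMaximal_strong_type {ι : Type*} [Countable ι] {ℓ τ : ι → ℝ} {B M : ℕ}
    (hℓ : ∀ i, 0 < ℓ i)
    (hcount : ∀ α : ℝ, 0 < α → {i | α ≤ ℓ i ∧ ℓ i ≤ 2 * α}.encard ≤ B)
    (hτ : ∀ i, |τ i| ≤ 2 ^ M * ℓ i) {G : ℝ → ℝ} (hGm : Measurable G) (hG0 : ∀ x, 0 ≤ G x)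
    {b : ℝ} (hGb : ∀ x, G x ≤ b) {p : ℝ} (hp : 1 < p) :
    ∫⁻ x, scaleMaximal ℓ τ (fun x => ENNReal.ofReal (G x)) x ^ p ≤
      ((8 + 6 * B * (M + 2) : ℕ) : ℝ≥0∞) * ENNReal.ofReal (p * (2 ^ p / (p - 1))) *
        ∫⁻ x, ENNReal.ofReal (G x) ^ p := by
  set F : ℝ → ℝ≥0∞ := fun x => ENNReal.ofReal (G x) with hF
  have hFm : Measurable F := hGm.ennreal_ofReal
  set K : ℝ≥0∞ := ((8 + 6 * B * (M + 2) : ℕ) : ℝ≥0∞) with hK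
  set N := scaleMaximal ℓ τ F with hN
  have hNm : Measurable N := measurable_scaleMaximal ℓ τ hFm
  -- Boundedness of `G` serves to make the maximal function finite, so that the real-valued layer
  -- cake formula applies to it.
  have hNb : ∀ x, N x ≤ ENNReal.ofReal b := fun x =>
    iSup_le fun i => avgBall_le_of_le
      (Eventually.of_forall fun z => ENNReal.ofReal_le_ofReal (hGb z)) _
  have hNtop : ∀ x, N x ≠ ⊤ := fun x => ne_top_of_le_ne_top ENNReal.ofReal_ne_top (hNb x)
  have hp0 : 0 < p := by linarith
  have hlayer : ∫⁻ x, N x ^ p = ENNReal.ofReal p *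
      ∫⁻ t in Ioi (0 : ℝ), volume {x | t < (N x).toReal} * ENNReal.ofReal (t ^ (p - 1)) := by
    rw [← lintegral_rpow_eq_lintegral_meas_lt_mul volume
      (Eventually.of_forall fun x => ENNReal.toReal_nonneg) hNm.ennreal_toReal.aemeasurable hp0]
    refine lintegral_congr fun x => ?_
    rw [← ENNReal.ofReal_rpow_of_nonneg ENNReal.toReal_nonneg hp0.le,
      ENNReal.ofReal_toReal (hNtop x)]
  have hweak : ∀ t ∈ Ioi (0 : ℝ), volume {x | t < (N x).toReal} * ENNReal.ofReal (t ^ (p - 1)) ≤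
      ∫⁻ x, 2 * K * (F x * (Iio (2 * G x)).indicator
        (fun t => ENNReal.ofReal (t ^ (p - 2))) t) := by
    intro t ht
    have ht0 : (0 : ℝ) < t := ht
    set F1 : ℝ → ℝ≥0∞ := {x | t < 2 * G x}.indicator F with hF1
    have hms : MeasurableSet {x | t < 2 * G x} := measurableSet_lt (by fun_prop) (by fun_prop)
    have hF1m : Measurable F1 := hFm.indicator hms
    have hFle : ∀ z, F z ≤ F1 z + ENNReal.ofReal (t / 2) := by
      intro z
      by_cases hz : t < 2 * G z
      · simp [hF1, hz]
      · simp only [hF1, mem_ofPred_eq, hz, not_false_eq_true, indicator_of_notMem, zero_add, hF]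
        exact ENNReal.ofReal_le_ofReal (by linarith)
    have hsub : {x | t < (N x).toReal} ⊆ {x | ENNReal.ofReal (t / 2) < scaleMaximal ℓ τ F1 x} := by
      intro x hx
      have hx' : ENNReal.ofReal t < N x := (ENNReal.ofReal_lt_iff_lt_toReal ht0.le (hNtop x)).2 hx
      have h2 : N x ≤ scaleMaximal ℓ τ F1 x + ENNReal.ofReal (t / 2) := by
        refine iSup_le fun i => (avgBall_le_add hF1m hFle _).trans ?_
        gcongr
        exact le_iSup (fun i => avgBall (ℓ i) F1 (x + τ i)) i
      by_contra hcon
      simp only [mem_ofPred_eq, not_lt] at hcon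
      have h3 : N x ≤ ENNReal.ofReal t := by
        refine h2.trans ((add_le_add_left hcon _).trans ?_)
        rw [← ENNReal.ofReal_add (by positivity) (by positivity)]
        exact ENNReal.ofReal_le_ofReal (by linarith)
      exact absurd hx' (not_lt.2 h3)
    have hw := scaleMaximal_weak_type hℓ hcount hτ F1 (c := ENNReal.ofReal (t / 2))
      (by simpa using ht0) ENNReal.ofReal_ne_top
    calc volume {x | t < (N x).toReal} * ENNReal.ofReal (t ^ (p - 1))
        ≤ volume {x | ENNReal.ofReal (t / 2) < scaleMaximal ℓ τ F1 x} *
            ENNReal.ofReal (t ^ (p - 1)) := by gcongr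
      _ = ENNReal.ofReal (2 * t ^ (p - 2)) * (ENNReal.ofReal (t / 2) *
            volume {x | ENNReal.ofReal (t / 2) < scaleMaximal ℓ τ F1 x}) := by
          rw [← mul_assoc, ← ENNReal.ofReal_mul (by positivity), mul_comm]
          congr 2
          rw [show p - 1 = (p - 2) + 1 by ring, Real.rpow_add_one ht0.ne']
          ring
      _ ≤ ENNReal.ofReal (2 * t ^ (p - 2)) * (K * ∫⁻ x, F1 x) := by gcongr
      _ = 2 * K * ENNReal.ofReal (t ^ (p - 2)) * ∫⁻ x, F1 x := by
          rw [ENNReal.ofReal_mul (by norm_num)]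
          simp only [ENNReal.ofReal_ofNat]
          ring
      _ = ∫⁻ x, 2 * K * ENNReal.ofReal (t ^ (p - 2)) * F1 x :=
          (lintegral_const_mul _ hF1m).symm
      _ = _ := by
          refine lintegral_congr fun x => ?_
          by_cases hx : t < 2 * G x
          · simp only [hF1, mem_ofPred_eq, hx, indicator_of_mem, mem_Iio]
            ring
          · simp [hF1, hx]
  have hmeas2 : Measurable fun q : ℝ × ℝ => 2 * K * (F q.2 * (Iio (2 * G q.2)).indicator
        (fun t => ENNReal.ofReal (t ^ (p - 2))) q.1) := by
    refine Measurable.const_mul ((hFm.comp measurable_snd).mul ?_) _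
    have : (fun q : ℝ × ℝ => (Iio (2 * G q.2)).indicator
        (fun t => ENNReal.ofReal (t ^ (p - 2))) q.1) =
        {q : ℝ × ℝ | q.1 < 2 * G q.2}.indicator (fun q => ENNReal.ofReal (q.1 ^ (p - 2))) := by
      ext q
      rfl
    rw [this]
    refine Measurable.indicator (by fun_prop) ?_
    exact measurableSet_lt (by fun_prop) (by fun_prop)
  calc ∫⁻ x, N x ^ p
      ≤ ENNReal.ofReal p * ∫⁻ t in Ioi (0 : ℝ), ∫⁻ x, 2 * K * (F x *
          (Iio (2 * G x)).indicator (fun t => ENNReal.ofReal (t ^ (p - 2))) t) := by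
        rw [hlayer]
        exact mul_le_mul_right (setLIntegral_mono' measurableSet_Ioi hweak) _
    -- Tonelli: the inner integral over `0 < t < 2 G x` can now be computed.
    _ = ENNReal.ofReal p * ∫⁻ x, ∫⁻ t in Ioi (0 : ℝ), 2 * K * (F x *
          (Iio (2 * G x)).indicator (fun t => ENNReal.ofReal (t ^ (p - 2))) t) := by
        rw [lintegral_lintegral_swap hmeas2.aemeasurable]
    _ = ENNReal.ofReal p * ∫⁻ x, 2 * K * ENNReal.ofReal (2 ^ (p - 1) / (p - 1)) * F x ^ p := by
        congr 1
        refine lintegral_congr fun x => ?_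
        rw [lintegral_const_mul' _ _ (by simp [hK, ENNReal.mul_eq_top]),
          lintegral_const_mul' _ _ (by simp [hF]),
          lintegral_Ioi_indicator_rpow hp (by linarith [hG0 x]),
          Real.mul_rpow (by norm_num) (hG0 x), hF,
          ENNReal.ofReal_rpow_of_nonneg (hG0 x) hp0.le, mul_assoc (2 * K),
          ← ENNReal.ofReal_mul (hG0 x), ← ENNReal.ofReal_mul (by
            have : 0 < p - 1 := by linarith
            positivity)]
        congr 2
        rcases (hG0 x).eq_or_lt with h | h
        · rw [← h]
          simp [Real.zero_rpow hp0.ne']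
        · rw [show G x ^ p = G x ^ (p - 1) * G x by
            rw [← Real.rpow_add_one h.ne']; ring_nf]
          ring
    _ = _ := by
        rw [lintegral_const_mul' _ _ (by simp [hK, ENNReal.mul_eq_top]), ENNReal.ofReal_mul hp0.le,
          show (2 : ℝ) ^ p / (p - 1) = 2 * (2 ^ (p - 1) / (p - 1)) by
            rw [show (2 : ℝ) ^ p = 2 ^ (p - 1) * 2 by
              rw [← Real.rpow_add_one (by norm_num)]; ring_nf]
            ring, ENNReal.ofReal_mul (by norm_num : (0 : ℝ) ≤ 2)]
        simp only [ENNReal.ofReal_ofNat]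
        ring

end
end BilinearMax

/-! ### Hölder and Minkowski in extended nonnegative form, and kernel averages. -/

namespace BilinearMax
noncomputable section

lemma eLpNorm_mul_le_ennreal {α : Type*} [MeasurableSpace α] {μ : Measure α} {p q r : ℝ≥0∞}
    (hp : 1 < p) (hq : 1 < q) (hr : 1 ≤ r) (hpqr : p⁻¹ + q⁻¹ = r⁻¹) {F G : α → ℝ≥0∞}
    (hF : Measurable F) (hG : Measurable G) :
    eLpNorm (fun x => F x * G x) r μ ≤ eLpNorm F p μ * eLpNorm G q μ := by
  have hp0 : p ≠ 0 := (zero_lt_one.trans hp).ne'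
  have hq0 : q ≠ 0 := (zero_lt_one.trans hq).ne'
  have hr0 : r ≠ 0 := (zero_lt_one.trans_le hr).ne'
  -- The endpoint with one exponent infinite, outside the scope of Hölder for real exponents.
  have aux : ∀ (s : ℝ≥0∞) {F G : α → ℝ≥0∞} (_ : Measurable G),
      eLpNorm (fun x => F x * G x) s μ ≤ eLpNorm F ⊤ μ * eLpNorm G s μ := by
    intro s F G hG
    rcases eq_or_ne s 0 with rfl | hs0
    · simp
    rcases eq_or_ne s ⊤ with rfl | hst
    · simp only [eLpNorm_exponent_top, eLpNormEssSup_eq_essSup_enorm, enorm_eq_self]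
      exact ENNReal.essSup_mul_le F G
    · have hsr : 0 < s.toReal := ENNReal.toReal_pos hs0 hst
      rw [eLpNorm_eq_lintegral_rpow_enorm_toReal hs0 hst,
        eLpNorm_eq_lintegral_rpow_enorm_toReal hs0 hst]
      simp only [one_div]
      rw [ENNReal.rpow_inv_le_iff hsr, ENNReal.mul_rpow_of_nonneg _ _ hsr.le,
        ENNReal.rpow_inv_rpow hsr.ne', ← lintegral_const_mul _ (by fun_prop)]
      refine lintegral_mono_ae ?_
      filter_upwards [ae_le_eLpNormEssSup (f := F) (μ := μ)] with x hx
      simp only [enorm_eq_self] at hx ⊢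
      rw [← ENNReal.mul_rpow_of_nonneg _ _ hsr.le]
      gcongr
      simpa using hx
  rcases eq_or_ne p ⊤ with rfl | hpt
  · have : r = q := by simpa [eq_comm] using hpqr
    subst this
    exact aux r hG
  rcases eq_or_ne q ⊤ with rfl | hqt
  · have : r = p := by simpa [eq_comm] using hpqr
    subst this
    rw [mul_comm]
    simpa only [mul_comm] using aux r hF
  have hrt : r ≠ ⊤ := by
    rintro rfl
    simp [hpt, hqt] at hpqr
  have hpr := ENNReal.toReal_pos hp0 hpt
  have hqr := ENNReal.toReal_pos hq0 hqt
  have hrr := ENNReal.toReal_pos hr0 hrt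
  have hreal : 1 / r.toReal = 1 / p.toReal + 1 / q.toReal := by
    have h := congrArg ENNReal.toReal hpqr
    rw [ENNReal.toReal_add (by simpa using hp0) (by simpa using hq0)] at h
    simpa using h.symm
  have hrp : r.toReal < p.toReal := by
    refine lt_of_one_div_lt_one_div hpr ?_
    rw [hreal]
    have : 0 < 1 / q.toReal := by positivity
    linarith
  rw [eLpNorm_eq_lintegral_rpow_enorm_toReal hp0 hpt,
    eLpNorm_eq_lintegral_rpow_enorm_toReal hq0 hqt,
    eLpNorm_eq_lintegral_rpow_enorm_toReal hr0 hrt]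
  simpa only [enorm_eq_self, Pi.mul_apply] using
    ENNReal.lintegral_Lp_mul_le_Lq_mul_Lr hrr hrp hreal μ hF.aemeasurable hG.aemeasurable

lemma lintegral_rpow_le_jensen {T : Type*} [MeasurableSpace T] (ν : Measure T) {H : T → ℝ≥0∞}
    (hH : AEMeasurable H ν) {r : ℝ} (hr : 1 ≤ r) :
    (∫⁻ t, H t ∂ν) ^ r ≤ ν univ ^ (r - 1) * ∫⁻ t, H t ^ r ∂ν := by
  rcases hr.eq_or_lt with rfl | hr1
  · simp
  have hr0 : 0 < r := by linarith
  have hc : r.HolderConjugate (r / (r - 1)) := Real.HolderConjugate.conjExponent hr1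
  have h := ENNReal.lintegral_mul_le_Lp_mul_Lq ν hc hH (aemeasurable_const (b := 1))
  simp only [Pi.mul_apply, mul_one, ENNReal.one_rpow, lintegral_const, one_mul] at h
  calc (∫⁻ t, H t ∂ν) ^ r
      ≤ ((∫⁻ t, H t ^ r ∂ν) ^ (1 / r) * ν univ ^ (1 / (r / (r - 1)))) ^ r := by gcongr
    _ = _ := by
      rw [ENNReal.mul_rpow_of_nonneg _ _ hr0.le, ← ENNReal.rpow_mul, ← ENNReal.rpow_mul,
        one_div_mul_cancel hr0.ne', ENNReal.rpow_one, mul_comm]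
      congr 2
      have : r - 1 ≠ 0 := by linarith
      field_simp

/-- Minkowski's integral inequality, for a family with uniformly bounded norms. -/
lemma eLpNorm_lintegral_le {T α : Type*} [MeasurableSpace T] [MeasurableSpace α] {ν : Measure T}
    [SFinite ν] {μ : Measure α} [SFinite μ] {H : T → α → ℝ≥0∞}
    (hH : Measurable (Function.uncurry H)) {r : ℝ≥0∞} (hr : 1 ≤ r) {K : ℝ≥0∞}
    (hK : ∀ᵐ t ∂ν, eLpNorm (H t) r μ ≤ K) :
    eLpNorm (fun x => ∫⁻ t, H t x ∂ν) r μ ≤ ν univ * K := by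
  have hr0 : r ≠ 0 := (zero_lt_one.trans_le hr).ne'
  rcases eq_or_ne r ⊤ with rfl | hrt
  · have h1 : ∀ᵐ t ∂ν, ∀ᵐ x ∂μ, H t x ≤ K := by
      filter_upwards [hK] with t ht
      filter_upwards [ae_le_eLpNormEssSup (f := H t) (μ := μ)] with x hx
      simpa using hx.trans ht
    have h2 : ∀ᵐ x ∂μ, ∀ᵐ t ∂ν, H t x ≤ K := by
      exact (Measure.ae_ae_comm (p := fun t x => H t x ≤ K)
        (measurableSet_le hH measurable_const)).1 h1
    rw [eLpNorm_exponent_top]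
    refine eLpNormEssSup_le_of_ae_enorm_bound ?_
    filter_upwards [h2] with x hx
    calc ‖∫⁻ t, H t x ∂ν‖ₑ = ∫⁻ t, H t x ∂ν := enorm_eq_self _
      _ ≤ ∫⁻ _, K ∂ν := lintegral_mono_ae hx
      _ = ν univ * K := by rw [lintegral_const, mul_comm]
  · have hrr := ENNReal.toReal_pos hr0 hrt
    have hr1 : 1 ≤ r.toReal := by
      rw [← ENNReal.toReal_one]
      exact (ENNReal.toReal_le_toReal (by simp) hrt).2 hr
    have hK' : ∀ᵐ t ∂ν, ∫⁻ x, H t x ^ r.toReal ∂μ ≤ K ^ r.toReal := by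
      filter_upwards [hK] with t ht
      rw [eLpNorm_eq_lintegral_rpow_enorm_toReal hr0 hrt, one_div,
        ENNReal.rpow_inv_le_iff hrr] at ht
      simpa using ht
    rw [eLpNorm_eq_lintegral_rpow_enorm_toReal hr0 hrt, one_div, ENNReal.rpow_inv_le_iff hrr]
    simp only [enorm_eq_self]
    calc ∫⁻ x, (∫⁻ t, H t x ∂ν) ^ r.toReal ∂μ
        ≤ ∫⁻ x, ν univ ^ (r.toReal - 1) * ∫⁻ t, H t x ^ r.toReal ∂ν ∂μ :=
          lintegral_mono fun x => lintegral_rpow_le_jensen ν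
            (hH.comp measurable_prodMk_right).aemeasurable hr1
      _ = ν univ ^ (r.toReal - 1) * ∫⁻ x, ∫⁻ t, H t x ^ r.toReal ∂ν ∂μ := by
          refine lintegral_const_mul _ ?_
          exact Measurable.lintegral_prod_left' (f := fun q : T × α => H q.1 q.2 ^ r.toReal)
            (hH.pow_const _)
      _ = ν univ ^ (r.toReal - 1) * ∫⁻ t, ∫⁻ x, H t x ^ r.toReal ∂μ ∂ν := by
          rw [lintegral_lintegral_swap]
          exact ((hH.comp measurable_swap).pow_const _).aemeasurable
      _ ≤ ν univ ^ (r.toReal - 1) * ∫⁻ _, K ^ r.toReal ∂ν := by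
          exact mul_le_mul_right (lintegral_mono_ae hK') _
      _ = (ν univ * K) ^ r.toReal := by
          rw [lintegral_const, ENNReal.mul_rpow_of_nonneg _ _ hrr.le, mul_comm (K ^ _),
            ← mul_assoc]
          congr 1
          nth_rewrite 2 [← ENNReal.rpow_one (ν univ)]
          rw [← ENNReal.rpow_add_of_nonneg _ _ (by linarith) zero_le_one]
          congr 1
          ring

/-- Minkowski's integral inequality for the measure with mass `c i` at `i`. -/
lemma eLpNorm_tsum_le {ι α : Type*} [Countable ι] [MeasurableSpace α] {μ : Measure α} [SFinite μ]
    {H : ι → α → ℝ≥0∞} (hH : ∀ i, Measurable (H i)) {r : ℝ≥0∞} (hr : 1 ≤ r) (c : ι → ℝ≥0)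
    {K : ℝ≥0∞} (hK : ∀ i, eLpNorm (H i) r μ ≤ K) :
    eLpNorm (fun x => ∑' i, (c i : ℝ≥0∞) * H i x) r μ ≤ (∑' i, (c i : ℝ≥0∞)) * K := by
  let : MeasurableSpace ι := ⊤
  set ν : Measure ι := Measure.sum fun i => c i • Measure.dirac i with hν
  have h1 : ∀ f : ι → ℝ≥0∞, ∫⁻ i, f i ∂ν = ∑' i, (c i : ℝ≥0∞) * f i := by
    intro f
    rw [hν, lintegral_sum_measure]
    refine tsum_congr fun i => ?_
    rw [lintegral_smul_measure, lintegral_dirac]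
    rfl
  have h2 : ν univ = ∑' i, (c i : ℝ≥0∞) := by
    have := h1 fun _ => 1
    simpa using this
  have hm : Measurable (Function.uncurry H) := measurable_from_prod_countable_right hH
  have := eLpNorm_lintegral_le (ν := ν) (μ := μ) hm hr (Eventually.of_forall hK)
  simpa only [h1, h2] using this

/-- The average of `F` against the kernel `ℓ⁻¹ (1 + (z / ℓ)²)⁻¹`. -/
def avgKernel (ℓ : ℝ) (F : ℝ → ℝ≥0∞) (y : ℝ) : ℝ≥0∞ :=
  ∫⁻ z, ENNReal.ofReal (ℓ⁻¹ / (1 + ((y - z) / ℓ) ^ 2)) * F z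

/-- The weights in the decomposition of the kernel of `avgKernel` into balls. -/
def ballWeight (i : ℕ) : ℝ≥0 := 8 * (1 / 2) ^ i

lemma tsum_ballWeight : ∑' i, (ballWeight i : ℝ≥0∞) = 16 := by
  have h : HasSum ballWeight (8 * 2) := by
    unfold ballWeight
    have := NNReal.hasSum_geometric (r := 1 / 2) (by
      rw [← NNReal.coe_lt_coe]; norm_num)
    have h2 : (1 - 1 / 2 : ℝ≥0)⁻¹ = 2 := by
      rw [← NNReal.coe_inj, NNReal.coe_inv, NNReal.coe_sub (by
        rw [← NNReal.coe_le_coe]; norm_num)]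
      norm_num
    rw [h2] at this
    exact this.mul_left 8
  rw [← ENNReal.coe_tsum h.summable, h.tsum_eq]
  norm_num

/-- One term suffices: for the least `i` with `|s / ℓ| ≤ 2^i`, minimality gives `4^i ≤ 4 (1 + (s /
ℓ)^2)`, and the weight `8 · 2^{-i}` over the length `2 · 2^i ℓ` is `4 · 4^{-i} / ℓ`. -/
lemma kernel_le_tsum_ball {ℓ : ℝ} (hℓ : 0 < ℓ) (s : ℝ) :
    ENNReal.ofReal (ℓ⁻¹ / (1 + (s / ℓ) ^ 2)) ≤ ∑' i : ℕ, (ballWeight i : ℝ≥0∞) *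
      (Metric.closedBall (0 : ℝ) (2 ^ i * ℓ)).indicator
        (fun _ => (ENNReal.ofReal (2 * (2 ^ i * ℓ)))⁻¹) s := by
  have hex : ∃ i : ℕ, |s / ℓ| ≤ 2 ^ i := by
    obtain ⟨i, hi⟩ := pow_unbounded_of_one_lt |s / ℓ| (one_lt_two)
    exact ⟨i, hi.le⟩
  classical
  set i := Nat.find hex with hi
  have h1 : |s / ℓ| ≤ 2 ^ i := Nat.find_spec hex
  have h2 : (4 : ℝ) ^ i ≤ 4 * (1 + (s / ℓ) ^ 2) := by
    rcases Nat.eq_zero_or_pos i with h0 | h0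
    · rw [h0]
      nlinarith [sq_nonneg (s / ℓ)]
    · have h3 : ¬ |s / ℓ| ≤ 2 ^ (i - 1) := Nat.find_min hex (by omega)
      rw [not_le] at h3
      have h4 : ((2 : ℝ) ^ (i - 1)) ^ 2 ≤ (s / ℓ) ^ 2 := by
        rw [← sq_abs (s / ℓ)]
        gcongr
      have h5 : (4 : ℝ) ^ i = 4 * ((2 : ℝ) ^ (i - 1)) ^ 2 := by
        rw [← pow_mul, mul_comm (i - 1), pow_mul]
        norm_num
        rw [← pow_succ', Nat.sub_add_cancel h0]
      linarith
  refine le_trans ?_ (ENNReal.le_tsum i)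
  have hmem : s ∈ Metric.closedBall (0 : ℝ) (2 ^ i * ℓ) := by
    rw [Metric.mem_closedBall, dist_zero_right, Real.norm_eq_abs]
    rwa [abs_div, abs_of_pos hℓ, div_le_iff₀ hℓ] at h1
  rw [indicator_of_mem hmem, ← ENNReal.ofReal_inv_of_pos (by positivity),
    show (ballWeight i : ℝ≥0∞) = ENNReal.ofReal (8 * (1 / 2) ^ i) by
      rw [ENNReal.ofReal, ENNReal.coe_inj, ballWeight, ← NNReal.coe_inj,
        Real.coe_toNNReal _ (by positivity)]
      simp, ← ENNReal.ofReal_mul (by positivity)]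
  refine ENNReal.ofReal_le_ofReal ?_
  have h4 : (4 : ℝ) ^ i = 2 ^ i * 2 ^ i := by
    rw [← mul_pow]
    norm_num
  rw [div_le_iff₀ (by positivity), one_div, inv_pow]
  field_simp
  have h5 : (s / ℓ) ^ 2 * ℓ ^ 2 = s ^ 2 := by
    rw [← mul_pow, div_mul_cancel₀ _ hℓ.ne']
  nlinarith [mul_le_mul_of_nonneg_right h2 (sq_nonneg ℓ)]

lemma avgKernel_le_tsum {ℓ : ℝ} (hℓ : 0 < ℓ) {F : ℝ → ℝ≥0∞} (hF : Measurable F) (y : ℝ) :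
    avgKernel ℓ F y ≤ ∑' i : ℕ, (ballWeight i : ℝ≥0∞) * avgBall (2 ^ i * ℓ) F y := by
  have hind : ∀ (i : ℕ) (z : ℝ), (Metric.closedBall (0 : ℝ) (2 ^ i * ℓ)).indicator
      (fun _ => (ENNReal.ofReal (2 * (2 ^ i * ℓ)))⁻¹) (y - z) * F z =
      (ENNReal.ofReal (2 * (2 ^ i * ℓ)))⁻¹ *
        (Metric.closedBall y (2 ^ i * ℓ)).indicator F z := by
    intro i z
    have : y - z ∈ Metric.closedBall (0 : ℝ) (2 ^ i * ℓ) ↔ z ∈ Metric.closedBall y (2 ^ i * ℓ) := by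
      simp [Metric.mem_closedBall, Real.dist_eq, abs_sub_comm]
    by_cases h : z ∈ Metric.closedBall y (2 ^ i * ℓ)
    · rw [indicator_of_mem h, indicator_of_mem (this.2 h)]
    · rw [indicator_of_notMem h, indicator_of_notMem (fun h' => h (this.1 h'))]
      simp
  calc avgKernel ℓ F y
      ≤ ∫⁻ z, (∑' i : ℕ, (ballWeight i : ℝ≥0∞) *
          (Metric.closedBall (0 : ℝ) (2 ^ i * ℓ)).indicator
            (fun _ => (ENNReal.ofReal (2 * (2 ^ i * ℓ)))⁻¹) (y - z)) * F z :=
        lintegral_mono fun z => mul_le_mul_left (kernel_le_tsum_ball hℓ _) _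
    _ = ∫⁻ z, ∑' i : ℕ, (ballWeight i : ℝ≥0∞) * ((ENNReal.ofReal (2 * (2 ^ i * ℓ)))⁻¹ *
          (Metric.closedBall y (2 ^ i * ℓ)).indicator F z) := by
        refine lintegral_congr fun z => ?_
        rw [← ENNReal.tsum_mul_right]
        refine tsum_congr fun i => ?_
        rw [mul_assoc, hind]
    _ = _ := by
        have hm : ∀ i : ℕ, Measurable ((Metric.closedBall y (2 ^ i * ℓ)).indicator F) :=
          fun i => hF.indicator Metric.isClosed_closedBall.measurableSet
        rw [lintegral_tsum fun i => (((hm i).const_mul _).const_mul _).aemeasurable]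
        refine tsum_congr fun i => ?_
        rw [lintegral_const_mul _ ((hm i).const_mul _), lintegral_const_mul _ (hm i),
          lintegral_indicator Metric.isClosed_closedBall.measurableSet, avgBall,
          ENNReal.div_eq_inv_mul]

lemma measurable_avgKernel (ℓ : ℝ) {F : ℝ → ℝ≥0∞} (hF : Measurable F) :
    Measurable (avgKernel ℓ F) := by
  unfold avgKernel
  refine Measurable.lintegral_prod_right' (f := fun p : ℝ × ℝ =>
    ENNReal.ofReal (ℓ⁻¹ / (1 + ((p.1 - p.2) / ℓ) ^ 2)) * F p.2) ?_
  fun_prop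

/-- The maximal function of the kernel averages over countably many shifted scales. -/
def kernelMaximal {ι : Type*} (ℓ τ : ι → ℝ) (F : ℝ → ℝ≥0∞) (x : ℝ) : ℝ≥0∞ :=
  ⨆ i, avgKernel (ℓ i) F (x + τ i)

lemma kernelMaximal_le {ι : Type*} {ℓ τ : ι → ℝ} (hℓ : ∀ i, 0 < ℓ i) {F : ℝ → ℝ≥0∞}
    (hF : Measurable F) (x : ℝ) :
    kernelMaximal ℓ τ F x ≤
      ∑' k : ℕ, (ballWeight k : ℝ≥0∞) * scaleMaximal (fun i => 2 ^ k * ℓ i) τ F x := by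
  refine iSup_le fun i => (avgKernel_le_tsum (hℓ i) hF _).trans (ENNReal.tsum_le_tsum fun k => ?_)
  exact mul_le_mul_right (le_iSup (fun i => avgBall (2 ^ k * ℓ i) F (x + τ i)) i) _

/-- The quantifiers matter: `A` depends on `p` and `B` only, not on the family of scales nor on `M`.
-/
lemma eLpNorm_scaleMaximal_le {p : ℝ≥0∞} (hp : 1 < p) (B : ℕ) :
    ∃ A : ℝ≥0, ∀ (ι : Type) (_ : Countable ι) (ℓ τ : ι → ℝ) (M : ℕ), (∀ i, 0 < ℓ i) →
      (∀ α : ℝ, 0 < α → {i | α ≤ ℓ i ∧ ℓ i ≤ 2 * α}.encard ≤ B) →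
      (∀ i, |τ i| ≤ 2 ^ M * ℓ i) → ∀ (f : ℝ → ℂ) (b : ℝ), Measurable f → (∀ x, ‖f x‖ ≤ b) →
        eLpNorm (scaleMaximal ℓ τ fun x => ‖f x‖ₑ) p volume ≤
          A * (M + 2 : ℕ) * eLpNorm f p volume := by
  rcases eq_or_ne p ⊤ with rfl | hpt
  · refine ⟨1, fun ι _ ℓ τ M hℓ hcount hτ f b hf hb => ?_⟩
    have h1 : eLpNorm (scaleMaximal ℓ τ fun x => ‖f x‖ₑ) ⊤ volume ≤ eLpNorm f ⊤ volume := by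
      rw [eLpNorm_exponent_top]
      refine eLpNormEssSup_le_of_ae_enorm_bound (Eventually.of_forall fun x => ?_)
      rw [enorm_eq_self]
      exact iSup_le fun i => avgBall_le_of_le (enorm_ae_le_eLpNormEssSup f volume) _
    refine h1.trans ?_
    rw [ENNReal.coe_one, one_mul]
    exact le_mul_of_one_le_left (zero_le) (by exact_mod_cast (by omega : 1 ≤ M + 2))
  have hp0 : p ≠ 0 := (zero_lt_one.trans hp).ne'
  have hpr : 1 < p.toReal := by
    rw [← ENNReal.toReal_one]
    exact (ENNReal.toReal_lt_toReal (by simp) hpt).2 hp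
  have hpr0 : 0 < p.toReal := by linarith
  set c : ℝ := p.toReal * (2 ^ p.toReal / (p.toReal - 1)) with hc
  -- The summand `1` ensures `A (M + 2) ≥ 1`, so the factor linear in `M` that the strong type bound
  -- puts on the `p`-th powers is at most `(A (M + 2))^p`.
  set A : ℝ≥0 := 1 + (8 + 6 * B) * c.toNNReal with hA
  refine ⟨A, fun ι _ ℓ τ M hℓ hcount hτ f b hf hb => ?_⟩
  have hs := scaleMaximal_strong_type hℓ hcount hτ hf.norm (fun x => norm_nonneg _) hb hpr
  simp only [ofReal_norm] at hs
  rw [eLpNorm_eq_lintegral_rpow_enorm_toReal hp0 hpt,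
    eLpNorm_eq_lintegral_rpow_enorm_toReal hp0 hpt, one_div, ENNReal.rpow_inv_le_iff hpr0,
    ENNReal.mul_rpow_of_nonneg _ _ hpr0.le, ENNReal.rpow_inv_rpow hpr0.ne']
  simp only [enorm_eq_self]
  refine hs.trans (mul_le_mul_left ?_ _)
  have h1 : (((8 + 6 * B * (M + 2) : ℕ) : ℝ≥0∞) * ENNReal.ofReal c) ≤
      (A : ℝ≥0∞) * (M + 2 : ℕ) := by
    rw [ENNReal.ofReal]
    norm_cast
    rw [hA]
    push_cast
    have h2 : (0 : ℝ≥0) ≤ c.toNNReal := zero_le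
    have h3 : (8 + 6 * (B : ℝ≥0) * (M + 2)) * c.toNNReal ≤
        ((8 + 6 * B) * c.toNNReal) * (M + 2) := by
      calc (8 + 6 * (B : ℝ≥0) * (M + 2)) * c.toNNReal
          ≤ (8 * (M + 2) + 6 * (B : ℝ≥0) * (M + 2)) * c.toNNReal := by
            gcongr
            refine le_mul_of_one_le_right zero_le ?_
            exact_mod_cast (by omega : 1 ≤ M + 2)
        _ = _ := by ring
    refine h3.trans ?_
    gcongr
    exact le_add_of_nonneg_left zero_le
  have h2 : (1 : ℝ≥0∞) ≤ (A : ℝ≥0∞) * (M + 2 : ℕ) := by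
    rw [hA]
    norm_cast
    refine one_le_mul ?_ ?_
    · exact le_add_of_nonneg_right zero_le
    · exact_mod_cast (by omega : 1 ≤ M + 2)
  calc _ ≤ (A : ℝ≥0∞) * (M + 2 : ℕ) := h1
    _ = ((A : ℝ≥0∞) * (M + 2 : ℕ)) ^ (1 : ℝ) := (ENNReal.rpow_one _).symm
    _ ≤ _ := ENNReal.rpow_le_rpow_of_exponent_le h2 hpr.le

/-- Multiplying all radii by `2^k` preserves the count `B`, and the shifts remain within `2^M`
radii. The ball estimate is therefore uniform in `k` and can be summed against the ball weights. -/
lemma eLpNorm_kernelMaximal_le {p : ℝ≥0∞} (hp : 1 < p) (B : ℕ) :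
    ∃ A : ℝ≥0, ∀ (ι : Type) (_ : Countable ι) (ℓ τ : ι → ℝ) (M : ℕ), (∀ i, 0 < ℓ i) →
      (∀ α : ℝ, 0 < α → {i | α ≤ ℓ i ∧ ℓ i ≤ 2 * α}.encard ≤ B) →
      (∀ i, |τ i| ≤ 2 ^ M * ℓ i) → ∀ (f : ℝ → ℂ) (b : ℝ), Measurable f → (∀ x, ‖f x‖ ≤ b) →
        eLpNorm (kernelMaximal ℓ τ fun x => ‖f x‖ₑ) p volume ≤
          A * (M + 2 : ℕ) * eLpNorm f p volume := by
  obtain ⟨A, hA⟩ := eLpNorm_scaleMaximal_le hp B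
  refine ⟨16 * A, fun ι _ ℓ τ M hℓ hcount hτ f b hf hb => ?_⟩
  have h1 : ∀ k : ℕ, eLpNorm (scaleMaximal (fun i => 2 ^ k * ℓ i) τ fun x => ‖f x‖ₑ) p volume ≤
      A * (M + 2 : ℕ) * eLpNorm f p volume := by
    intro k
    have h2k : (0 : ℝ) < 2 ^ k := by positivity
    refine hA ι ‹_› _ τ M (fun i => mul_pos h2k (hℓ i)) (fun α hα => ?_) (fun i => ?_) f b hf hb
    · refine (Set.encard_le_encard ?_).trans (hcount (α / 2 ^ k) (by positivity))
      rintro i ⟨h1, h2⟩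
      refine ⟨?_, ?_⟩
      · rw [div_le_iff₀ h2k]
        linarith
      · rw [← mul_div_assoc, le_div_iff₀ h2k]
        linarith
    · refine (hτ i).trans ?_
      have : ℓ i ≤ 2 ^ k * ℓ i := le_mul_of_one_le_left (hℓ i).le (one_le_pow₀ one_le_two)
      gcongr
  calc eLpNorm (kernelMaximal ℓ τ fun x => ‖f x‖ₑ) p volume
      ≤ eLpNorm (fun x => ∑' k : ℕ, (ballWeight k : ℝ≥0∞) *
          scaleMaximal (fun i => 2 ^ k * ℓ i) τ (fun x => ‖f x‖ₑ) x) p volume :=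
        eLpNorm_mono_enorm fun x => by
          simpa only [enorm_eq_self] using kernelMaximal_le hℓ hf.enorm x
    _ ≤ (∑' k, (ballWeight k : ℝ≥0∞)) * (A * (M + 2 : ℕ) * eLpNorm f p volume) :=
        eLpNorm_tsum_le (fun k => measurable_scaleMaximal _ _ hf.enorm) hp.le _ h1
    _ = _ := by
        rw [tsum_ballWeight]
        push_cast
        ring

lemma avgKernel_le_of_forall {ℓ : ℝ} (hℓ : 0 < ℓ) {F : ℝ → ℝ≥0∞} (hF : Measurable F) {y : ℝ}
    {c : ℝ≥0∞} (h : ∀ k : ℕ, avgBall (2 ^ k * ℓ) F y ≤ c) : avgKernel ℓ F y ≤ 16 * c := by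
  refine (avgKernel_le_tsum hℓ hF y).trans ?_
  rw [← tsum_ballWeight, ← ENNReal.tsum_mul_right]
  exact ENNReal.tsum_le_tsum fun k => mul_le_mul_right (h k) _

/-- The ball is the interval `[x - ℓ, x + ℓ]`, of length `2 ℓ`, moved by `τ / (2 ℓ)` times its
length. -/
lemma avgBall_le_grandMaximal {ℓ c τ : ℝ} (hℓ : 0 < ℓ) (hτ : |τ| ≤ c * (2 * ℓ)) (f : ℝ → ℂ)
    (x : ℝ) : avgBall ℓ (fun y => ‖f y‖ₑ) (x + τ) ≤ grandMaximal c f x := by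
  have hw : |τ / (2 * ℓ)| ≤ c := by
    rw [abs_div, abs_of_pos (by positivity : 0 < 2 * ℓ), div_le_iff₀ (by positivity)]
    exact hτ
  refine le_trans ?_ (le_iSup₂ (f := fun (w : ℝ) (_ : |w| ≤ c) => shiftedMaximal w f x) _ hw)
  refine le_trans ?_ (le_iSup_of_le (x - ℓ) (le_iSup_of_le (x + ℓ) (le_iSup_of_le
    ⟨by linarith, by linarith, by linarith⟩ le_rfl)))
  have h1 : x + ℓ - (x - ℓ) = 2 * ℓ := by ring
  rw [h1, div_mul_cancel₀ _ (by positivity), avgBall, Real.closedBall_eq_Icc]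
  rw [show x + τ - ℓ = x - ℓ + τ by ring, show x + τ + ℓ = x + ℓ + τ by ring]

/-- The larger balls in the decomposition of the kernel have the same shift, which is even smaller
relative to their radii. -/
lemma avgKernel_le_grandMaximal {ℓ c τ : ℝ} (hℓ : 0 < ℓ) (hc : 0 ≤ c) (hτ : |τ| ≤ c * ℓ)
    {f : ℝ → ℂ} (hf : Measurable f) (x : ℝ) :
    avgKernel ℓ (fun y => ‖f y‖ₑ) (x + τ) ≤ 16 * grandMaximal c f x := by
  refine avgKernel_le_of_forall hℓ hf.enorm fun k => ?_
  refine avgBall_le_grandMaximal (by positivity) (hτ.trans ?_) f x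
  have : (1 : ℝ) ≤ 2 ^ k := one_le_pow₀ one_le_two
  have : ℓ ≤ 2 * (2 ^ k * ℓ) := by nlinarith
  gcongr

end
end BilinearMax

/-! ### Frequency cutoffs times powers, and the kernels of their Fourier multipliers. -/

namespace BilinearMax
noncomputable section

lemma integral_mul_exp_ibp {h : ℝ → ℝ} (hh : ContDiff ℝ 1 h) (hc : HasCompactSupport h) (s : ℝ) :
    Complex.I * s * ∫ u : ℝ, (h u : ℂ) * Complex.exp (Complex.I * s * u) =
      -∫ u : ℝ, ((deriv h u : ℝ) : ℂ) * Complex.exp (Complex.I * s * u) := by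
  have hd : ∀ u : ℝ, HasDerivAt (fun u : ℝ => (h u : ℂ) * Complex.exp (Complex.I * s * u))
      (((deriv h u : ℝ) : ℂ) * Complex.exp (Complex.I * s * u) +
        Complex.I * s * ((h u : ℂ) * Complex.exp (Complex.I * s * u))) u := by
    intro u
    have h1 : HasDerivAt (fun u : ℝ => (h u : ℂ)) ((deriv h u : ℝ) : ℂ) u :=
      ((hh.differentiable one_ne_zero u).hasDerivAt).ofReal_comp
    have h2 : HasDerivAt (fun u : ℝ => Complex.exp (Complex.I * s * u))
        (Complex.exp (Complex.I * s * u) * (Complex.I * s * 1)) u :=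
      ((hasDerivAt_id u).ofReal_comp.const_mul (Complex.I * s)).cexp
    refine (h1.mul h2).congr_deriv ?_
    ring
  have hcd : HasCompactSupport (deriv h) := hc.deriv
  have hdc : Continuous (deriv h) := hh.continuous_deriv le_rfl
  have i1 : Integrable fun u : ℝ => (h u : ℂ) * Complex.exp (Complex.I * s * u) := by
    refine Continuous.integrable_of_hasCompactSupport ?_ ?_
    · have := hh.continuous
      fun_prop
    · exact (hc.comp_left (g := fun r : ℝ => (r : ℂ)) (by simp)).mul_right
  have i2 : Integrable fun u : ℝ => ((deriv h u : ℝ) : ℂ) * Complex.exp (Complex.I * s * u) := by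
    refine Continuous.integrable_of_hasCompactSupport (by fun_prop) ?_
    exact (hcd.comp_left (g := fun r : ℝ => (r : ℂ)) (by simp)).mul_right
  have h0 := integral_eq_zero_of_hasDerivAt_of_integrable hd (i2.add (i1.const_mul _)) i1
  rw [integral_add i2 (i1.const_mul _), integral_const_mul] at h0
  exact eq_neg_of_add_eq_zero_right h0

lemma norm_integral_mul_exp_le {h : ℝ → ℝ} (hs : ∀ u, 2 < |u| → h u = 0) {S : ℝ}
    (hS : ∀ u, |u| ≤ 2 → |h u| ≤ S) (s : ℝ) :
    ‖∫ u : ℝ, (h u : ℂ) * Complex.exp (Complex.I * s * u)‖ ≤ S * 4 := by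
  rw [← setIntegral_eq_integral_of_forall_compl_eq_zero (s := Icc (-2) 2)]
  · refine (norm_setIntegral_le_of_norm_le_const (C := S) (by simp) fun u hu => ?_).trans ?_
    · rw [norm_mul, show Complex.I * s * u = ((s * u : ℝ) : ℂ) * Complex.I by push_cast; ring,
        Complex.norm_exp_ofReal_mul_I, mul_one, Complex.norm_real, Real.norm_eq_abs]
      exact hS u (abs_le.2 hu)
    · simp [Measure.real]
      norm_num
  · intro u hu
    rw [hs u, Complex.ofReal_zero, zero_mul]
    by_contra hcon
    exact hu (abs_le.1 (not_lt.1 hcon))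

lemma deriv_eq_zero_of_two_lt {h : ℝ → ℝ} (hs : ∀ u, 2 < |u| → h u = 0) {u : ℝ} (hu : 2 < |u|) :
    deriv h u = 0 := by
  have : h =ᶠ[𝓝 u] fun _ => 0 := by
    filter_upwards [(isOpen_lt continuous_const continuous_abs).mem_nhds hu] with v hv
    exact hs v hv
  rw [this.deriv_eq, deriv_const]

lemma hasCompactSupport_of_two_lt {h : ℝ → ℝ} (hs : ∀ u, 2 < |u| → h u = 0) :
    HasCompactSupport h := by
  refine HasCompactSupport.of_support_subset_isCompact (isCompact_Icc (a := -2) (b := 2)) ?_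
  intro u hu
  by_contra hcon
  refine hu (hs u (not_le.1 fun h' => hcon (abs_le.1 h')))

/-- The trivial bound, added to the bound for `s^2` times the integral that two integrations by
parts give. -/
lemma norm_integral_mul_exp_le_decay {h : ℝ → ℝ} (hh : ContDiff ℝ 2 h)
    (hs : ∀ u, 2 < |u| → h u = 0) {S : ℝ} (hS : ∀ u, |u| ≤ 2 → |h u| ≤ S)
    (hS2 : ∀ u, |u| ≤ 2 → |deriv (deriv h) u| ≤ S) (s : ℝ) :
    ‖∫ u : ℝ, (h u : ℂ) * Complex.exp (Complex.I * s * u)‖ ≤ 8 * S / (1 + s ^ 2) := by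
  have hs1 : ∀ u, 2 < |u| → deriv h u = 0 := fun u hu => deriv_eq_zero_of_two_lt hs hu
  have hs2 : ∀ u, 2 < |u| → deriv (deriv h) u = 0 := fun u hu => deriv_eq_zero_of_two_lt hs1 hu
  have hd : ContDiff ℝ 1 (deriv h) := by
    have : ContDiff ℝ (1 + 1) h := by
      norm_num
      exact hh
    exact (contDiff_succ_iff_deriv.1 this).2.2
  have e1 := integral_mul_exp_ibp (hh.of_le (by norm_num)) (hasCompactSupport_of_two_lt hs) s
  have e2 := integral_mul_exp_ibp hd (hasCompactSupport_of_two_lt hs1) s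
  set J := ∫ u : ℝ, (h u : ℂ) * Complex.exp (Complex.I * s * u)
  have h1 : ‖J‖ ≤ S * 4 := norm_integral_mul_exp_le hs hS s
  have h2 : s ^ 2 * ‖J‖ ≤ S * 4 := by
    have : (s : ℂ) ^ 2 * J = -∫ u : ℝ, ((deriv (deriv h) u : ℝ) : ℂ) *
        Complex.exp (Complex.I * s * u) := by
      rw [← e2, ← neg_neg (∫ u : ℝ, ((deriv h u : ℝ) : ℂ) * Complex.exp (Complex.I * s * u)), ← e1]
      linear_combination ((s : ℂ) ^ 2 * J) * Complex.I_sq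
    have h3 := congrArg norm this
    rw [norm_mul, norm_pow, Complex.norm_real, Real.norm_eq_abs, sq_abs, norm_neg] at h3
    rw [h3]
    exact norm_integral_mul_exp_le hs2 hS2 s
  rw [le_div_iff₀ (by positivity)]
  linarith

lemma contDiff_mul_pow {h θ : ℝ → ℝ} (hh : ContDiff ℝ 2 h) (hθ : ContDiff ℝ 2 θ) (k : ℕ) :
    ContDiff ℝ 2 (fun u => h u * θ u ^ k) := hh.mul (hθ.pow k)

/-- Each further factor `θ` costs `4 L`, because the second derivative of a product has four terms.
The growth stays exponential in `k`, which a geometric series can absorb. -/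
lemma deriv_bounds_mul_pow {h θ : ℝ → ℝ} (hh : ContDiff ℝ 2 h) (hθ : ContDiff ℝ 2 θ) {S L : ℝ}
    {u : ℝ} (h0 : |h u| ≤ S) (h1 : |deriv h u| ≤ S) (h2 : |deriv (deriv h) u| ≤ S)
    (t0 : |θ u| ≤ L) (t1 : |deriv θ u| ≤ L) (t2 : |deriv (deriv θ) u| ≤ L) (k : ℕ) :
    |h u * θ u ^ k| ≤ S * (4 * L) ^ k ∧ |deriv (fun u => h u * θ u ^ k) u| ≤ S * (4 * L) ^ k ∧
      |deriv (deriv (fun u => h u * θ u ^ k)) u| ≤ S * (4 * L) ^ k := by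
  have hL : 0 ≤ L := (abs_nonneg _).trans t0
  have hS : 0 ≤ S := (abs_nonneg _).trans h0
  have two : ∀ {g : ℝ → ℝ}, ContDiff ℝ 2 g → Differentiable ℝ g ∧ Differentiable ℝ (deriv g) := by
    intro g hg
    have : ContDiff ℝ (1 + 1) g := by
      norm_num
      exact hg
    exact ⟨hg.differentiable (by norm_num),
      ((contDiff_succ_iff_deriv.1 this).2.2).differentiable one_ne_zero⟩
  induction k with
  | zero => simpa using ⟨h0, h1, h2⟩
  | succ k ih =>
    set g : ℝ → ℝ := fun u => h u * θ u ^ k with hg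
    obtain ⟨i0, i1, i2⟩ := ih
    obtain ⟨dg, dg'⟩ := two (contDiff_mul_pow hh hθ k)
    obtain ⟨dθ, dθ'⟩ := two hθ
    have e : (fun u => h u * θ u ^ (k + 1)) = fun u => g u * θ u := by
      ext v
      rw [hg, pow_succ]
      ring
    have e1 : deriv (fun u => g u * θ u) = fun u => deriv g u * θ u + g u * deriv θ u := by
      ext v
      exact deriv_fun_mul (dg v) (dθ v)
    have e2 : deriv (fun u => deriv g u * θ u + g u * deriv θ u) u =
        (deriv (deriv g) u * θ u + deriv g u * deriv θ u) +
          (deriv g u * deriv θ u + g u * deriv (deriv θ) u) := by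
      exact (((dg' u).hasDerivAt.mul (dθ u).hasDerivAt).add
        ((dg u).hasDerivAt.mul (dθ' u).hasDerivAt)).deriv
    set X := S * (4 * L) ^ k with hX
    have hX0 : 0 ≤ X := by positivity
    have eX : S * (4 * L) ^ (k + 1) = 4 * (X * L) := by
      rw [hX, pow_succ]
      ring
    have hXL : 0 ≤ X * L := by positivity
    have m : ∀ {a b : ℝ}, |a| ≤ X → |b| ≤ L → |a * b| ≤ X * L := fun ha hb => by
      rw [abs_mul]
      exact mul_le_mul ha hb (abs_nonneg _) hX0
    rw [congrFun e u, e, e1, e2, eX]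
    refine ⟨(m i0 t0).trans (by linarith), ?_, ?_⟩
    · refine (abs_add_le _ _).trans ?_
      linarith [m i1 t0, m i0 t1]
    · refine (abs_add_le _ _).trans ?_
      have := abs_add_le (deriv (deriv g) u * θ u) (deriv g u * deriv θ u)
      have := abs_add_le (deriv g u * deriv θ u) (g u * deriv (deriv θ) u)
      linarith [m i2 t0, m i1 t1, m i0 t2]

lemma exists_deriv_bounds {h : ℝ → ℝ} (hh : ContDiff ℝ 2 h) :
    ∃ S : ℝ, 1 ≤ S ∧ ∀ u, |u| ≤ 2 → |h u| ≤ S ∧ |deriv h u| ≤ S ∧ |deriv (deriv h) u| ≤ S := by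
  have hd : ContDiff ℝ 1 (deriv h) := by
    have : ContDiff ℝ (1 + 1) h := by
      norm_num
      exact hh
    exact (contDiff_succ_iff_deriv.1 this).2.2
  obtain ⟨a, ha⟩ := (isCompact_Icc (a := (-2 : ℝ)) (b := 2)).exists_bound_of_continuousOn
    hh.continuous.continuousOn
  obtain ⟨b, hb⟩ := (isCompact_Icc (a := (-2 : ℝ)) (b := 2)).exists_bound_of_continuousOn
    hd.continuous.continuousOn
  obtain ⟨c, hc⟩ := (isCompact_Icc (a := (-2 : ℝ)) (b := 2)).exists_bound_of_continuousOn
    (hd.continuous_deriv le_rfl).continuousOn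
  refine ⟨max 1 (max a (max b c)), le_max_left _ _, fun u hu => ?_⟩
  have hu' := abs_le.1 hu
  exact ⟨(ha u hu').trans (by simp), (hb u hu').trans (by simp), (hc u hu').trans (by simp)⟩

/-- `h θ^k` is bounded by `S (4 L)^k`, and its Fourier transform decays quadratically with the same
constant. -/
def HasPowerDecay (h θ : ℝ → ℝ) (S L : ℝ) : Prop :=
  ∀ k : ℕ, (∀ u, |h u * θ u ^ k| ≤ S * (4 * L) ^ k) ∧
    ∀ s : ℝ, ‖∫ u : ℝ, ((h u * θ u ^ k : ℝ) : ℂ) * Complex.exp (Complex.I * s * u)‖ ≤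
      S * (4 * L) ^ k / (1 + s ^ 2)

/-- The base `4 L` comes from `θ` alone; the cutoff `h` enters only through the prefactor `S`. This
is what makes the separation `C₀` independent of `φ`. -/
lemma exists_hasPowerDecay {h θ : ℝ → ℝ} (hh : ContDiff ℝ 2 h) (hs : ∀ u, 2 < |u| → h u = 0)
    (hθ : ContDiff ℝ 2 θ) {L : ℝ}
    (hL : ∀ u, |u| ≤ 2 → |θ u| ≤ L ∧ |deriv θ u| ≤ L ∧ |deriv (deriv θ) u| ≤ L) :
    ∃ S : ℝ, 0 ≤ S ∧ HasPowerDecay h θ S L := by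
  obtain ⟨S, hS1, hS⟩ := exists_deriv_bounds hh
  have hL0 : 0 ≤ L := (abs_nonneg _).trans (hL 0 (by simp)).1
  have key := fun (k : ℕ) (u : ℝ) (hu : |u| ≤ 2) => deriv_bounds_mul_pow hh hθ (hS u hu).1
    (hS u hu).2.1 (hS u hu).2.2 (hL u hu).1 (hL u hu).2.1 (hL u hu).2.2 k
  refine ⟨8 * S, by linarith, fun k => ⟨fun u => ?_, fun s => ?_⟩⟩
  · have h4 : 0 ≤ S * (4 * L) ^ k := by positivity
    rcases le_or_gt |u| 2 with hu | hu
    · exact (key k u hu).1.trans (by linarith)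
    · rw [hs u hu, zero_mul, abs_zero]
      linarith
  · have := norm_integral_mul_exp_le_decay (contDiff_mul_pow hh hθ k)
      (fun u hu => by rw [hs u hu, zero_mul]) (fun u hu => (key k u hu).1)
      (fun u hu => (key k u hu).2.2) s
    rwa [← mul_assoc] at this

/-- A globally smooth substitute for `u⁻¹`: multiplied by a cutoff that vanishes for `|u| < 1/2`,
its powers are the negative powers of the frequency that the series produces. -/
lemma exists_smooth_inv : ∃ θ : ℝ → ℝ, ContDiff ℝ 2 θ ∧ ∀ u, 1 / 2 ≤ |u| → θ u = u⁻¹ := by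
  let f : ContDiffBump (0 : ℝ) := ⟨1 / 4, 1 / 2, by norm_num, by norm_num⟩
  refine ⟨fun u => (1 - f u) * u⁻¹, ?_, fun u hu => ?_⟩
  · rw [contDiff_iff_contDiffAt]
    intro u
    rcases eq_or_ne u 0 with rfl | hu
    · have : (fun u => (1 - f u) * u⁻¹) =ᶠ[𝓝 0] fun _ => 0 := by
        filter_upwards [f.eventuallyEq_one] with v hv
        rw [hv]
        simp
      exact contDiffAt_const.congr_of_eventuallyEq this
    · exact (contDiffAt_const.sub f.contDiffAt).mul (contDiffAt_inv ℝ hu)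
  · change (1 - f u) * u⁻¹ = u⁻¹
    rw [f.zero_of_le_dist (by rwa [dist_zero_right, Real.norm_eq_abs]), sub_zero, one_mul]

lemma integrable_fourierHat (f : 𝓢(ℝ, ℂ)) : Integrable (fourierHat f) := by
  have h : fourierHat f = fun ξ => (1 / Real.sqrt (2 * Real.pi) : ℝ) *
      (FourierTransform.fourier f : 𝓢(ℝ, ℂ)) (ξ / (2 * Real.pi)) := by
    ext ξ
    rw [fourierHat, SchwartzMap.fourier_coe, Real.fourier_eq']
    congr 2
    ext x
    rw [smul_eq_mul, mul_comm]
    congr 2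
    simp only [RCLike.inner_apply, conj_trivial]
    push_cast
    have : (Real.pi : ℂ) ≠ 0 := by exact_mod_cast Real.pi_ne_zero
    field_simp
  rw [h]
  refine Integrable.const_mul ?_ _
  exact (SchwartzMap.integrable _).comp_div (by positivity)

/-- By Fubini the localized function is `f` convolved with a rescaled Fourier transform of `h`, and
the quadratic decay of the latter is the kernel of `avgKernel` at width `1 / |lam|`. -/
lemma enorm_freqLocal_le {f : ℝ → ℂ} (hf : Integrable f) (hfm : Measurable f) {h : ℝ → ℝ}
    (hh : Integrable h) (hm : Measurable h) {H : ℝ}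
    (hH : ∀ s : ℝ, ‖∫ u : ℝ, (h u : ℂ) * Complex.exp (Complex.I * s * u)‖ ≤ H / (1 + s ^ 2))
    {lam : ℝ} (hlam : lam ≠ 0) (y : ℝ) :
    ‖∫ ξ : ℝ, fourierHat f ξ * (h (ξ / lam) : ℂ) * Complex.exp (Complex.I * ξ * y)‖ₑ ≤
      ENNReal.ofReal H * avgKernel |lam|⁻¹ (fun x => ‖f x‖ₑ) y := by
  have hH0 : 0 ≤ H := by
    have := (norm_nonneg _).trans (hH 0)
    simpa using this
  set c : ℂ := ((1 / Real.sqrt (2 * Real.pi) : ℝ) : ℂ) with hc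
  -- The normalization `1 / √(2π)` is discarded, being at most one.
  have hc1 : ‖c‖ ≤ 1 := by
    rw [hc, Complex.norm_real, Real.norm_of_nonneg (by positivity)]
    rw [div_le_one (by positivity), Real.one_le_sqrt]
    have := Real.pi_gt_three
    linarith
  have hhl : Integrable fun ξ : ℝ => (h (ξ / lam) : ℂ) := (hh.comp_div hlam).ofReal
  have e1 : ∫ ξ : ℝ, fourierHat f ξ * (h (ξ / lam) : ℂ) * Complex.exp (Complex.I * ξ * y) =
      c * ∫ ξ : ℝ, ∫ z : ℝ, f z * (h (ξ / lam) : ℂ) *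
        Complex.exp (Complex.I * ξ * (y - z : ℝ)) := by
    rw [← integral_const_mul]
    refine integral_congr_ae (Eventually.of_forall fun ξ => ?_)
    simp only
    rw [fourierHat, mul_assoc, mul_assoc, ← integral_mul_const]
    congr 2
    ext z
    rw [show Complex.I * ξ * (y - z : ℝ) = -(Complex.I * z * ξ) + Complex.I * ξ * y by
      push_cast; ring, Complex.exp_add]
    ring
  have hint : Integrable (fun q : ℝ × ℝ => f q.2 * (h (q.1 / lam) : ℂ) *
      Complex.exp (Complex.I * q.1 * (y - q.2 : ℝ))) := by
    have h1 : Integrable (fun q : ℝ × ℝ => (h (q.1 / lam) : ℂ) * f q.2) := hhl.mul_prod hf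
    refine h1.mono (by fun_prop) (Eventually.of_forall fun q => ?_)
    rw [norm_mul, show Complex.I * q.1 * (y - q.2 : ℝ) =
      ((q.1 * (y - q.2) : ℝ) : ℂ) * Complex.I by push_cast; ring, Complex.norm_exp_ofReal_mul_I,
      mul_one, mul_comm]
  have e2 : ∫ ξ : ℝ, ∫ z : ℝ, f z * (h (ξ / lam) : ℂ) *
        Complex.exp (Complex.I * ξ * (y - z : ℝ)) =
      ∫ z : ℝ, f z * ((|lam| : ℝ) * ∫ u : ℝ, (h u : ℂ) *
        Complex.exp (Complex.I * (lam * (y - z) : ℝ) * u)) := by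
    rw [integral_integral_swap hint]
    refine integral_congr_ae (Eventually.of_forall fun z => ?_)
    simp only
    have h3 := Measure.integral_comp_div (fun u : ℝ => (h u : ℂ) *
        Complex.exp (Complex.I * (lam * (y - z) : ℝ) * u)) lam
    rw [Complex.real_smul] at h3
    rw [← h3, ← integral_const_mul]
    congr 1
    ext ξ
    have : (lam : ℂ) ≠ 0 := by exact_mod_cast hlam
    rw [mul_assoc, show Complex.I * ξ * (y - z : ℝ) =
      Complex.I * (lam * (y - z) : ℝ) * (ξ / lam : ℝ) by push_cast; field_simp]
  rw [e1, e2, enorm_mul]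
  calc ‖c‖ₑ * ‖∫ z : ℝ, f z * ((|lam| : ℝ) * ∫ u : ℝ, (h u : ℂ) *
        Complex.exp (Complex.I * (lam * (y - z) : ℝ) * u))‖ₑ
      ≤ 1 * ∫⁻ z : ℝ, ‖f z * ((|lam| : ℝ) * ∫ u : ℝ, (h u : ℂ) *
        Complex.exp (Complex.I * (lam * (y - z) : ℝ) * u))‖ₑ := by
        gcongr
        · rw [← ofReal_norm]
          exact ENNReal.ofReal_le_one.2 hc1
        · exact enorm_integral_le_lintegral_enorm _
    _ ≤ ∫⁻ z : ℝ, ENNReal.ofReal H *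
          (ENNReal.ofReal ((|lam|⁻¹)⁻¹ / (1 + ((y - z) / |lam|⁻¹) ^ 2)) * ‖f z‖ₑ) := by
        rw [one_mul]
        refine lintegral_mono fun z => ?_
        rw [enorm_mul, mul_comm, ← mul_assoc]
        gcongr
        rw [← ENNReal.ofReal_mul hH0, ← ofReal_norm]
        refine ENNReal.ofReal_le_ofReal ?_
        rw [norm_mul, Complex.norm_real, Real.norm_of_nonneg (abs_nonneg _), inv_inv, div_inv_eq_mul]
        calc _ ≤ |lam| * (H / (1 + (lam * (y - z)) ^ 2)) := by
              gcongr
              exact hH _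
          _ = _ := by
            rw [mul_pow, mul_pow, sq_abs]
            ring
    _ = _ := by
        rw [avgKernel, lintegral_const_mul]
        have := hfm
        fun_prop

end
end BilinearMax

/-! ### Oscillatory integrals: expansions that separate the two frequencies. -/

namespace BilinearMax
noncomputable section

/-- The bounds on a rescaled curve `q`, with first and second derivatives `q₁` and `q₂`, which
oscillatory integral estimates use. -/
structure PhaseBounds (q q₁ q₂ : ℝ → ℝ) (K : ℝ) : Prop where
  one_le : 1 ≤ K
  hasDerivAt : ∀ t ∈ annulus, HasDerivAt q (q₁ t) t
  hasDerivAt₁ : ∀ t ∈ annulus, HasDerivAt q₁ (q₂ t) t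
  continuousOn₂ : ContinuousOn q₂ annulus
  le_abs : ∀ t ∈ annulus, K⁻¹ ≤ |q₁ t|
  abs_le : ∀ t ∈ annulus, |q₁ t| ≤ K
  abs_le₂ : ∀ t ∈ annulus, |q₂ t| ≤ K

/-- The oscillating factor. -/
def wave (a e : ℝ) (q : ℝ → ℝ) (t : ℝ) : ℂ :=
  Complex.exp (-(Complex.I * ((a * t : ℝ) : ℂ))) * Complex.exp (Complex.I * ((e * q t : ℝ) : ℂ))

lemma norm_wave (a e : ℝ) (q : ℝ → ℝ) (t : ℝ) : ‖wave a e q t‖ = 1 := by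
  rw [wave, norm_mul, mul_comm Complex.I, mul_comm Complex.I, ← neg_mul, ← Complex.ofReal_neg,
    Complex.norm_exp_ofReal_mul_I, Complex.norm_exp_ofReal_mul_I, mul_one]

/-- The derivative of `ρ q₁ᵏ`. -/
def amp (ρ q₁ q₂ : ℝ → ℝ) (k : ℤ) (t : ℝ) : ℝ :=
  deriv ρ t * q₁ t ^ k + ρ t * (k * q₁ t ^ (k - 1) * q₂ t)

lemma IsAveragingKernel.tsupport_subset_annulus {ρ : ℝ → ℝ} (hρ : IsAveragingKernel ρ) :
    tsupport ρ ⊆ annulus := fun _ ht =>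
  ⟨(hρ.support_subset ht).1.le, (hρ.support_subset ht).2.le.trans (by norm_num)⟩

lemma IsAveragingKernel.hasCompactSupport {ρ : ℝ → ℝ} (hρ : IsAveragingKernel ρ) :
    HasCompactSupport ρ := by
  refine HasCompactSupport.of_support_subset_isCompact (isCompact_Icc (a := -1) (b := 1)) ?_
  intro t ht
  exact abs_le.1 (hρ.support_subset (subset_tsupport _ ht)).2.le

lemma integrable_of_continuousOn_tsupport {ρ : ℝ → ℝ} (hc : HasCompactSupport ρ) {F : ℝ → ℂ}
    (hF : ContinuousOn F (tsupport ρ)) (h0 : ∀ t ∉ tsupport ρ, F t = 0) : Integrable F := by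
  rw [← integrableOn_iff_integrable_of_support_subset (s := tsupport ρ)]
  · exact hF.integrableOn_compact hc
  · intro t ht
    by_contra hcon
    exact ht (h0 t hcon)

lemma deriv_eq_zero_of_notMem_tsupport {ρ : ℝ → ℝ} {t : ℝ} (ht : t ∉ tsupport ρ) :
    deriv ρ t = 0 := by
  have : t ∉ tsupport (deriv ρ) := fun h => ht (tsupport_deriv_subset h)
  exact image_eq_zero_of_notMem_tsupport this

lemma amp_eq_zero {ρ q₁ q₂ : ℝ → ℝ} {t : ℝ} (ht : t ∉ tsupport ρ) (k : ℤ) :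
    amp ρ q₁ q₂ k t = 0 := by
  rw [amp, deriv_eq_zero_of_notMem_tsupport ht, image_eq_zero_of_notMem_tsupport ht]
  simp

namespace PhaseBounds

variable {q q₁ q₂ ρ : ℝ → ℝ} {K : ℝ}

lemma ne_zero (h : PhaseBounds q q₁ q₂ K) {t : ℝ} (ht : t ∈ annulus) : q₁ t ≠ 0 := by
  have h1 := h.le_abs t ht
  have h2 : 0 < K⁻¹ := inv_pos.2 (by linarith [h.one_le])
  exact abs_pos.1 (h2.trans_le h1)

lemma continuousOn_wave (h : PhaseBounds q q₁ q₂ K) (a e : ℝ) :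
    ContinuousOn (wave a e q) annulus := by
  have hq : ContinuousOn q annulus := fun t ht =>
    (h.hasDerivAt t ht).continuousAt.continuousWithinAt
  unfold wave
  fun_prop

lemma continuousOn_zpow (h : PhaseBounds q q₁ q₂ K) (k : ℤ) :
    ContinuousOn (fun t => q₁ t ^ k) annulus := by
  have hq : ContinuousOn q₁ annulus := fun t ht =>
    (h.hasDerivAt₁ t ht).continuousAt.continuousWithinAt
  exact hq.zpow₀ k fun t ht => Or.inl (h.ne_zero ht)

lemma continuousOn_amp (h : PhaseBounds q q₁ q₂ K) (hρ : IsAveragingKernel ρ) (k : ℤ) :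
    ContinuousOn (amp ρ q₁ q₂ k) annulus := by
  have h1 : ContinuousOn (deriv ρ) annulus :=
    (hρ.contDiff.continuous_deriv (by simp)).continuousOn
  have h2 : ContinuousOn ρ annulus := hρ.contDiff.continuous.continuousOn
  exact (h1.mul (h.continuousOn_zpow k)).add
    (h2.mul ((continuousOn_const.mul (h.continuousOn_zpow (k - 1))).mul h.continuousOn₂))

lemma abs_zpow_le (h : PhaseBounds q q₁ q₂ K) {t : ℝ} (ht : t ∈ annulus) (k : ℤ) :
    |q₁ t ^ k| ≤ K ^ k.natAbs := by
  have hK : 0 < K := by linarith [h.one_le]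
  rw [abs_zpow]
  rcases Int.natAbs_eq k with hk | hk
  · rw [hk, zpow_natCast, Int.natAbs_natCast]
    exact pow_le_pow_left₀ (abs_nonneg _) (h.abs_le t ht) _
  · rw [hk, zpow_neg, zpow_natCast, Int.natAbs_neg, Int.natAbs_natCast, ← inv_pow]
    refine pow_le_pow_left₀ (by positivity) ?_ _
    rw [inv_le_comm₀ (abs_pos.2 (h.ne_zero ht)) hK]
    exact h.le_abs t ht

/-- Differentiating the power produces a factor `|k|`, absorbed into `2^|k|`; hence the base `2 K`
instead of `K`. -/
lemma abs_amp_le (h : PhaseBounds q q₁ q₂ K) (hρ : IsAveragingKernel ρ) {R : ℝ}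
    (hR : ∀ t, |ρ t| ≤ R) (hR' : ∀ t, |deriv ρ t| ≤ R) (k : ℤ) (t : ℝ) :
    |amp ρ q₁ q₂ k t| ≤ 2 * R * K ^ 2 * (2 * K) ^ k.natAbs := by
  have hK := h.one_le
  have hR0 : 0 ≤ R := (abs_nonneg _).trans (hR 0)
  by_cases ht : t ∈ tsupport ρ
  swap
  · rw [amp_eq_zero ht, abs_zero]
    positivity
  have hta := hρ.tsupport_subset_annulus ht
  set n := k.natAbs with hn
  have hk : |(k : ℝ)| = n := by
    rw [hn, Nat.cast_natAbs, Int.cast_abs]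
  have hn2 : (n : ℝ) ≤ 2 ^ n := by exact_mod_cast Nat.lt_two_pow_self.le
  have hone : (1 : ℝ) ≤ 2 ^ n := one_le_pow₀ one_le_two
  have h1 : |q₁ t ^ (k - 1)| ≤ K ^ n * K := by
    refine (h.abs_zpow_le hta (k - 1)).trans ?_
    rw [← pow_succ]
    exact pow_le_pow_right₀ hK (by omega)
  have h2 : |amp ρ q₁ q₂ k t| ≤ R * K ^ n + R * (n * (K ^ n * K) * K) := by
    refine (abs_add_le _ _).trans (add_le_add ?_ ?_)
    · rw [abs_mul]
      exact mul_le_mul (hR' t) (h.abs_zpow_le hta k) (abs_nonneg _) hR0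
    · rw [abs_mul, abs_mul, abs_mul, hk]
      have := h.abs_le₂ t hta
      have := hR t
      gcongr
  refine h2.trans ?_
  have hK2 : (1 : ℝ) ≤ K ^ 2 := one_le_pow₀ hK
  have hKn : (0 : ℝ) < K ^ n := by positivity
  have e1 : R * K ^ n ≤ R * K ^ 2 * (2 ^ n * K ^ n) := by
    have : R * K ^ n = R * 1 * (1 * K ^ n) := by ring
    rw [this]
    gcongr
  have e2 : R * (n * (K ^ n * K) * K) ≤ R * K ^ 2 * (2 ^ n * K ^ n) := by
    have : R * (n * (K ^ n * K) * K) = R * K ^ 2 * (n * K ^ n) := by ring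
    rw [this]
    gcongr
  rw [mul_pow]
  linarith

/-- Integration by parts against the total derivative of `wave · ρ q₁^k`: the phase contributes `-i
a + i e q₁`, and the factor `q₁` raises the exponent by one. -/
lemma integral_wave_mul_amp (h : PhaseBounds q q₁ q₂ K) (hρ : IsAveragingKernel ρ) (a e : ℝ)
    (k : ℤ) :
    ∫ t, wave a e q t * (amp ρ q₁ q₂ k t : ℂ) =
      Complex.I * (a * (∫ t, wave a e q t * ((ρ t * q₁ t ^ k : ℝ) : ℂ)) -
        e * ∫ t, wave a e q t * ((ρ t * q₁ t ^ (k + 1) : ℝ) : ℂ)) := by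
  have hsub := hρ.tsupport_subset_annulus
  have hcont : ContinuousOn ρ (tsupport ρ) := hρ.contDiff.continuous.continuousOn
  have hJ : ∀ k : ℤ, Integrable fun t => wave a e q t * ((ρ t * q₁ t ^ k : ℝ) : ℂ) := by
    intro k
    refine integrable_of_continuousOn_tsupport hρ.hasCompactSupport ?_ fun t ht => ?_
    · exact ((h.continuousOn_wave a e).mono hsub).mul (Complex.continuous_ofReal.comp_continuousOn
        (hcont.mul ((h.continuousOn_zpow k).mono hsub)))
    · rw [image_eq_zero_of_notMem_tsupport ht]
      simp
  have hA : Integrable fun t => wave a e q t * (amp ρ q₁ q₂ k t : ℂ) := by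
    refine integrable_of_continuousOn_tsupport hρ.hasCompactSupport ?_ fun t ht => ?_
    · exact ((h.continuousOn_wave a e).mono hsub).mul (Complex.continuous_ofReal.comp_continuousOn
        ((h.continuousOn_amp hρ k).mono hsub))
    · rw [amp_eq_zero ht]
      simp
  have hd : ∀ t, HasDerivAt (fun t => wave a e q t * ((ρ t * q₁ t ^ k : ℝ) : ℂ))
      (wave a e q t * (amp ρ q₁ q₂ k t : ℂ) +
        (-(Complex.I * a) * (wave a e q t * ((ρ t * q₁ t ^ k : ℝ) : ℂ)) +
          Complex.I * e * (wave a e q t * ((ρ t * q₁ t ^ (k + 1) : ℝ) : ℂ)))) t := by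
    intro t
    by_cases ht : t ∈ tsupport ρ
    · have hta := hsub ht
      have d1 : HasDerivAt (fun t => Complex.exp (-(Complex.I * ((a * t : ℝ) : ℂ))))
          (Complex.exp (-(Complex.I * ((a * t : ℝ) : ℂ))) * -(Complex.I * ((a * 1 : ℝ) : ℂ))) t :=
        ((((hasDerivAt_id t).const_mul a).ofReal_comp).const_mul Complex.I).neg.cexp
      have d2 : HasDerivAt (fun t => Complex.exp (Complex.I * ((e * q t : ℝ) : ℂ)))
          (Complex.exp (Complex.I * ((e * q t : ℝ) : ℂ)) *
            (Complex.I * ((e * q₁ t : ℝ) : ℂ))) t :=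
        ((((h.hasDerivAt t hta).const_mul e).ofReal_comp).const_mul Complex.I).cexp
      have d3 : HasDerivAt (fun t => ρ t * q₁ t ^ k) (amp ρ q₁ q₂ k t) t := by
        have r1 : HasDerivAt ρ (deriv ρ t) t :=
          (hρ.contDiff.differentiable (by simp) t).hasDerivAt
        have r2 : HasDerivAt (fun t => q₁ t ^ k) (k * q₁ t ^ (k - 1) * q₂ t) t :=
          (hasDerivAt_zpow k (q₁ t) (Or.inl (h.ne_zero hta))).comp t (h.hasDerivAt₁ t hta)
        exact r1.mul r2
      refine ((d1.mul d2).mul d3.ofReal_comp).congr_deriv ?_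
      simp only [Pi.mul_apply, wave]
      rw [zpow_add_one₀ (h.ne_zero hta)]
      push_cast
      ring
    · have hz : (fun t => wave a e q t * ((ρ t * q₁ t ^ k : ℝ) : ℂ)) =ᶠ[𝓝 t] fun _ => 0 := by
        filter_upwards [(isClosed_tsupport ρ).isOpen_compl.mem_nhds ht] with s hs
        rw [image_eq_zero_of_notMem_tsupport hs]
        simp
      refine ((hasDerivAt_const t (0 : ℂ)).congr_of_eventuallyEq hz).congr_deriv ?_
      rw [amp_eq_zero ht, image_eq_zero_of_notMem_tsupport ht]
      simp
  have hB : Integrable fun t => -(Complex.I * a) * (wave a e q t * ((ρ t * q₁ t ^ k : ℝ) : ℂ)) +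
      Complex.I * e * (wave a e q t * ((ρ t * q₁ t ^ (k + 1) : ℝ) : ℂ)) :=
    ((hJ k).const_mul _).add ((hJ (k + 1)).const_mul _)
  have h0 := integral_eq_zero_of_hasDerivAt_of_integrable hd (hA.add hB) (hJ k)
  rw [integral_add hA hB, integral_add ((hJ k).const_mul _) ((hJ (k + 1)).const_mul _),
    integral_const_mul, integral_const_mul] at h0
  linear_combination h0

lemma norm_integral_wave_le (h : PhaseBounds q q₁ q₂ K) (hρ : IsAveragingKernel ρ) (a e : ℝ)
    (k : ℤ) : ‖∫ t, wave a e q t * ((ρ t * q₁ t ^ k : ℝ) : ℂ)‖ ≤ K ^ k.natAbs := by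
  have hK := h.one_le
  have hint : Integrable ρ :=
    hρ.contDiff.continuous.integrable_of_hasCompactSupport hρ.hasCompactSupport
  calc ‖∫ t, wave a e q t * ((ρ t * q₁ t ^ k : ℝ) : ℂ)‖ ≤ ∫ t, ρ t * K ^ k.natAbs := by
        refine norm_integral_le_of_norm_le (hint.mul_const _) (Eventually.of_forall fun t => ?_)
        rw [norm_mul, norm_wave, one_mul, Complex.norm_real, Real.norm_eq_abs, abs_mul,
          abs_of_nonneg (hρ.nonneg t)]
        by_cases ht : t ∈ tsupport ρ
        · exact mul_le_mul_of_nonneg_left (h.abs_zpow_le (hρ.tsupport_subset_annulus ht) k)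
            (hρ.nonneg t)
        · rw [image_eq_zero_of_notMem_tsupport ht]
          simp
    _ = K ^ k.natAbs := by rw [integral_mul_const, hρ.integral_eq_one, one_mul]

lemma norm_integral_wave_mul_amp_le (h : PhaseBounds q q₁ q₂ K) (hρ : IsAveragingKernel ρ)
    {R : ℝ} (hR : ∀ t, |ρ t| ≤ R) (hR' : ∀ t, |deriv ρ t| ≤ R) (a e : ℝ) (k : ℤ) :
    ‖∫ t, wave a e q t * (amp ρ q₁ q₂ k t : ℂ)‖ ≤ 2 * R * K ^ 2 * (2 * K) ^ k.natAbs * 2 := by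
  rw [← setIntegral_eq_integral_of_forall_compl_eq_zero (s := Icc (-1) 1)]
  · refine (norm_setIntegral_le_of_norm_le_const (C := 2 * R * K ^ 2 * (2 * K) ^ k.natAbs)
      (by simp) fun t _ => ?_).trans ?_
    · rw [norm_mul, norm_wave, one_mul, Complex.norm_real]
      exact h.abs_amp_le hρ hR hR' k t
    · refine le_of_eq ?_
      simp [Measure.real]
      norm_num
  · intro t ht
    rw [amp_eq_zero, Complex.ofReal_zero, mul_zero]
    intro hcon
    exact ht (_root_.abs_le.1 (hρ.support_subset hcon).2.le)

lemma exists_deriv_bound (hρ : IsAveragingKernel ρ) :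
    ∃ R : ℝ, 0 ≤ R ∧ (∀ t, |ρ t| ≤ R) ∧ ∀ t, |deriv ρ t| ≤ R := by
  obtain ⟨a, ha⟩ := hρ.hasCompactSupport.exists_bound_of_continuous hρ.contDiff.continuous
  obtain ⟨b, hb⟩ := hρ.hasCompactSupport.deriv.exists_bound_of_continuous
    (hρ.contDiff.continuous_deriv (by simp))
  exact ⟨max a b, ((norm_nonneg _).trans (ha 0)).trans (le_max_left _ _),
    fun t => (ha t).trans (le_max_left _ _), fun t => (hb t).trans (le_max_right _ _)⟩

/-- With `J k = ∫ wave ρ q₁^k`, the identity for `amp` reads `J k = (e / a) J (k + 1)` plus a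
multiple of `a⁻¹`, and is iterated from `J 0`. The dependence on `a` and on `e` appears as separate
powers in each term. The ratio `|e / a| ≤ 1 / (4 K)` beats the growth `(2 K)^k` of the amplitudes.
-/
lemma hasSum_wave_left (h : PhaseBounds q q₁ q₂ K) (hρ : IsAveragingKernel ρ) {a e : ℝ}
    (ha : a ≠ 0) (hae : 4 * K * |e| ≤ |a|) :
    HasSum (fun k : ℕ => -Complex.I * (a⁻¹ ^ (k + 1) * e ^ k : ℝ) *
      ∫ t, wave a e q t * (amp ρ q₁ q₂ k t : ℂ)) (∫ t, wave a e q t * (ρ t : ℂ)) := by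
  have hK := h.one_le
  have hac : (a : ℂ) ≠ 0 := by exact_mod_cast ha
  have hapos : 0 < |a| := abs_pos.2 ha
  obtain ⟨R, hR0, hR, hR'⟩ := exists_deriv_bound hρ
  set J : ℤ → ℂ := fun k => ∫ t, wave a e q t * ((ρ t * q₁ t ^ k : ℝ) : ℂ) with hJ
  have hr : |e| / |a| ≤ (4 * K)⁻¹ := by
    rw [div_le_iff₀ hapos, inv_mul_eq_div, le_div_iff₀ (by positivity)]
    linarith
  have hsum : Summable (fun k : ℕ => -Complex.I * (a⁻¹ ^ (k + 1) * e ^ k : ℝ) *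
      ∫ t, wave a e q t * (amp ρ q₁ q₂ k t : ℂ)) := by
    refine Summable.of_norm_bounded (g := fun k : ℕ => |a|⁻¹ * (2 * R * K ^ 2 * 2) * (1 / 2) ^ k)
      ((summable_geometric_two).mul_left _) fun k => ?_
    rw [norm_mul, norm_mul, norm_neg, Complex.norm_I, one_mul, Complex.norm_real, Real.norm_eq_abs,
      abs_mul, abs_pow, abs_pow, abs_inv]
    have hb := h.norm_integral_wave_mul_amp_le hρ hR hR' a e k
    rw [Int.natAbs_natCast] at hb
    calc |a|⁻¹ ^ (k + 1) * |e| ^ k * ‖∫ t, wave a e q t * (amp ρ q₁ q₂ k t : ℂ)‖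
        ≤ |a|⁻¹ ^ (k + 1) * |e| ^ k * (2 * R * K ^ 2 * (2 * K) ^ k * 2) := by gcongr
      _ = |a|⁻¹ * (2 * R * K ^ 2 * 2) * ((|e| / |a|) * (2 * K)) ^ k := by
          rw [pow_succ, mul_pow, div_eq_mul_inv, mul_pow]
          ring
      _ ≤ |a|⁻¹ * (2 * R * K ^ 2 * 2) * (1 / 2) ^ k := by
          have : |e| / |a| * (2 * K) ≤ 1 / 2 := by
            calc |e| / |a| * (2 * K) ≤ (4 * K)⁻¹ * (2 * K) := by gcongr
              _ = 1 / 2 := by field_simp; norm_num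
          gcongr
  rw [hsum.hasSum_iff_tendsto_nat]
  -- The partial sums telescope, leaving a remainder `(e / a)^n J n`.
  have hpart : ∀ n : ℕ, ∑ k ∈ Finset.range n, (-Complex.I * (a⁻¹ ^ (k + 1) * e ^ k : ℝ) *
      ∫ t, wave a e q t * (amp ρ q₁ q₂ k t : ℂ)) = J 0 - (e / a : ℂ) ^ n * J n := by
    intro n
    induction n with
    | zero => simp
    | succ n ih =>
      rw [Finset.sum_range_succ, ih, h.integral_wave_mul_amp hρ]
      change _ - _ * J n + -Complex.I * _ * (Complex.I * (a * J n - e * J (n + 1))) = _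
      push_cast
      rw [div_pow, div_pow, pow_succ, inv_pow, pow_succ]
      field_simp
      linear_combination (a ^ (n + 1) * e ^ n * (e * J (n + 1) - a * J n)) * Complex.I_sq
  have hJ0 : ∫ t, wave a e q t * (ρ t : ℂ) = J 0 := by
    simp [hJ]
  simp_rw [hpart, hJ0]
  -- The remainder is at most `(|e / a| K)^n`, since `ρ` has mass one.
  have hz : Tendsto (fun n : ℕ => (e / a : ℂ) ^ n * J n) atTop (𝓝 0) := by
    refine squeeze_zero_norm (a := fun n : ℕ => (1 / 2 : ℝ) ^ n) (fun n => ?_)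
      (tendsto_pow_atTop_nhds_zero_of_lt_one (by norm_num) (by norm_num))
    rw [norm_mul, norm_pow, norm_div, Complex.norm_real, Complex.norm_real, Real.norm_eq_abs,
      Real.norm_eq_abs]
    have hb := h.norm_integral_wave_le hρ a e n
    rw [Int.natAbs_natCast] at hb
    calc (|e| / |a|) ^ n * ‖J n‖ ≤ (|e| / |a|) ^ n * K ^ n := by gcongr
      _ = (|e| / |a| * K) ^ n := by rw [mul_pow]
      _ ≤ (1 / 2) ^ n := by
        have : |e| / |a| * K ≤ 1 / 2 := by
          calc |e| / |a| * K ≤ (4 * K)⁻¹ * K := by gcongr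
            _ = 1 / 4 := by field_simp
            _ ≤ 1 / 2 := by norm_num
        gcongr
  simpa using hz.const_sub (J 0)

/-- The same recursion solved in the other direction, for `J (k + 1)` in terms of `J k`, so that the
exponents of `q₁` run through the negative integers. The lower bound on `|q₁|` is needed here. -/
lemma hasSum_wave_right (h : PhaseBounds q q₁ q₂ K) (hρ : IsAveragingKernel ρ) {a e : ℝ}
    (he : e ≠ 0) (hae : 4 * K * |a| ≤ |e|) :
    HasSum (fun k : ℕ => Complex.I * (a ^ k * e⁻¹ ^ (k + 1) : ℝ) *
      ∫ t, wave a e q t * (amp ρ q₁ q₂ (-(k + 1 : ℕ) : ℤ) t : ℂ))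
      (∫ t, wave a e q t * (ρ t : ℂ)) := by
  have hK := h.one_le
  have hec : (e : ℂ) ≠ 0 := by exact_mod_cast he
  have hepos : 0 < |e| := abs_pos.2 he
  obtain ⟨R, hR0, hR, hR'⟩ := exists_deriv_bound hρ
  set J : ℤ → ℂ := fun k => ∫ t, wave a e q t * ((ρ t * q₁ t ^ k : ℝ) : ℂ) with hJ
  have hr : |a| / |e| ≤ (4 * K)⁻¹ := by
    rw [div_le_iff₀ hepos, inv_mul_eq_div, le_div_iff₀ (by positivity)]
    linarith
  have hsum : Summable (fun k : ℕ => Complex.I * (a ^ k * e⁻¹ ^ (k + 1) : ℝ) *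
      ∫ t, wave a e q t * (amp ρ q₁ q₂ (-(k + 1 : ℕ) : ℤ) t : ℂ)) := by
    refine Summable.of_norm_bounded
      (g := fun k : ℕ => |e|⁻¹ * (2 * R * K ^ 2 * (2 * K) * 2) * (1 / 2) ^ k)
      ((summable_geometric_two).mul_left _) fun k => ?_
    rw [norm_mul, norm_mul, Complex.norm_I, one_mul, Complex.norm_real, Real.norm_eq_abs,
      abs_mul, abs_pow, abs_pow, abs_inv]
    have hb := h.norm_integral_wave_mul_amp_le hρ hR hR' a e (-(k + 1 : ℕ) : ℤ)
    rw [Int.natAbs_neg, Int.natAbs_natCast] at hb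
    calc |a| ^ k * |e|⁻¹ ^ (k + 1) * ‖∫ t, wave a e q t * (amp ρ q₁ q₂ (-(k + 1 : ℕ) : ℤ) t : ℂ)‖
        ≤ |a| ^ k * |e|⁻¹ ^ (k + 1) * (2 * R * K ^ 2 * (2 * K) ^ (k + 1) * 2) := by gcongr
      _ = |e|⁻¹ * (2 * R * K ^ 2 * (2 * K) * 2) * ((|a| / |e|) * (2 * K)) ^ k := by
          rw [pow_succ, pow_succ, mul_pow (_ / _), div_eq_mul_inv, mul_pow |a|]
          ring
      _ ≤ |e|⁻¹ * (2 * R * K ^ 2 * (2 * K) * 2) * (1 / 2) ^ k := by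
          have : |a| / |e| * (2 * K) ≤ 1 / 2 := by
            calc |a| / |e| * (2 * K) ≤ (4 * K)⁻¹ * (2 * K) := by gcongr
              _ = 1 / 2 := by field_simp; norm_num
          gcongr
  rw [hsum.hasSum_iff_tendsto_nat]
  have hpart : ∀ n : ℕ, ∑ k ∈ Finset.range n, (Complex.I * (a ^ k * e⁻¹ ^ (k + 1) : ℝ) *
      ∫ t, wave a e q t * (amp ρ q₁ q₂ (-(k + 1 : ℕ) : ℤ) t : ℂ)) =
        J 0 - (a / e : ℂ) ^ n * J (-(n : ℤ)) := by
    intro n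
    induction n with
    | zero => simp
    | succ n ih =>
      rw [Finset.sum_range_succ, ih, h.integral_wave_mul_amp hρ]
      change _ - _ * J (-(n : ℤ)) + Complex.I * _ * (Complex.I * (a * J (-(n + 1 : ℕ) : ℤ) -
        e * J ((-(n + 1 : ℕ) : ℤ) + 1))) = _
      rw [show (-(n + 1 : ℕ) : ℤ) + 1 = -(n : ℤ) by push_cast; ring]
      push_cast
      rw [div_pow, div_pow, pow_succ, inv_pow, pow_succ]
      field_simp
      linear_combination (e ^ (n + 1) * a ^ n * (a * J (-(n + 1)) - e * J (-n))) * Complex.I_sq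
  have hJ0 : ∫ t, wave a e q t * (ρ t : ℂ) = J 0 := by
    simp [hJ]
  simp_rw [hpart, hJ0]
  have hz : Tendsto (fun n : ℕ => (a / e : ℂ) ^ n * J (-(n : ℤ))) atTop (𝓝 0) := by
    refine squeeze_zero_norm (a := fun n : ℕ => (1 / 2 : ℝ) ^ n) (fun n => ?_)
      (tendsto_pow_atTop_nhds_zero_of_lt_one (by norm_num) (by norm_num))
    rw [norm_mul, norm_pow, norm_div, Complex.norm_real, Complex.norm_real, Real.norm_eq_abs,
      Real.norm_eq_abs]
    have hb := h.norm_integral_wave_le hρ a e (-(n : ℤ))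
    rw [Int.natAbs_neg, Int.natAbs_natCast] at hb
    calc (|a| / |e|) ^ n * ‖J (-(n : ℤ))‖ ≤ (|a| / |e|) ^ n * K ^ n := by gcongr
      _ = (|a| / |e| * K) ^ n := by rw [mul_pow]
      _ ≤ (1 / 2) ^ n := by
        have : |a| / |e| * K ≤ 1 / 2 := by
          calc |a| / |e| * K ≤ (4 * K)⁻¹ * K := by gcongr
            _ = 1 / 4 := by field_simp
            _ ≤ 1 / 2 := by norm_num
        gcongr
  simpa using hz.const_sub (J 0)

end PhaseBounds

end
end BilinearMax

/-! ### Uniform bounds for the rescaled curve, from the non-flatness conditions. -/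

namespace BilinearMax
noncomputable section

/-- The curve `γ` rescaled to the unit scale. -/
def curve (γ : ℝ → ℝ) (s t : ℝ) : ℝ := γ (s * t) / (s * deriv γ s)

/-- The first derivative of `curve`. -/
def curve₁ (γ : ℝ → ℝ) (s t : ℝ) : ℝ := deriv γ (s * t) / deriv γ s

/-- The second derivative of `curve`. -/
def curve₂ (γ : ℝ → ℝ) (s t : ℝ) : ℝ := s * deriv (deriv γ) (s * t) / deriv γ s

lemma annulus_eq : annulus = Icc (-4) (-(1 / 4)) ∪ Icc (1 / 4) 4 := by
  ext t
  simp only [annulus, mem_ofPred_eq, mem_union, mem_Icc]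
  constructor
  · rintro ⟨h1, h2⟩
    rcases le_total 0 t with h | h
    · rw [abs_of_nonneg h] at h1 h2
      exact Or.inr ⟨h1, h2⟩
    · rw [abs_of_nonpos h] at h1 h2
      exact Or.inl ⟨by linarith, by linarith⟩
  · rintro (⟨h1, h2⟩ | ⟨h1, h2⟩)
    · rw [abs_of_nonpos (by linarith)]
      exact ⟨by linarith, by linarith⟩
    · rw [abs_of_nonneg (by linarith)]
      exact ⟨h1, h2⟩

lemma isCompact_annulus : IsCompact annulus := by
  rw [annulus_eq]
  exact isCompact_Icc.union isCompact_Icc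

lemma measurableSet_annulus : MeasurableSet annulus := isCompact_annulus.isClosed.measurableSet

lemma uniqueDiffOn_annulus : UniqueDiffOn ℝ annulus := by
  intro t ht
  rw [annulus_eq] at ht ⊢
  rcases ht with h | h
  · exact ((uniqueDiffOn_Icc (by norm_num)) t h).mono subset_union_left
  · exact ((uniqueDiffOn_Icc (by norm_num)) t h).mono subset_union_right

lemma mem_annulus_of_abs {t : ℝ} (h1 : 1 / 4 ≤ |t|) (h2 : |t| ≤ 4) : t ∈ annulus := ⟨h1, h2⟩

lemma abs_iteratedDerivWithin_le_cNorm {N : ℕ} {F : ℝ → ℝ} (hF : ContDiffOn ℝ N F annulus) {i : ℕ}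
    (hi : i ≤ N) {t : ℝ} (ht : t ∈ annulus) :
    |iteratedDerivWithin i F annulus t| ≤ cNorm N F := by
  have hbdd : BddAbove (range fun t : annulus => |iteratedDerivWithin i F annulus (t : ℝ)|) := by
    obtain ⟨C, hC⟩ := isCompact_annulus.exists_bound_of_continuousOn
      (hF.continuousOn_iteratedDerivWithin (by exact_mod_cast hi) uniqueDiffOn_annulus)
    refine ⟨C, ?_⟩
    rintro _ ⟨t, rfl⟩
    exact hC t t.2
  refine (le_ciSup hbdd ⟨t, ht⟩).trans ?_
  exact le_ciSup (f := fun k : Fin (N + 1) => ⨆ t : annulus,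
    |iteratedDerivWithin (k : ℕ) F annulus (t : ℝ)|) (Set.finite_range _).bddAbove
    ⟨i, Nat.lt_succ_of_le hi⟩

section Rescaling

variable {γ : ℝ → ℝ} {V : Set ℝ} {s : ℝ}

lemma hasDerivAt_curve (hγ : ContDiffOn ℝ 2 γ V) (hV : IsOpen V) (hs : s ≠ 0) {t : ℝ}
    (ht : s * t ∈ V) : HasDerivAt (curve γ s) (curve₁ γ s t) t := by
  have h1 : HasDerivAt γ (deriv γ (s * t)) (s * t) :=
    ((hγ.contDiffAt (hV.mem_nhds ht)).differentiableAt (by norm_num)).hasDerivAt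
  have h2 : HasDerivAt (fun t => s * t) s t := by simpa using (hasDerivAt_id t).const_mul s
  refine ((h1.comp t h2).div_const (s * deriv γ s)).congr_deriv ?_
  rw [curve₁, mul_comm s (deriv γ s), mul_div_mul_right _ _ hs]

lemma hasDerivAt_curve₁ (hγ : ContDiffOn ℝ 2 γ V) (hV : IsOpen V) {t : ℝ}
    (ht : s * t ∈ V) : HasDerivAt (curve₁ γ s) (curve₂ γ s t) t := by
  have h3 : ContDiffOn ℝ (1 + 1) γ V := by
    norm_num
    exact hγ
  have hd : ContDiffOn ℝ 1 (deriv γ) V := ((contDiffOn_succ_iff_deriv_of_isOpen hV).1 h3).2.2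
  have h1 : HasDerivAt (deriv γ) (deriv (deriv γ) (s * t)) (s * t) :=
    ((hd.contDiffAt (hV.mem_nhds ht)).differentiableAt (by norm_num)).hasDerivAt
  have h2 : HasDerivAt (fun t => s * t) s t := by simpa using (hasDerivAt_id t).const_mul s
  refine ((h1.comp t h2).div_const (deriv γ s)).congr_deriv ?_
  rw [curve₂, mul_comm s (deriv (deriv γ) (s * t))]

lemma continuousOn_curve₂ (hγ : ContDiffOn ℝ 2 γ V) (hV : IsOpen V)
    (hsV : ∀ t ∈ annulus, s * t ∈ V) : ContinuousOn (curve₂ γ s) annulus := by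
  have h3 : ContDiffOn ℝ (1 + 1) γ V := by
    norm_num
    exact hγ
  have hd : ContDiffOn ℝ (0 + 1) (deriv γ) V := by
    rw [zero_add]
    exact ((contDiffOn_succ_iff_deriv_of_isOpen hV).1 h3).2.2
  have hc : ContinuousOn (deriv (deriv γ)) V :=
    ((contDiffOn_succ_iff_deriv_of_isOpen hV).1 hd).2.2.continuousOn
  have : ContinuousOn (fun t => deriv (deriv γ) (s * t)) annulus :=
    hc.comp (by fun_prop) hsV
  unfold curve₂
  fun_prop

lemma eventually_mem (hV : IsOpen V) {t : ℝ} (ht : s * t ∈ V) : ∀ᶠ u in 𝓝 t, s * u ∈ V :=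
  (continuous_const.mul continuous_id).continuousAt.eventually_mem (hV.mem_nhds ht)

lemma deriv_curve_eventuallyEq (hγ : ContDiffOn ℝ 2 γ V) (hV : IsOpen V) (hs : s ≠ 0) {t : ℝ}
    (ht : s * t ∈ V) : deriv (curve γ s) =ᶠ[𝓝 t] curve₁ γ s := by
  filter_upwards [eventually_mem hV ht] with u hu
  exact (hasDerivAt_curve hγ hV hs hu).deriv

lemma contDiffAt_curve {N : ℕ} (hγ : ContDiffOn ℝ N γ V) (hV : IsOpen V) {t : ℝ}
    (ht : s * t ∈ V) : ContDiffAt ℝ N (curve γ s) t := by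
  have h1 : ContDiffAt ℝ N γ (s * t) := hγ.contDiffAt (hV.mem_nhds ht)
  have h2 : ContDiffAt ℝ N (fun t => s * t) t := by fun_prop
  exact (h1.comp t h2).div_const _

end Rescaling

/-- The facts about a region, its scales and its profile that the two ends of the line share. -/
structure ScaleData (N : ℕ) (γ : ℝ → ℝ) (V : Set ℝ) (s : ℕ → ℝ) (Q : ℝ → ℝ) : Prop where
  nonflat : IsNonFlat N γ V s Q
  two_le : 2 ≤ N
  isOpen : IsOpen V
  pos : ∀ k, 0 < s k
  mem : ∀ᶠ k in atTop, ∀ t ∈ annulus, s k * t ∈ V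
  half : ∃ e : ℕ → ℕ, Tendsto e atTop atTop ∧ ∀ᶠ k in atTop, s (e k) = 1 / 2 * s k
  double : ∃ e : ℕ → ℕ, Tendsto e atTop atTop ∧ ∀ᶠ k in atTop, s (e k) = 2 * s k

namespace ScaleData

variable {N : ℕ} {γ : ℝ → ℝ} {V : Set ℝ} {s : ℕ → ℝ} {Q : ℝ → ℝ}

lemma contDiffOn_two (h : ScaleData N γ V s Q) : ContDiffOn ℝ 2 γ V :=
  h.nonflat.contDiffOn.of_le (by exact_mod_cast h.two_le)

lemma eventually_deriv_ne_zero (h : ScaleData N γ V s Q) :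
    ∀ᶠ k in atTop, deriv γ (s k) ≠ 0 := by
  filter_upwards [h.mem] with k hk
  have := h.nonflat.deriv_ne_zero _ (hk 1 (mem_annulus_of_abs (by norm_num) (by norm_num)))
  rwa [mul_one] at this

/-- The smallness of `cNorm` translated into the explicit formulas `curve₁` and `curve₂`, which are
the derivatives of `curve` because `s k * t` stays in the open region. -/
lemma eventually_approx (h : ScaleData N γ V s Q) {ε : ℝ} (hε : 0 < ε) :
    ∀ᶠ k in atTop, ∀ t ∈ annulus, |curve γ (s k) t - Q t| ≤ ε ∧
      |curve₁ γ (s k) t - iteratedDerivWithin 1 Q annulus t| ≤ ε ∧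
      |curve₂ γ (s k) t - iteratedDerivWithin 2 Q annulus t| ≤ ε := by
  filter_upwards [h.mem, h.nonflat.tendsto_profile.eventually_le_const hε] with k hk hle t ht
  have hN := h.two_le
  have hs : s k ≠ 0 := (h.pos k).ne'
  have hq : ContDiffOn ℝ N (curve γ (s k)) annulus := fun u hu =>
    (contDiffAt_curve h.nonflat.contDiffOn h.isOpen (hk u hu)).contDiffWithinAt
  have hdiff : ContDiffOn ℝ N (curve γ (s k) - Q) annulus := hq.sub h.nonflat.contDiffOn_profile
  have key : ∀ i ≤ N, |iteratedDeriv i (curve γ (s k)) t - iteratedDerivWithin i Q annulus t| ≤ ε := by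
    intro i hi
    have hi' : ((i : ℕ) : WithTop ℕ∞) ≤ N := by exact_mod_cast hi
    rw [← iteratedDerivWithin_eq_iteratedDeriv uniqueDiffOn_annulus
      ((contDiffAt_curve h.nonflat.contDiffOn h.isOpen (hk t ht)).of_le hi') ht,
      ← iteratedDerivWithin_sub ht uniqueDiffOn_annulus ((hq t ht).of_le hi')
        ((h.nonflat.contDiffOn_profile t ht).of_le hi')]
    exact (abs_iteratedDerivWithin_le_cNorm hdiff hi ht).trans hle
  have e1 := deriv_curve_eventuallyEq h.contDiffOn_two h.isOpen hs (hk t ht)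
  refine ⟨?_, ?_, ?_⟩
  · simpa using key 0 (by omega)
  · have := key 1 (by omega)
    rwa [iteratedDeriv_one, e1.eq_of_nhds] at this
  · have := key 2 (by omega)
    rwa [iteratedDeriv_succ, iteratedDeriv_one, e1.deriv_eq,
      (hasDerivAt_curve₁ h.contDiffOn_two h.isOpen (hk t ht)).deriv] at this

lemma tendsto_curve₁ (h : ScaleData N γ V s Q) {t : ℝ} (ht : t ∈ annulus) :
    Tendsto (fun k => curve₁ γ (s k) t) atTop (𝓝 (iteratedDerivWithin 1 Q annulus t)) := by
  rw [Metric.tendsto_nhds]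
  intro ε hε
  filter_upwards [h.eventually_approx (half_pos hε)] with k hk
  rw [Real.dist_eq]
  linarith [(hk t ht).2.1]

/-- By the intermediate value theorem a change of sign would create a zero of `γ'`. -/
lemma eventually_sign (h : ScaleData N γ V s Q) {a b : ℝ} (hab : Icc a b ⊆ annulus) :
    ∀ᶠ k in atTop, (∀ t ∈ Icc a b, 0 ≤ curve₁ γ (s k) t) ∨ ∀ t ∈ Icc a b, curve₁ γ (s k) t ≤ 0 := by
  filter_upwards [h.mem, h.eventually_deriv_ne_zero] with k hk hne
  by_contra! hcon
  obtain ⟨⟨t, ht, htneg⟩, ⟨u, hu, hupos⟩⟩ := hcon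
  have hc : ContinuousOn (curve₁ γ (s k)) (Icc a b) := fun v hv =>
    (hasDerivAt_curve₁ h.contDiffOn_two h.isOpen (hk v (hab hv))).continuousAt.continuousWithinAt
  obtain ⟨v, hv, hv0⟩ := isPreconnected_Icc.intermediate_value ht hu hc ⟨htneg.le, hupos.le⟩
  rw [curve₁, div_eq_zero_iff] at hv0
  rcases hv0 with h0 | h0
  · exact h.nonflat.deriv_ne_zero _ (hk v (hab hv)) h0
  · exact hne h0

/-- As a limit of functions of constant sign, `Q'` has a weak sign, so an interior zero is a local
extremum of `Q'` and forces `Q'' = 0` there. -/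
lemma profile_deriv_ne_zero_of_mem_Ioo (h : ScaleData N γ V s Q) {a b t : ℝ}
    (hab : Icc a b ⊆ annulus) (ht : t ∈ Ioo a b) : iteratedDerivWithin 1 Q annulus t ≠ 0 := by
  intro h0
  have hI : Icc a b ∈ 𝓝 t := Icc_mem_nhds ht.1 ht.2
  have hextr : IsLocalExtr (iteratedDerivWithin 1 Q annulus) t := by
    -- The sign may vary with `k`, but one of the two occurs for infinitely many `k`, which is
    -- enough for the limit.
    rcases frequently_or_distrib.1 (h.eventually_sign hab).frequently with hf | hf
    · left
      filter_upwards [hI] with u hu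
      rw [h0]
      exact ge_of_tendsto_of_frequently (h.tendsto_curve₁ (hab hu)) (hf.mono fun k hk => hk u hu)
    · right
      filter_upwards [hI] with u hu
      rw [h0]
      exact le_of_tendsto_of_frequently (h.tendsto_curve₁ (hab hu)) (hf.mono fun k hk => hk u hu)
  have hd := hextr.deriv_eq_zero
  rw [← derivWithin_of_mem_nhds (mem_of_superset hI hab), ← iteratedDerivWithin_succ] at hd
  obtain ⟨c, hc, hcle⟩ := h.nonflat.nonflat
  have := hcle t (hab (Ioo_subset_Icc_self ht))
  rw [show 2 = 1 + 1 from rfl, hd, abs_zero] at this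
  linarith

lemma profile_deriv_ne_zero_of_abs (h : ScaleData N γ V s Q) {t : ℝ} (h1 : 1 / 4 < |t|)
    (h2 : |t| < 4) : iteratedDerivWithin 1 Q annulus t ≠ 0 := by
  rcases le_total 0 t with ht | ht
  · rw [abs_of_nonneg ht] at h1 h2
    exact h.profile_deriv_ne_zero_of_mem_Ioo (by rw [annulus_eq]; exact subset_union_right) ⟨h1, h2⟩
  · rw [abs_of_nonpos ht] at h1 h2
    exact h.profile_deriv_ne_zero_of_mem_Ioo (by rw [annulus_eq]; exact subset_union_left)
      ⟨by linarith, by linarith⟩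

/-- The limit of `γ'(s c t) / γ'(s) = (γ'(s c t) / γ'(s c)) (γ'(s c) / γ'(s))`, where `s c` is again
one of the scales. -/
lemma profile_deriv_mul (h : ScaleData N γ V s Q) {c : ℝ} (hc : c ∈ annulus)
    (he : ∃ e : ℕ → ℕ, Tendsto e atTop atTop ∧ ∀ᶠ k in atTop, s (e k) = c * s k) {t : ℝ}
    (ht : t ∈ annulus) (hct : c * t ∈ annulus) :
    iteratedDerivWithin 1 Q annulus (c * t) =
      iteratedDerivWithin 1 Q annulus t * iteratedDerivWithin 1 Q annulus c := by
  obtain ⟨e, het, hes⟩ := he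
  refine tendsto_nhds_unique (h.tendsto_curve₁ hct) ?_
  refine (((h.tendsto_curve₁ ht).comp het).mul (h.tendsto_curve₁ hc)).congr' ?_
  filter_upwards [hes, h.mem, het.eventually h.eventually_deriv_ne_zero] with k hk hm hne
  simp only [Function.comp_apply, curve₁]
  rw [hk] at hne ⊢
  rw [mul_comm (s k) c, show c * s k * t = s k * (c * t) by ring,
    div_mul_div_comm, mul_comm (deriv γ (c * s k)), mul_div_mul_right _ _ hne]

/-- The extremum argument fails at the endpoints `|t| = 1/4` and `|t| = 4`. There multiplicativity
with `c = 1/2` or `c = 2` factors `Q'(t)` into values at interior points. -/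
lemma profile_deriv_ne_zero (h : ScaleData N γ V s Q) {t : ℝ} (ht : t ∈ annulus) :
    iteratedDerivWithin 1 Q annulus t ≠ 0 := by
  rcases ht.1.eq_or_lt with h1 | h1
  · have h2 : |2 * t| = 1 / 2 := by
      rw [abs_mul, ← h1]
      norm_num
    have := h.profile_deriv_mul (c := 1 / 2) (t := 2 * t)
      (mem_annulus_of_abs (by norm_num [abs_of_pos]) (by norm_num [abs_of_pos])) h.half
      (mem_annulus_of_abs (by rw [h2]; norm_num) (by rw [h2]; norm_num))
      (by rwa [← mul_assoc, show (1 / 2 : ℝ) * 2 = 1 by norm_num, one_mul])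
    rw [← mul_assoc, show (1 / 2 : ℝ) * 2 = 1 by norm_num, one_mul] at this
    rw [this]
    exact mul_ne_zero (h.profile_deriv_ne_zero_of_abs (by rw [h2]; norm_num) (by rw [h2]; norm_num))
      (h.profile_deriv_ne_zero_of_abs (by norm_num [abs_of_pos]) (by norm_num [abs_of_pos]))
  rcases ht.2.eq_or_lt with h3 | h3
  · have h2 : |1 / 2 * t| = 2 := by
      rw [abs_mul, h3]
      norm_num [abs_of_pos]
    have := h.profile_deriv_mul (c := 2) (t := 1 / 2 * t)
      (mem_annulus_of_abs (by norm_num) (by norm_num)) h.double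
      (mem_annulus_of_abs (by rw [h2]; norm_num) (by rw [h2]; norm_num))
      (by rwa [← mul_assoc, show 2 * (1 / 2 : ℝ) = 1 by norm_num, one_mul])
    rw [← mul_assoc, show 2 * (1 / 2 : ℝ) = 1 by norm_num, one_mul] at this
    rw [this]
    exact mul_ne_zero (h.profile_deriv_ne_zero_of_abs (by rw [h2]; norm_num) (by rw [h2]; norm_num))
      (h.profile_deriv_ne_zero_of_abs (by norm_num) (by norm_num))
  exact h.profile_deriv_ne_zero_of_abs h1 h3

/-- Every `K` above a threshold works, so that the two ends of the line can share one constant. -/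
lemma exists_phaseBounds (h : ScaleData N γ V s Q) :
    ∃ K₀ : ℝ, ∀ K, K₀ ≤ K → ∀ᶠ k in atTop, deriv γ (s k) ≠ 0 ∧
      PhaseBounds (curve γ (s k)) (curve₁ γ (s k)) (curve₂ γ (s k)) K ∧
      ∀ t ∈ annulus, |curve γ (s k) t| ≤ 2 * cNorm 2 Q := by
  have hQ2 : ContDiffOn ℝ (2 : ℕ) Q annulus :=
    h.nonflat.contDiffOn_profile.of_le (by exact_mod_cast h.two_le)
  set D := cNorm 2 Q with hD
  have hDle : ∀ i ≤ 2, ∀ t ∈ annulus, |iteratedDerivWithin i Q annulus t| ≤ D := fun i hi t ht =>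
    abs_iteratedDerivWithin_le_cNorm hQ2 hi ht
  have h1mem : (1 : ℝ) ∈ annulus := mem_annulus_of_abs (by norm_num) (by norm_num)
  have hDpos : 0 < D := by
    obtain ⟨c, hc, hcle⟩ := h.nonflat.nonflat
    exact hc.trans_le ((hcle 1 h1mem).trans (hDle 2 le_rfl 1 h1mem))
  obtain ⟨t₀, ht₀, hmin⟩ := isCompact_annulus.exists_isMinOn ⟨1, h1mem⟩
    ((hQ2.continuousOn_iteratedDerivWithin (m := 1) (by norm_num) uniqueDiffOn_annulus).abs)
  set c := |iteratedDerivWithin 1 Q annulus t₀| with hc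
  have hcpos : 0 < c := abs_pos.2 (h.profile_deriv_ne_zero ht₀)
  -- `D` bounds `Q` and its first two derivatives, `c` is the minimum of `|Q'|`; approximation
  -- within `D` and within `c / 2` leaves the upper bound `2 D` and the lower bound `c / 2`.
  refine ⟨max 1 (max (2 * D) (2 / c)), fun K hK => ?_⟩
  have hK1 : 1 ≤ K := (le_max_left _ _).trans hK
  have hK2 : 2 * D ≤ K := ((le_max_left _ _).trans (le_max_right _ _)).trans hK
  have hK3 : 2 / c ≤ K := ((le_max_right _ _).trans (le_max_right _ _)).trans hK
  have hK4 : K⁻¹ ≤ c / 2 := by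
    rw [inv_le_comm₀ (by linarith) (by positivity), inv_div]
    exact hK3
  filter_upwards [h.mem, h.eventually_deriv_ne_zero, h.eventually_approx hDpos,
    h.eventually_approx (half_pos hcpos)] with k hm hne ha hb
  have htri : ∀ x y : ℝ, |x| ≤ |x - y| + |y| := fun x y => by
    simpa using abs_add_le (x - y) y
  refine ⟨hne, ⟨hK1, fun t ht => hasDerivAt_curve h.contDiffOn_two h.isOpen (h.pos k).ne' (hm t ht),
    fun t ht => hasDerivAt_curve₁ h.contDiffOn_two h.isOpen (hm t ht),
    continuousOn_curve₂ h.contDiffOn_two h.isOpen hm, fun t ht => ?_, fun t ht => ?_,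
    fun t ht => ?_⟩, fun t ht => ?_⟩
  · have h1 := (hb t ht).2.1
    have h2 : c ≤ |iteratedDerivWithin 1 Q annulus t| := hmin ht
    have h3 := htri (iteratedDerivWithin 1 Q annulus t) (curve₁ γ (s k) t)
    rw [abs_sub_comm] at h3
    linarith
  · linarith [htri (curve₁ γ (s k) t) (iteratedDerivWithin 1 Q annulus t), (ha t ht).2.1,
      hDle 1 (by norm_num) t ht]
  · linarith [htri (curve₂ γ (s k) t) (iteratedDerivWithin 2 Q annulus t), (ha t ht).2.2,
      hDle 2 le_rfl t ht]
  · have h0 := hDle 0 (by norm_num) t ht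
    rw [iteratedDerivWithin_zero] at h0
    linarith [htri (curve γ (s k) t) (Q t), (ha t ht).1]

end ScaleData

lemma IsNonFlatNearZero.scaleData {N : ℕ} (hN : 2 ≤ N) {γ Q : ℝ → ℝ}
    (h : IsNonFlatNearZero N γ Q) :
    ∃ V, ScaleData N γ V (fun j => (2 : ℝ) ^ (-(j : ℤ))) Q := by
  obtain ⟨δ, hδ, h⟩ := h
  refine ⟨_, h, hN, ?_, fun k => by positivity, ?_, ⟨fun k => k + 1, tendsto_add_atTop_nat 1,
    Eventually.of_forall fun k => ?_⟩, ⟨fun k => k - 1, tendsto_sub_atTop_nat 1, ?_⟩⟩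
  · exact (isOpen_lt continuous_const continuous_abs).inter
      (isOpen_lt continuous_abs continuous_const)
  · have ht : Tendsto (fun k : ℕ => (2 : ℝ) ^ (-(k : ℤ))) atTop (𝓝 0) := by
      simp only [zpow_neg, zpow_natCast, ← inv_pow]
      exact tendsto_pow_atTop_nhds_zero_of_lt_one (by norm_num) (by norm_num)
    filter_upwards [ht.eventually_lt_const (show 0 < δ / 4 by positivity)] with k hk t ht
    have h2 : (0 : ℝ) < 2 ^ (-(k : ℤ)) := by positivity
    have h3 : |(2 : ℝ) ^ (-(k : ℤ)) * t| = 2 ^ (-(k : ℤ)) * |t| := by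
      rw [abs_mul, abs_of_pos h2]
    simp only [h3]
    exact ⟨mul_pos h2 (lt_of_lt_of_le (by norm_num) ht.1), by nlinarith [ht.1, ht.2]⟩
  · push_cast
    rw [neg_add, zpow_add₀ two_ne_zero, mul_comm]
    norm_num
  · filter_upwards [eventually_ge_atTop 1] with k hk
    push_cast [hk]
    rw [neg_sub, sub_eq_add_neg, zpow_add₀ two_ne_zero]
    norm_num

lemma IsNonFlatNearInfinity.scaleData {N : ℕ} (hN : 2 ≤ N) {γ Q : ℝ → ℝ}
    (h : IsNonFlatNearInfinity N γ Q) :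
    ∃ V, ScaleData N γ V (fun j => (2 : ℝ) ^ (j : ℤ)) Q := by
  obtain ⟨R, hR, h⟩ := h
  refine ⟨_, h, hN, ?_, fun k => by positivity, ?_, ⟨fun k => k - 1, tendsto_sub_atTop_nat 1, ?_⟩,
    ⟨fun k => k + 1, tendsto_add_atTop_nat 1, Eventually.of_forall fun k => ?_⟩⟩
  · exact isOpen_lt continuous_const continuous_abs
  · have ht : Tendsto (fun k : ℕ => (2 : ℝ) ^ (k : ℤ)) atTop atTop := by
      simp only [zpow_natCast]
      exact tendsto_pow_atTop_atTop_of_one_lt one_lt_two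
    filter_upwards [ht.eventually_gt_atTop (4 * R)] with k hk t ht
    have h2 : (0 : ℝ) < 2 ^ (k : ℤ) := by positivity
    have h3 : |(2 : ℝ) ^ (k : ℤ) * t| = 2 ^ (k : ℤ) * |t| := by
      rw [abs_mul, abs_of_pos h2]
    simp only [h3]
    nlinarith [ht.1, ht.2]
  · filter_upwards [eventually_ge_atTop 1] with k hk
    push_cast [hk]
    rw [sub_eq_add_neg, zpow_add₀ two_ne_zero, mul_comm]
    norm_num
  · push_cast
    rw [zpow_add₀ two_ne_zero, mul_comm]
    norm_num

/-- The amplitude `2^{-j} γ'(2^{-j})` of the curve at the scale `2^{-j}`. -/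
def amplitude (γ : ℝ → ℝ) (j : ℤ) : ℝ := (2 : ℝ) ^ (-j) * deriv γ ((2 : ℝ) ^ (-j))

/-- The bounds on the curve which hold uniformly over the scales `|j| > j₀`. -/
structure UniformCurve (γ Q₀ Qinf : ℝ → ℝ) (j₀ : ℕ) (K : ℝ) (B : ℕ) : Prop where
  ne_zero : ∀ j : ℤ, (j₀ : ℤ) < |j| → deriv γ ((2 : ℝ) ^ (-j)) ≠ 0
  phase : ∀ j : ℤ, (j₀ : ℤ) < |j| → PhaseBounds (curve γ ((2 : ℝ) ^ (-j)))
    (curve₁ γ ((2 : ℝ) ^ (-j))) (curve₂ γ ((2 : ℝ) ^ (-j))) K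
  abs_le : ∀ j : ℤ, (j₀ : ℤ) < |j| → ∀ t ∈ annulus,
    |curve γ ((2 : ℝ) ^ (-j)) t| ≤ 2 * cNorm 2 (profileAt Q₀ Qinf j)
  count : ∀ α : ℝ, 0 < α →
    {j : ℤ | α ≤ |amplitude γ j| ∧ |amplitude γ j| ≤ 2 * α}.encard ≤ B

/-- The scales `2^{-j}` with `j > 0` come from the condition at zero, those with `j ≤ 0` from the
one at infinity; the counts of the variation hypotheses add up. -/
lemma exists_uniformCurve {N : ℕ} (hN : 2 ≤ N) {γ Q₀ Qinf : ℝ → ℝ}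
    (h₀ : IsNonFlatNearZero N γ Q₀) (hinf : IsNonFlatNearInfinity N γ Qinf) :
    ∃ (j₀ : ℕ) (K : ℝ) (B : ℕ), UniformCurve γ Q₀ Qinf j₀ K B := by
  obtain ⟨V₀, d₀⟩ := h₀.scaleData hN
  obtain ⟨V₁, d₁⟩ := hinf.scaleData hN
  obtain ⟨K₀, hK₀⟩ := d₀.exists_phaseBounds
  obtain ⟨K₁, hK₁⟩ := d₁.exists_phaseBounds
  obtain ⟨B₀, hB₀⟩ := d₀.nonflat.variation
  obtain ⟨B₁, hB₁⟩ := d₁.nonflat.variation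
  set K := max K₀ K₁ with hK
  have e₀ := hK₀ K (le_max_left _ _)
  have e₁ := hK₁ K (le_max_right _ _)
  obtain ⟨n₀, hn₀⟩ := eventually_atTop.1 (e₀.and e₁)
  have hcase : ∀ j : ℤ, (n₀ : ℤ) < |j| → deriv γ ((2 : ℝ) ^ (-j)) ≠ 0 ∧
      PhaseBounds (curve γ ((2 : ℝ) ^ (-j))) (curve₁ γ ((2 : ℝ) ^ (-j)))
        (curve₂ γ ((2 : ℝ) ^ (-j))) K ∧
      ∀ t ∈ annulus, |curve γ ((2 : ℝ) ^ (-j)) t| ≤ 2 * cNorm 2 (profileAt Q₀ Qinf j) := by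
    intro j hj
    rcases lt_or_ge 0 j with hj0 | hj0
    · rw [profileAt, if_pos hj0]
      have := (hn₀ j.toNat (by rw [abs_of_pos hj0] at hj; omega)).1
      simpa only [Int.toNat_of_nonneg hj0.le] using this
    · rw [profileAt, if_neg (by omega)]
      have := (hn₀ (-j).toNat (by rw [abs_of_nonpos hj0] at hj; omega)).2
      simpa only [Int.toNat_of_nonneg (neg_nonneg.2 hj0)] using this
  refine ⟨n₀, K, B₀ + B₁, fun j hj => (hcase j hj).1, fun j hj => (hcase j hj).2.1,
    fun j hj => (hcase j hj).2.2, fun α hα => ?_⟩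
  have hsub : {j : ℤ | α ≤ |amplitude γ j| ∧ |amplitude γ j| ≤ 2 * α} ⊆
      (fun k : ℕ => (k : ℤ)) '' {k : ℕ | α ≤ |(2 : ℝ) ^ (-(k : ℤ)) * deriv γ ((2 : ℝ) ^ (-(k : ℤ)))|
        ∧ |(2 : ℝ) ^ (-(k : ℤ)) * deriv γ ((2 : ℝ) ^ (-(k : ℤ)))| ≤ 2 * α} ∪
      (fun k : ℕ => -(k : ℤ)) '' {k : ℕ | α ≤ |(2 : ℝ) ^ (k : ℤ) * deriv γ ((2 : ℝ) ^ (k : ℤ))|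
        ∧ |(2 : ℝ) ^ (k : ℤ) * deriv γ ((2 : ℝ) ^ (k : ℤ))| ≤ 2 * α} := by
    intro j hj
    rcases le_total 0 j with hj0 | hj0
    · obtain ⟨k, rfl⟩ := Int.eq_ofNat_of_zero_le hj0
      exact Or.inl ⟨k, hj, rfl⟩
    · obtain ⟨k, hk⟩ := Int.eq_ofNat_of_zero_le (neg_nonneg.2 hj0)
      have hjk : j = -(k : ℤ) := by
        have : -j = (k : ℤ) := hk
        omega
      subst hjk
      refine Or.inr ⟨k, ?_, rfl⟩
      simpa only [mem_ofPred_eq, amplitude, neg_neg] using hj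
  refine (Set.encard_le_encard hsub).trans ((Set.encard_union_le _ _).trans ?_)
  push_cast
  exact add_le_add ((Set.encard_image_le _ _).trans (hB₀ α hα))
    ((Set.encard_image_le _ _).trans (hB₁ α hα))

end
end BilinearMax

/-! ### From separated symbols to positive averages along the curve. -/

namespace BilinearMax
noncomputable section

lemma measurable_wave_uncurry {q : ℝ → ℝ} (hq : Measurable q) (s σ : ℝ) :
    Measurable fun p : (ℝ × ℝ) × ℝ => wave (p.1.1 * s) (p.1.2 * σ) q p.2 := by
  unfold wave
  fun_prop

/-- The Fubini step: integrating in the frequencies first decouples the two functions. -/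
lemma enorm_integral_wave_le {A B b : ℝ → ℂ} (hA : Integrable A) (hB : Integrable B)
    (hb : Integrable b) {q : ℝ → ℝ} (hq : Measurable q) (s σ : ℝ) :
    ‖∫ z : ℝ × ℝ, A z.1 * B z.2 * ∫ t, wave (z.1 * s) (z.2 * σ) q t * b t‖ₑ ≤
      ∫⁻ t, ‖b t‖ₑ * (‖∫ ξ : ℝ, A ξ * Complex.exp (-(Complex.I * ((ξ * s * t : ℝ) : ℂ)))‖ₑ *
        ‖∫ η : ℝ, B η * Complex.exp (Complex.I * ((η * σ * q t : ℝ) : ℂ))‖ₑ) := by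
  have hint : Integrable (fun p : (ℝ × ℝ) × ℝ =>
      A p.1.1 * B p.1.2 * (wave (p.1.1 * s) (p.1.2 * σ) q p.2 * b p.2))
      ((volume.prod volume).prod volume) := by
    have h1 : Integrable (fun p : (ℝ × ℝ) × ℝ => A p.1.1 * B p.1.2 * b p.2)
      ((volume.prod volume).prod volume) := (hA.mul_prod hB).mul_prod hb
    have h2 := h1.bdd_mul (f := fun p : (ℝ × ℝ) × ℝ => wave (p.1.1 * s) (p.1.2 * σ) q p.2)
      (c := 1) (measurable_wave_uncurry hq s σ).aestronglyMeasurable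
      (Eventually.of_forall fun p => (norm_wave _ _ _ _).le)
    refine h2.congr (Eventually.of_forall fun p => ?_)
    simp only
    ring
  have e1 : ∫ z : ℝ × ℝ, A z.1 * B z.2 * ∫ t, wave (z.1 * s) (z.2 * σ) q t * b t =
      ∫ t, b t * ((∫ ξ : ℝ, A ξ * Complex.exp (-(Complex.I * ((ξ * s * t : ℝ) : ℂ)))) *
        ∫ η : ℝ, B η * Complex.exp (Complex.I * ((η * σ * q t : ℝ) : ℂ))) := by
    have e0 : ∀ z : ℝ × ℝ, A z.1 * B z.2 * ∫ t, wave (z.1 * s) (z.2 * σ) q t * b t =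
        ∫ t, A z.1 * B z.2 * (wave (z.1 * s) (z.2 * σ) q t * b t) :=
      fun z => (integral_const_mul _ _).symm
    simp_rw [e0]
    rw [integral_integral_swap hint]
    refine integral_congr_ae (Eventually.of_forall fun t => ?_)
    simp only
    rw [← integral_prod_mul, ← integral_const_mul]
    refine integral_congr_ae (Eventually.of_forall fun z => ?_)
    simp only [wave]
    ring
  rw [e1]
  refine (enorm_integral_le_lintegral_enorm _).trans (le_of_eq ?_)
  simp_rw [enorm_mul]

/-- The set on which averages over the curve are taken. -/
def window : Set ℝ := {t | 1 / 4 ≤ |t| ∧ |t| ≤ 1}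

lemma measurableSet_window : MeasurableSet window :=
  (isClosed_le continuous_const continuous_abs).measurableSet.inter
    (isClosed_le continuous_abs continuous_const).measurableSet

lemma volume_window_le : volume window ≤ 2 := by
  have : window ⊆ Icc (-1) 1 := fun t ht => _root_.abs_le.1 ht.2
  refine (measure_mono this).trans ?_
  rw [Real.volume_Icc]
  norm_num

/-- Fourier-side factors which are admissible with constant `H`: bounded by `H`, and with Fourier
transform decaying quadratically with constant `H`. -/
structure Factor (h : ℝ → ℝ) (H : ℝ) : Prop where
  continuous : Continuous h
  hasCompactSupport : HasCompactSupport h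
  bound : ∀ u, |h u| ≤ H
  decay : ∀ s : ℝ, ‖∫ u : ℝ, (h u : ℂ) * Complex.exp (Complex.I * s * u)‖ ≤ H / (1 + s ^ 2)

lemma Factor.nonneg {h : ℝ → ℝ} {H : ℝ} (hh : Factor h H) : 0 ≤ H :=
  (abs_nonneg _).trans (hh.bound 0)

lemma norm_exp_I_mul_mul (x y : ℝ) : ‖Complex.exp (Complex.I * x * y)‖ = 1 := by
  rw [show Complex.I * x * y = ((x * y : ℝ) : ℂ) * Complex.I by push_cast; ring,
    Complex.norm_exp_ofReal_mul_I]

lemma measurable_fourierHat (f : 𝓢(ℝ, ℂ)) : Measurable (fourierHat f) := by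
  unfold fourierHat
  refine Measurable.const_mul ?_ _
  refine StronglyMeasurable.measurable ?_
  refine StronglyMeasurable.integral_prod_right (f := fun ξ x : ℝ =>
    f x * Complex.exp (-(Complex.I * x * ξ))) ?_
  refine Measurable.stronglyMeasurable ?_
  have := f.continuous.measurable
  unfold Function.uncurry
  fun_prop

lemma integrable_freqFactor (f : 𝓢(ℝ, ℂ)) {h : ℝ → ℝ} {H : ℝ} (hh : Factor h H) (lam x : ℝ) :
    Integrable fun ξ : ℝ => fourierHat f ξ * (h (ξ / lam) : ℂ) * Complex.exp (Complex.I * ξ * x) := by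
  have hc := hh.continuous
  have hm := measurable_fourierHat f
  refine ((integrable_fourierHat f).norm.mul_const H).mono' (by fun_prop)
    (Eventually.of_forall fun ξ => ?_)
  rw [norm_mul, norm_mul, norm_exp_I_mul_mul, mul_one, Complex.norm_real]
  exact mul_le_mul_of_nonneg_left (hh.bound _) (norm_nonneg _)

/-- In each term of the expansion the frequency integrals are performed first: the wave at time `t`
only translates, so they give localized versions of `f` and `g` at `x - s t` and `x + σ q(t)`. The
terms are then summed with weights `B k (H k L k)`, the positive average being common to all of
them. -/
lemma enorm_tsum_waves_le {ι : Type*} [Countable ι] (f g : 𝓢(ℝ, ℂ)) (x : ℝ) {q : ℝ → ℝ}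
    (hq : Measurable q) (s σ : ℝ) {lam mu : ℝ} (hlam : lam ≠ 0) (hmu : mu ≠ 0)
    {h l : ι → ℝ → ℝ} {H L B : ι → ℝ} (hh : ∀ k, Factor (h k) (H k))
    (hl : ∀ k, Factor (l k) (L k)) {b : ι → ℝ → ℂ} (hbi : ∀ k, Integrable (b k))
    (hB0 : ∀ k, 0 ≤ B k) (hbB : ∀ k t, ‖b k t‖ ≤ B k) (hbw : ∀ k, ∀ t ∉ window, b k t = 0)
    {S : ℝ} (hsum : HasSum (fun k => B k * (H k * L k)) S) {μ : ℝ → ℝ → ℂ}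
    (hμ : ∀ ξ η, HasSum (fun k => ((h k (ξ / lam) : ℝ) : ℂ) * ((l k (η / mu) : ℝ) : ℂ) *
      ∫ t, wave (ξ * s) (η * σ) q t * b k t) (μ ξ η)) :
    ‖∫ z : ℝ × ℝ, multiplierIntegrand μ f g x z.1 z.2‖ₑ ≤ ENNReal.ofReal S *
      ∫⁻ t in window, avgKernel |lam|⁻¹ (fun y => ‖f y‖ₑ) (x - s * t) *
        avgKernel |mu|⁻¹ (fun y => ‖g y‖ₑ) (x + σ * q t) := by
  set A : ι → ℝ → ℂ := fun k ξ =>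
    fourierHat f ξ * (h k (ξ / lam) : ℂ) * Complex.exp (Complex.I * ξ * x) with hA
  set D : ι → ℝ → ℂ := fun k η =>
    fourierHat g η * (l k (η / mu) : ℂ) * Complex.exp (Complex.I * η * x) with hD
  have hAi : ∀ k, Integrable (A k) := fun k => integrable_freqFactor f (hh k) lam x
  have hDi : ∀ k, Integrable (D k) := fun k => integrable_freqFactor g (hl k) mu x
  set T : ι → ℝ × ℝ → ℂ := fun k z =>
    A k z.1 * D k z.2 * ∫ t, wave (z.1 * s) (z.2 * σ) q t * b k t with hT
  have hwm : ∀ k, AEStronglyMeasurable (fun z : ℝ × ℝ =>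
      ∫ t, wave (z.1 * s) (z.2 * σ) q t * b k t) (volume.prod volume) := by
    intro k
    refine AEStronglyMeasurable.integral_prod_right' (f := fun p : (ℝ × ℝ) × ℝ =>
      wave (p.1.1 * s) (p.1.2 * σ) q p.2 * b k p.2) ?_
    exact (measurable_wave_uncurry hq s σ).aestronglyMeasurable.mul
      (hbi k).aestronglyMeasurable.comp_snd
  have hwb : ∀ k (z : ℝ × ℝ), ‖∫ t, wave (z.1 * s) (z.2 * σ) q t * b k t‖ₑ ≤
      ENNReal.ofReal (B k) * 2 := by
    intro k z
    refine (enorm_integral_le_lintegral_enorm _).trans ?_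
    calc ∫⁻ t, ‖wave (z.1 * s) (z.2 * σ) q t * b k t‖ₑ
        ≤ ∫⁻ t, window.indicator (fun _ => ENNReal.ofReal (B k)) t := by
          refine lintegral_mono fun t => ?_
          by_cases ht : t ∈ window
          · rw [indicator_of_mem ht, ← ofReal_norm, norm_mul, norm_wave, one_mul]
            exact ENNReal.ofReal_le_ofReal (hbB k t)
          · rw [hbw k t ht]
            simp
      _ = ENNReal.ofReal (B k) * volume window := by
          rw [lintegral_indicator measurableSet_window, setLIntegral_const]
      _ ≤ _ := by
          gcongr
          exact volume_window_le
  have hTm : ∀ k, AEStronglyMeasurable (T k) (volume.prod volume) := fun k =>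
    ((hAi k).mul_prod (hDi k)).aestronglyMeasurable.mul (hwm k)
  -- Absolute convergence, which justifies exchanging the series and the double integral: the
  -- transforms are integrable and the weights are summable.
  have hTsum : ∑' k, ∫⁻ z, ‖T k z‖ₑ ∂(volume.prod volume) ≠ ⊤ := by
    set N : ℝ≥0∞ := (∫⁻ ξ, ‖fourierHat f ξ‖ₑ) * ∫⁻ η, ‖fourierHat g η‖ₑ with hN
    have hNtop : N ≠ ⊤ := ENNReal.mul_ne_top (integrable_fourierHat f).2.ne
      (integrable_fourierHat g).2.ne
    have hle : ∀ k, ∫⁻ z, ‖T k z‖ₑ ∂(volume.prod volume) ≤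
        ENNReal.ofReal (B k * (H k * L k)) * (2 * N) := by
      intro k
      have hpt : ∀ z : ℝ × ℝ, ‖T k z‖ₑ ≤ ENNReal.ofReal (B k * (H k * L k)) * 2 *
          (‖fourierHat f z.1‖ₑ * ‖fourierHat g z.2‖ₑ) := by
        intro z
        have e1 : ‖A k z.1‖ₑ ≤ ‖fourierHat f z.1‖ₑ * ENNReal.ofReal (H k) := by
          rw [hA]
          simp only
          rw [enorm_mul, enorm_mul, ← ofReal_norm (Complex.exp _), norm_exp_I_mul_mul,
            ENNReal.ofReal_one, mul_one]
          gcongr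
          rw [← ofReal_norm, Complex.norm_real]
          exact ENNReal.ofReal_le_ofReal ((hh k).bound _)
        have e2 : ‖D k z.2‖ₑ ≤ ‖fourierHat g z.2‖ₑ * ENNReal.ofReal (L k) := by
          rw [hD]
          simp only
          rw [enorm_mul, enorm_mul, ← ofReal_norm (Complex.exp _), norm_exp_I_mul_mul,
            ENNReal.ofReal_one, mul_one]
          gcongr
          rw [← ofReal_norm, Complex.norm_real]
          exact ENNReal.ofReal_le_ofReal ((hl k).bound _)
        rw [hT]
        simp only
        rw [enorm_mul, enorm_mul]
        refine (mul_le_mul' (mul_le_mul' e1 e2) (hwb k z)).trans (le_of_eq ?_)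
        rw [ENNReal.ofReal_mul (hB0 k), ENNReal.ofReal_mul (hh k).nonneg]
        ring
      refine (lintegral_mono hpt).trans (le_of_eq ?_)
      have hmf := measurable_fourierHat f
      have hmg := measurable_fourierHat g
      rw [lintegral_const_mul _ (by fun_prop), lintegral_prod_mul hmf.enorm.aemeasurable
        hmg.enorm.aemeasurable, hN, mul_assoc]
    refine ne_top_of_le_ne_top ?_ (ENNReal.tsum_le_tsum hle)
    rw [ENNReal.tsum_mul_right]
    refine ENNReal.mul_ne_top ?_ (ENNReal.mul_ne_top (by simp) hNtop)
    exact hsum.summable.tsum_ofReal_ne_top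
  have hInt : ∀ z : ℝ × ℝ, multiplierIntegrand μ f g x z.1 z.2 = ∑' k, T k z := by
    intro z
    have := ((hμ z.1 z.2).mul_left (fourierHat f z.1 * fourierHat g z.2 *
      Complex.exp (Complex.I * z.1 * x) * Complex.exp (Complex.I * z.2 * x))).tsum_eq
    rw [multiplierIntegrand]
    calc _ = _ := by ring
      _ = _ := this.symm
      _ = _ := by
        refine tsum_congr fun k => ?_
        rw [hT, hA, hD]
        ring
  have hterm : ∀ k, ‖∫ z, T k z ∂(volume.prod volume)‖ₑ ≤ ENNReal.ofReal (B k * (H k * L k)) *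
      ∫⁻ t in window, avgKernel |lam|⁻¹ (fun y => ‖f y‖ₑ) (x - s * t) *
        avgKernel |mu|⁻¹ (fun y => ‖g y‖ₑ) (x + σ * q t) := by
    intro k
    refine (enorm_integral_wave_le (hAi k) (hDi k) (hbi k) hq s σ).trans ?_
    rw [← lintegral_indicator measurableSet_window, ← lintegral_const_mul' _ _ ENNReal.ofReal_ne_top]
    refine lintegral_mono fun t => ?_
    simp only
    by_cases ht : t ∈ window
    swap
    · rw [hbw k t ht]
      simp
    rw [indicator_of_mem ht]
    have hmg : Measurable g := g.continuous.measurable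
    have hmf : Measurable f := f.continuous.measurable
    have e1 : ‖∫ ξ : ℝ, A k ξ * Complex.exp (-(Complex.I * ((ξ * s * t : ℝ) : ℂ)))‖ₑ ≤
        ENNReal.ofReal (H k) * avgKernel |lam|⁻¹ (fun y => ‖f y‖ₑ) (x - s * t) := by
      have := enorm_freqLocal_le f.integrable hmf
        ((hh k).continuous.integrable_of_hasCompactSupport (hh k).hasCompactSupport)
        (hh k).continuous.measurable (hh k).decay hlam (x - s * t)
      convert this using 4 with ξ
      rw [hA]
      simp only
      rw [mul_assoc, ← Complex.exp_add]
      congr 2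
      push_cast
      ring
    have e2 : ‖∫ η : ℝ, D k η * Complex.exp (Complex.I * ((η * σ * q t : ℝ) : ℂ))‖ₑ ≤
        ENNReal.ofReal (L k) * avgKernel |mu|⁻¹ (fun y => ‖g y‖ₑ) (x + σ * q t) := by
      have := enorm_freqLocal_le g.integrable hmg
        ((hl k).continuous.integrable_of_hasCompactSupport (hl k).hasCompactSupport)
        (hl k).continuous.measurable (hl k).decay hmu (x + σ * q t)
      convert this using 4 with ξ
      rw [hD]
      simp only
      rw [mul_assoc, ← Complex.exp_add]
      congr 2
      push_cast
      ring
    have e3 : ‖b k t‖ₑ ≤ ENNReal.ofReal (B k) := by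
      rw [← ofReal_norm]
      exact ENNReal.ofReal_le_ofReal (hbB k t)
    refine (mul_le_mul' e3 (mul_le_mul' e1 e2)).trans (le_of_eq ?_)
    rw [ENNReal.ofReal_mul (hB0 k), ENNReal.ofReal_mul (hh k).nonneg]
    ring
  calc ‖∫ z : ℝ × ℝ, multiplierIntegrand μ f g x z.1 z.2‖ₑ
      = ‖∑' k, ∫ z, T k z ∂(volume.prod volume)‖ₑ := by
        rw [← integral_tsum hTm hTsum]
        simp_rw [hInt]
        rfl
    _ ≤ ∑' k, ‖∫ z, T k z ∂(volume.prod volume)‖ₑ := enorm_tsum_le_tsum_enorm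
    _ ≤ _ := ENNReal.tsum_le_tsum hterm
    _ = _ := by
        rw [ENNReal.tsum_mul_right, ← ENNReal.ofReal_tsum_of_nonneg
          (fun k => mul_nonneg (hB0 k) (mul_nonneg (hh k).nonneg (hl k).nonneg)) hsum.summable,
          hsum.tsum_eq]

end
end BilinearMax

/-! ### Domination of the localized operators, with gain `2^{-max(m,n)}`. -/

namespace BilinearMax
noncomputable section

/-- Frequency cutoffs of class `C²` supported in `[-2, 2]`. -/
structure LowCutoff (φ : ℝ → ℝ) : Prop where
  contDiff : ContDiff ℝ 2 φ
  eq_zero : ∀ u, 2 < |u| → φ u = 0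

/-- Frequency cutoffs of class `C²` supported in `{1/2 ≤ |u| ≤ 2}`. -/
structure HighCutoff (φ : ℝ → ℝ) : Prop extends LowCutoff φ where
  eq_zero_of_lt : ∀ u, |u| < 1 / 2 → φ u = 0

lemma LowCutoff.factor {φ θ : ℝ → ℝ} (hφ : LowCutoff φ) (hθ : ContDiff ℝ 2 θ) {S L : ℝ}
    (h : HasPowerDecay φ θ S L) (k : ℕ) : Factor (fun u => φ u * θ u ^ k) (S * (4 * L) ^ k) where
  continuous := (contDiff_mul_pow hφ.contDiff hθ k).continuous
  hasCompactSupport := hasCompactSupport_of_two_lt fun u hu => by rw [hφ.eq_zero u hu, zero_mul]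
  bound := (h k).1
  decay := (h k).2

/-- The multiplier `m_j(ξ, η) φ₁(ξ / 2^{m+j}) φ₂(γ'(2^{-j}) η / 2^{n+j})`. -/
def symbolCut (γ ρ φ₁ φ₂ : ℝ → ℝ) (j m n : ℤ) (ξ η : ℝ) : ℂ :=
  symbol γ ρ j ξ η * (φ₁ (ξ / (2 : ℝ) ^ (m + j)) : ℂ) *
    (φ₂ (deriv γ ((2 : ℝ) ^ (-j)) * η / (2 : ℝ) ^ (n + j)) : ℂ)

/-- The positive bilinear averages along the curve which dominate the multiplier operators. -/
def curveAverage (γ : ℝ → ℝ) (j m n : ℤ) (F G : ℝ → ℝ≥0∞) (x : ℝ) : ℝ≥0∞ :=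
  ∫⁻ t in window, avgKernel ((2 : ℝ) ^ (-(m + j))) F (x - (2 : ℝ) ^ (-j) * t) *
    avgKernel ((2 : ℝ) ^ (-n) * |amplitude γ j|) G
      (x + amplitude γ j * annulus.indicator (curve γ ((2 : ℝ) ^ (-j))) t)

lemma IsAveragingKernel.tsupport_subset_window {ρ : ℝ → ℝ} (hρ : IsAveragingKernel ρ) :
    tsupport ρ ⊆ window := fun _ ht => ⟨(hρ.support_subset ht).1.le, (hρ.support_subset ht).2.le⟩

/-- The rescaled curve is only controlled on the annulus. Replacing it by zero elsewhere makes it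
measurable and changes nothing, since the amplitudes vanish there. -/
lemma integral_wave_indicator (a e : ℝ) (q : ℝ → ℝ) {b : ℝ → ℂ} (hb : ∀ t ∉ annulus, b t = 0) :
    ∫ t, wave a e (annulus.indicator q) t * b t = ∫ t, wave a e q t * b t := by
  refine integral_congr_ae (Eventually.of_forall fun t => ?_)
  simp only
  by_cases ht : t ∈ annulus
  · rw [wave, wave, indicator_of_mem ht]
  · rw [hb t ht, mul_zero, mul_zero]

lemma symbol_eq_integral_wave {γ ρ : ℝ → ℝ} {j : ℤ} (hj : amplitude γ j ≠ 0) (ξ η : ℝ) :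
    symbol γ ρ j ξ η = ∫ t, wave (ξ * (2 : ℝ) ^ (-j)) (η * amplitude γ j)
      (curve γ ((2 : ℝ) ^ (-j))) t * (ρ t : ℂ) := by
  rw [symbol]
  congr 1
  ext t
  rw [wave]
  have e1 : ξ / (2 : ℝ) ^ j * t = ξ * (2 : ℝ) ^ (-j) * t := by rw [zpow_neg, div_eq_mul_inv]
  have e2 : η * γ (t / (2 : ℝ) ^ j) = η * amplitude γ j * curve γ ((2 : ℝ) ^ (-j)) t := by
    rw [curve, ← amplitude, mul_assoc, mul_div_cancel₀ _ hj, zpow_neg, div_eq_inv_mul]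
  rw [e1, e2]

lemma PhaseBounds.measurable_indicator {q q₁ q₂ : ℝ → ℝ} {K : ℝ} (h : PhaseBounds q q₁ q₂ K) :
    Measurable (annulus.indicator q) := by
  have hq : ContinuousOn q annulus := fun t ht =>
    (h.hasDerivAt t ht).continuousAt.continuousWithinAt
  classical
  rw [← piecewise_eq_indicator]
  exact hq.measurable_piecewise continuousOn_const measurableSet_annulus

lemma PhaseBounds.integrable_amp {q q₁ q₂ ρ : ℝ → ℝ} {K : ℝ} (h : PhaseBounds q q₁ q₂ K)
    (hρ : IsAveragingKernel ρ) (k : ℤ) : Integrable fun t => (amp ρ q₁ q₂ k t : ℂ) := by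
  refine integrable_of_continuousOn_tsupport hρ.hasCompactSupport ?_ fun t ht => ?_
  · exact Complex.continuous_ofReal.comp_continuousOn
      ((h.continuousOn_amp hρ k).mono hρ.tsupport_subset_annulus)
  · rw [amp_eq_zero ht, Complex.ofReal_zero]

section Domination

variable {γ ρ φ₁ φ₂ : ℝ → ℝ} {K : ℝ} {j : ℤ}

lemma amplitude_ne_zero (hj : deriv γ ((2 : ℝ) ^ (-j)) ≠ 0) : amplitude γ j ≠ 0 :=
  mul_ne_zero (by positivity) hj

/-- In the variable `η` the cutoff lives at frequency `2^n / amplitude γ j`, so the averages of `g`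
have width `2^{-n} |amplitude γ j|`. -/
lemma cutoff_arg_eq (n : ℤ) (η : ℝ) :
    deriv γ ((2 : ℝ) ^ (-j)) * η / (2 : ℝ) ^ (n + j) = η / ((2 : ℝ) ^ n / amplitude γ j) := by
  rw [amplitude, zpow_neg, zpow_add₀ two_ne_zero]
  field_simp

lemma curveAverage_eq (m n : ℤ) (F G : ℝ → ℝ≥0∞) (x : ℝ) :
    curveAverage γ j m n F G x = ∫⁻ t in window, avgKernel |(2 : ℝ) ^ (m + j)|⁻¹ F
      (x - (2 : ℝ) ^ (-j) * t) * avgKernel |(2 : ℝ) ^ n / amplitude γ j|⁻¹ G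
      (x + amplitude γ j * annulus.indicator (curve γ ((2 : ℝ) ^ (-j))) t) := by
  have e1 : |(2 : ℝ) ^ (m + j)|⁻¹ = (2 : ℝ) ^ (-(m + j)) := by
    rw [abs_of_pos (by positivity), zpow_neg]
  have e2 : |(2 : ℝ) ^ n / amplitude γ j|⁻¹ = (2 : ℝ) ^ (-n) * |amplitude γ j| := by
    rw [abs_div, inv_div, abs_of_pos (by positivity : (0 : ℝ) < 2 ^ n), zpow_neg, div_eq_inv_mul]
  rw [curveAverage, e1, e2]

/-- The trivial bound, without integration by parts: a single term with amplitude `ρ`. It serves for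
the indices whose maximum is bounded. -/
lemma enorm_integral_symbolCut_le (hj : deriv γ ((2 : ℝ) ^ (-j)) ≠ 0)
    (h : PhaseBounds (curve γ ((2 : ℝ) ^ (-j))) (curve₁ γ ((2 : ℝ) ^ (-j)))
      (curve₂ γ ((2 : ℝ) ^ (-j))) K) (hρ : IsAveragingKernel ρ) (hφ₁ : LowCutoff φ₁)
    (hφ₂ : LowCutoff φ₂) {S₁ S₂ L R : ℝ} (d₁ : HasPowerDecay φ₁ id S₁ L)
    (d₂ : HasPowerDecay φ₂ id S₂ L) (hR : ∀ t, |ρ t| ≤ R) (m n : ℤ) (f g : 𝓢(ℝ, ℂ)) (x : ℝ) :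
    ‖∫ z : ℝ × ℝ, multiplierIntegrand (symbolCut γ ρ φ₁ φ₂ j m n) f g x z.1 z.2‖ₑ ≤
      ENNReal.ofReal (R * (S₁ * S₂)) *
        curveAverage γ j m n (fun y => ‖f y‖ₑ) (fun y => ‖g y‖ₑ) x := by
  have hR0 : 0 ≤ R := (abs_nonneg _).trans (hR 0)
  rw [curveAverage_eq]
  have hF₁ := hφ₁.factor contDiff_id d₁ 0
  have hF₂ := hφ₂.factor contDiff_id d₂ 0
  simp only [pow_zero, mul_one] at hF₁ hF₂
  refine enorm_tsum_waves_le (ι := Unit) f g x h.measurable_indicator _ _ (by positivity)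
    (div_ne_zero (by positivity) (amplitude_ne_zero hj)) (fun _ => hF₁) (fun _ => hF₂)
    (b := fun _ t => (ρ t : ℂ)) (B := fun _ => R) (fun _ => ?_) (fun _ => hR0) (fun _ t => ?_)
    (fun _ t ht => ?_) (hasSum_unique _) fun ξ η => ?_
  · exact (hρ.contDiff.continuous.integrable_of_hasCompactSupport hρ.hasCompactSupport).ofReal
  · rw [Complex.norm_real]
    exact hR t
  · rw [image_eq_zero_of_notMem_tsupport fun hcon => ht (hρ.tsupport_subset_window hcon),
      Complex.ofReal_zero]
  · rw [integral_wave_indicator _ _ _ fun t ht => by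
      rw [image_eq_zero_of_notMem_tsupport fun hcon => ht (hρ.tsupport_subset_annulus hcon),
        Complex.ofReal_zero], ← symbol_eq_integral_wave (amplitude_ne_zero hj)]
    convert hasSum_unique (β := Unit) _ using 1
    rw [symbolCut, cutoff_arg_eq]
    ring

lemma hasSum_geometric_bound {C r : ℝ} (hC : 0 ≤ C) (hr0 : 0 ≤ r) (hr : r ≤ 1 / 2) :
    ∃ S, HasSum (fun k : ℕ => C * r ^ k) S ∧ S ≤ 2 * C := by
  refine ⟨_, (hasSum_geometric_of_lt_one hr0 (by linarith)).mul_left C, ?_⟩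
  have : (1 - r)⁻¹ ≤ 2 := by
    rw [inv_le_comm₀ (by linarith) (by norm_num)]
    linarith
  nlinarith

/-- With `a = 2^m u` and `e = 2^n v`, the `k`-th term of the expansion carries `φ₁(u) u^{-(k+1)}`
and `φ₂(v) v^k`. These are admissible factors, with constants growing like `(4 L)^k` each, and the
unmatched `2^{-m}` is the gain. -/
lemma enorm_integral_symbolCut_le_left (hj : deriv γ ((2 : ℝ) ^ (-j)) ≠ 0)
    (h : PhaseBounds (curve γ ((2 : ℝ) ^ (-j))) (curve₁ γ ((2 : ℝ) ^ (-j)))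
      (curve₂ γ ((2 : ℝ) ^ (-j))) K) (hρ : IsAveragingKernel ρ) (hφ₁ : HighCutoff φ₁)
    (hφ₂ : LowCutoff φ₂) {θ : ℝ → ℝ} (hθ : ContDiff ℝ 2 θ) (hθu : ∀ u, 1 / 2 ≤ |u| → θ u = u⁻¹)
    {S₁ S₂ L R : ℝ} (hL : 1 ≤ L) (d₁ : HasPowerDecay φ₁ θ S₁ L)
    (d₂ : HasPowerDecay φ₂ id S₂ L) (hR : ∀ t, |ρ t| ≤ R) (hR' : ∀ t, |deriv ρ t| ≤ R)
    {m n : ℤ} (hmn : 64 * K * L ^ 2 * (2 : ℝ) ^ n ≤ (2 : ℝ) ^ m) (f g : 𝓢(ℝ, ℂ)) (x : ℝ) :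
    ‖∫ z : ℝ × ℝ, multiplierIntegrand (symbolCut γ ρ φ₁ φ₂ j m n) f g x z.1 z.2‖ₑ ≤
      ENNReal.ofReal (2 * (2 * R * K ^ 2 * (S₁ * (4 * L)) * S₂) * (2 : ℝ) ^ (-m)) *
        curveAverage γ j m n (fun y => ‖f y‖ₑ) (fun y => ‖g y‖ₑ) x := by
  have hR0 : 0 ≤ R := (abs_nonneg _).trans (hR 0)
  have hK := h.one_le
  have hX : (0 : ℝ) < 2 ^ m := by positivity
  have hY : (0 : ℝ) < 2 ^ n := by positivity
  rw [zpow_neg]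
  set X : ℝ := 2 ^ m with hXdef
  set Y : ℝ := 2 ^ n with hYdef
  have hF₁ := fun k : ℕ => hφ₁.toLowCutoff.factor hθ d₁ (k + 1)
  have hF₂ := fun k : ℕ => hφ₂.factor contDiff_id d₂ k
  have hS₁ : 0 ≤ S₁ * (4 * L) := by simpa using (hF₁ 0).nonneg
  have hS₂ : 0 ≤ S₂ := by simpa using (hF₂ 0).nonneg
  have hL2 : 1 ≤ L ^ 2 := one_le_pow₀ hL
  -- The ratio of the series of weights: `2 K` from the amplitude and `4 L` from each of the two
  -- cutoffs.
  have hr : Y * X⁻¹ * (2 * K) * (4 * L) ^ 2 ≤ 1 / 2 := by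
    rw [show Y * X⁻¹ * (2 * K) * (4 * L) ^ 2 = (32 * K * L ^ 2 * Y) / X by ring,
      div_le_iff₀ hX]
    linarith
  obtain ⟨S, hS, hSle⟩ := hasSum_geometric_bound
    (C := X⁻¹ * (2 * R * K ^ 2 * (S₁ * (4 * L)) * S₂)) (by positivity) (by positivity) hr
  have hfin : ENNReal.ofReal S ≤
      ENNReal.ofReal (2 * (2 * R * K ^ 2 * (S₁ * (4 * L)) * S₂) * X⁻¹) :=
    ENNReal.ofReal_le_ofReal (hSle.trans (le_of_eq (by ring)))
  refine le_trans ?_ (mul_le_mul_left hfin _)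
  rw [curveAverage_eq]
  refine enorm_tsum_waves_le (ι := ℕ) f g x h.measurable_indicator _ _ (by positivity)
    (div_ne_zero (by positivity) (amplitude_ne_zero hj)) hF₁ hF₂
    (b := fun k t => (-Complex.I * (X⁻¹ ^ (k + 1) * Y ^ k : ℝ)) *
      (amp ρ (curve₁ γ ((2 : ℝ) ^ (-j))) (curve₂ γ ((2 : ℝ) ^ (-j))) k t : ℂ))
    (B := fun k => X⁻¹ ^ (k + 1) * Y ^ k * (2 * R * K ^ 2 * (2 * K) ^ k))
    (fun k => (h.integrable_amp hρ k).const_mul _) (fun k => by positivity) (fun k t => ?_)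
    (fun k t ht => ?_) ?_ fun ξ η => ?_
  · rw [norm_mul, norm_mul, norm_neg, Complex.norm_I, one_mul, Complex.norm_real,
      Complex.norm_real, Real.norm_of_nonneg (by positivity)]
    gcongr
    simpa using h.abs_amp_le hρ hR hR' k t
  · rw [amp_eq_zero fun hcon => ht (hρ.tsupport_subset_window hcon)]
    simp
  · convert hS using 2 with k
    rw [show (Y * X⁻¹ * (2 * K) * (4 * L) ^ 2) ^ k =
      Y ^ k * X⁻¹ ^ k * (2 * K) ^ k * ((4 * L) ^ k * (4 * L) ^ k) by
        rw [sq, mul_pow, mul_pow, mul_pow, mul_pow (4 * L)]]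
    ring
  · have hint : ∀ k : ℕ, ∫ t, wave (ξ * (2 : ℝ) ^ (-j)) (η * amplitude γ j)
        (annulus.indicator (curve γ ((2 : ℝ) ^ (-j)))) t *
        ((-Complex.I * (X⁻¹ ^ (k + 1) * Y ^ k : ℝ)) *
          (amp ρ (curve₁ γ ((2 : ℝ) ^ (-j))) (curve₂ γ ((2 : ℝ) ^ (-j))) k t : ℂ)) =
        (-Complex.I * (X⁻¹ ^ (k + 1) * Y ^ k : ℝ)) *
          ∫ t, wave (ξ * (2 : ℝ) ^ (-j)) (η * amplitude γ j) (curve γ ((2 : ℝ) ^ (-j))) t *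
            (amp ρ (curve₁ γ ((2 : ℝ) ^ (-j))) (curve₂ γ ((2 : ℝ) ^ (-j))) k t : ℂ) := by
      intro k
      rw [integral_wave_indicator _ _ _ fun t ht => by
        rw [amp_eq_zero fun hcon => ht (hρ.tsupport_subset_annulus hcon)]; simp,
        ← integral_const_mul]
      congr 1
      ext t
      ring
    simp_rw [hint]
    rw [symbolCut, cutoff_arg_eq, symbol_eq_integral_wave (amplitude_ne_zero hj)]
    have ea : ξ * (2 : ℝ) ^ (-j) = X * (ξ / (2 : ℝ) ^ (m + j)) := by
      rw [hXdef, zpow_add₀ two_ne_zero, zpow_neg]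
      field_simp
    have ee : η * amplitude γ j = Y * (η / (Y / amplitude γ j)) := by
      have := amplitude_ne_zero hj
      field_simp
    set u := ξ / (2 : ℝ) ^ (m + j)
    set v := η / (Y / amplitude γ j)
    rw [ea, ee]
    by_cases hu : φ₁ u = 0
    · simp only [hu, zero_mul, mul_zero, Complex.ofReal_zero]
      exact hasSum_zero
    by_cases hv : φ₂ v = 0
    · simp only [hv, zero_mul, mul_zero, Complex.ofReal_zero]
      exact hasSum_zero
    have hu2 : 1 / 2 ≤ |u| := by
      by_contra! hcon
      exact hu (hφ₁.eq_zero_of_lt u hcon)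
    have hv2 : |v| ≤ 2 := by
      by_contra! hcon
      exact hv (hφ₂.eq_zero v hcon)
    have hu0 : u ≠ 0 := by
      rintro h0
      rw [h0, abs_zero] at hu2
      linarith
    -- On the supports `|u| ≥ 1/2` and `|v| ≤ 2`, so the frequencies really are separated as the
    -- expansion requires.
    have hcond : 4 * K * |Y * v| ≤ |X * u| := by
      rw [abs_mul, abs_mul, abs_of_pos hX, abs_of_pos hY]
      calc 4 * K * (Y * |v|) ≤ 4 * K * (Y * 2) := by gcongr
        _ ≤ X * (1 / 2) := by
          have : K * 1 * Y ≤ K * L ^ 2 * Y := by gcongr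
          linarith
        _ ≤ X * |u| := by gcongr
    have := (h.hasSum_wave_left hρ (mul_ne_zero hX.ne' hu0) hcond).mul_left ((φ₁ u : ℂ) * φ₂ v)
    rw [mul_assoc, mul_comm _ ((φ₁ u : ℂ) * φ₂ v)]
    refine Eq.mpr (congrArg (fun F => HasSum F _) (funext fun k => ?_)) this
    rw [hθu u hu2]
    push_cast
    simp only [id, mul_pow, mul_inv]
    ring

/-- The mirror image, with `e` dominant. The exponents of the derivative are `-(k + 1)`, which costs
one more factor `2 K`. -/
lemma enorm_integral_symbolCut_le_right (hj : deriv γ ((2 : ℝ) ^ (-j)) ≠ 0)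
    (h : PhaseBounds (curve γ ((2 : ℝ) ^ (-j))) (curve₁ γ ((2 : ℝ) ^ (-j)))
      (curve₂ γ ((2 : ℝ) ^ (-j))) K) (hρ : IsAveragingKernel ρ) (hφ₁ : LowCutoff φ₁)
    (hφ₂ : HighCutoff φ₂) {θ : ℝ → ℝ} (hθ : ContDiff ℝ 2 θ) (hθu : ∀ u, 1 / 2 ≤ |u| → θ u = u⁻¹)
    {S₁ S₂ L R : ℝ} (hL : 1 ≤ L) (d₁ : HasPowerDecay φ₁ id S₁ L)
    (d₂ : HasPowerDecay φ₂ θ S₂ L) (hR : ∀ t, |ρ t| ≤ R) (hR' : ∀ t, |deriv ρ t| ≤ R)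
    {m n : ℤ} (hmn : 64 * K * L ^ 2 * (2 : ℝ) ^ m ≤ (2 : ℝ) ^ n) (f g : 𝓢(ℝ, ℂ)) (x : ℝ) :
    ‖∫ z : ℝ × ℝ, multiplierIntegrand (symbolCut γ ρ φ₁ φ₂ j m n) f g x z.1 z.2‖ₑ ≤
      ENNReal.ofReal (2 * (2 * R * K ^ 2 * (2 * K) * S₁ * (S₂ * (4 * L))) * (2 : ℝ) ^ (-n)) *
        curveAverage γ j m n (fun y => ‖f y‖ₑ) (fun y => ‖g y‖ₑ) x := by
  have hR0 : 0 ≤ R := (abs_nonneg _).trans (hR 0)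
  have hK := h.one_le
  have hX : (0 : ℝ) < 2 ^ m := by positivity
  have hY : (0 : ℝ) < 2 ^ n := by positivity
  rw [zpow_neg]
  set X : ℝ := 2 ^ m with hXdef
  set Y : ℝ := 2 ^ n with hYdef
  have hF₁ := fun k : ℕ => hφ₁.factor contDiff_id d₁ k
  have hF₂ := fun k : ℕ => hφ₂.toLowCutoff.factor hθ d₂ (k + 1)
  have hS₁ : 0 ≤ S₁ := by simpa using (hF₁ 0).nonneg
  have hS₂ : 0 ≤ S₂ * (4 * L) := by simpa using (hF₂ 0).nonneg
  have hL2 : 1 ≤ L ^ 2 := one_le_pow₀ hL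
  have hr : X * Y⁻¹ * (2 * K) * (4 * L) ^ 2 ≤ 1 / 2 := by
    rw [show X * Y⁻¹ * (2 * K) * (4 * L) ^ 2 = (32 * K * L ^ 2 * X) / Y by ring,
      div_le_iff₀ hY]
    linarith
  obtain ⟨S, hS, hSle⟩ := hasSum_geometric_bound
    (C := Y⁻¹ * (2 * R * K ^ 2 * (2 * K) * S₁ * (S₂ * (4 * L)))) (by positivity) (by positivity) hr
  have hfin : ENNReal.ofReal S ≤
      ENNReal.ofReal (2 * (2 * R * K ^ 2 * (2 * K) * S₁ * (S₂ * (4 * L))) * Y⁻¹) :=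
    ENNReal.ofReal_le_ofReal (hSle.trans (le_of_eq (by ring)))
  refine le_trans ?_ (mul_le_mul_left hfin _)
  rw [curveAverage_eq]
  refine enorm_tsum_waves_le (ι := ℕ) f g x h.measurable_indicator _ _ (by positivity)
    (div_ne_zero (by positivity) (amplitude_ne_zero hj)) hF₁ hF₂
    (b := fun k t => (Complex.I * (X ^ k * Y⁻¹ ^ (k + 1) : ℝ)) *
      (amp ρ (curve₁ γ ((2 : ℝ) ^ (-j))) (curve₂ γ ((2 : ℝ) ^ (-j))) (-(k + 1 : ℕ) : ℤ) t : ℂ))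
    (B := fun k => X ^ k * Y⁻¹ ^ (k + 1) * (2 * R * K ^ 2 * (2 * K) ^ (k + 1)))
    (fun k => (h.integrable_amp hρ _).const_mul _) (fun k => by positivity) (fun k t => ?_)
    (fun k t ht => ?_) ?_ fun ξ η => ?_
  · rw [norm_mul, norm_mul, Complex.norm_I, one_mul, Complex.norm_real,
      Complex.norm_real, Real.norm_of_nonneg (by positivity)]
    gcongr
    have := h.abs_amp_le hρ hR hR' (-(k + 1 : ℕ) : ℤ) t
    rwa [Int.natAbs_neg, Int.natAbs_natCast] at this
  · rw [amp_eq_zero fun hcon => ht (hρ.tsupport_subset_window hcon)]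
    simp
  · convert hS using 2 with k
    rw [show (X * Y⁻¹ * (2 * K) * (4 * L) ^ 2) ^ k =
      X ^ k * Y⁻¹ ^ k * (2 * K) ^ k * ((4 * L) ^ k * (4 * L) ^ k) by
        rw [sq, mul_pow, mul_pow, mul_pow, mul_pow (4 * L)]]
    ring
  · have hint : ∀ k : ℕ, ∫ t, wave (ξ * (2 : ℝ) ^ (-j)) (η * amplitude γ j)
        (annulus.indicator (curve γ ((2 : ℝ) ^ (-j)))) t *
        ((Complex.I * (X ^ k * Y⁻¹ ^ (k + 1) : ℝ)) *
          (amp ρ (curve₁ γ ((2 : ℝ) ^ (-j))) (curve₂ γ ((2 : ℝ) ^ (-j)))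
            (-(k + 1 : ℕ) : ℤ) t : ℂ)) =
        (Complex.I * (X ^ k * Y⁻¹ ^ (k + 1) : ℝ)) *
          ∫ t, wave (ξ * (2 : ℝ) ^ (-j)) (η * amplitude γ j) (curve γ ((2 : ℝ) ^ (-j))) t *
            (amp ρ (curve₁ γ ((2 : ℝ) ^ (-j))) (curve₂ γ ((2 : ℝ) ^ (-j)))
              (-(k + 1 : ℕ) : ℤ) t : ℂ) := by
      intro k
      rw [integral_wave_indicator _ _ _ fun t ht => by
        rw [amp_eq_zero fun hcon => ht (hρ.tsupport_subset_annulus hcon)]; simp,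
        ← integral_const_mul]
      congr 1
      ext t
      ring
    simp_rw [hint]
    rw [symbolCut, cutoff_arg_eq, symbol_eq_integral_wave (amplitude_ne_zero hj)]
    have ea : ξ * (2 : ℝ) ^ (-j) = X * (ξ / (2 : ℝ) ^ (m + j)) := by
      rw [hXdef, zpow_add₀ two_ne_zero, zpow_neg]
      field_simp
    have ee : η * amplitude γ j = Y * (η / (Y / amplitude γ j)) := by
      have := amplitude_ne_zero hj
      field_simp
    set u := ξ / (2 : ℝ) ^ (m + j)
    set v := η / (Y / amplitude γ j)
    rw [ea, ee]
    by_cases hu : φ₁ u = 0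
    · simp only [hu, zero_mul, mul_zero, Complex.ofReal_zero]
      exact hasSum_zero
    by_cases hv : φ₂ v = 0
    · simp only [hv, zero_mul, mul_zero, Complex.ofReal_zero]
      exact hasSum_zero
    have hv2 : 1 / 2 ≤ |v| := by
      by_contra! hcon
      exact hv (hφ₂.eq_zero_of_lt v hcon)
    have hu2 : |u| ≤ 2 := by
      by_contra! hcon
      exact hu (hφ₁.eq_zero u hcon)
    have hv0 : v ≠ 0 := by
      rintro h0
      rw [h0, abs_zero] at hv2
      linarith
    have hcond : 4 * K * |X * u| ≤ |Y * v| := by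
      rw [abs_mul, abs_mul, abs_of_pos hX, abs_of_pos hY]
      calc 4 * K * (X * |u|) ≤ 4 * K * (X * 2) := by gcongr
        _ ≤ Y * (1 / 2) := by
          have : K * 1 * X ≤ K * L ^ 2 * X := by gcongr
          linarith
        _ ≤ Y * |v| := by gcongr
    have := (h.hasSum_wave_right hρ (mul_ne_zero hY.ne' hv0) hcond).mul_left ((φ₁ u : ℂ) * φ₂ v)
    rw [mul_assoc, mul_comm _ ((φ₁ u : ℂ) * φ₂ v)]
    refine Eq.mpr (congrArg (fun F => HasSum F _) (funext fun k => ?_)) this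
    rw [hθu v hv2]
    push_cast
    simp only [id, mul_pow, mul_inv]
    ring

end Domination

/-- The operators with the cutoffs `φ₁` and `φ₂` are dominated by averages along the curve when the
frequencies are separated by `C₀`, or bounded by `C₀`. -/
def Dominates (K : ℝ) (C₀ : ℕ) (ρ φ₁ φ₂ : ℝ → ℝ) (A : ℝ≥0) : Prop :=
  ∀ ⦃γ : ℝ → ℝ⦄ ⦃j : ℤ⦄, deriv γ ((2 : ℝ) ^ (-j)) ≠ 0 → PhaseBounds (curve γ ((2 : ℝ) ^ (-j)))
      (curve₁ γ ((2 : ℝ) ^ (-j))) (curve₂ γ ((2 : ℝ) ^ (-j))) K →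
    ∀ m n : ℤ, (C₀ < m - n → HighCutoff φ₁) → (C₀ < n - m → HighCutoff φ₂) →
      (|m - n| ≤ C₀ → max m n ≤ C₀) → ∀ (f g : 𝓢(ℝ, ℂ)) (x : ℝ),
      ‖∫ z : ℝ × ℝ, multiplierIntegrand (symbolCut γ ρ φ₁ φ₂ j m n) f g x z.1 z.2‖ₑ ≤
        A * ENNReal.ofReal ((2 : ℝ) ^ (-max m n)) *
          curveAverage γ j m n (fun y => ‖f y‖ₑ) (fun y => ‖g y‖ₑ) x

lemma Dominates.mono {K : ℝ} {C₀ : ℕ} {ρ φ₁ φ₂ : ℝ → ℝ} {A A' : ℝ≥0}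
    (h : Dominates K C₀ ρ φ₁ φ₂ A) (hA : A ≤ A') : Dominates K C₀ ρ φ₁ φ₂ A' :=
  fun γ j hj hp m n h₁ h₂ h₃ f g x => (h hj hp m n h₁ h₂ h₃ f g x).trans (by gcongr)

/-- The separation `C₀` of the frequencies depends on `K` only. -/
lemma exists_dominates (K : ℝ) : ∃ C₀ : ℕ, 1 ≤ C₀ ∧ ∀ {ρ φ₁ φ₂ : ℝ → ℝ}, IsAveragingKernel ρ →
    LowCutoff φ₁ → LowCutoff φ₂ → ∃ A : ℝ≥0, Dominates K C₀ ρ φ₁ φ₂ A := by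
  obtain ⟨θ, hθ, hθu⟩ := exists_smooth_inv
  obtain ⟨L, hL1, hL⟩ := exists_deriv_bounds hθ
  obtain ⟨L', hL1', hL'⟩ := exists_deriv_bounds (contDiff_id (𝕜 := ℝ) (E := ℝ) (n := 2))
  -- Here `L` and `L'` come from the fixed functions `θ` and `id`, and no cutoff is involved, so
  -- `C₀` depends on `K` alone.
  obtain ⟨C₀, hC₀⟩ := pow_unbounded_of_one_lt (64 * K * (L + L') ^ 2) one_lt_two
  have h2 : 64 * K * (L + L') ^ 2 ≤ (2 : ℝ) ^ (C₀ + 1 : ℕ) := by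
    rw [pow_succ (2 : ℝ)]
    have : (0 : ℝ) < 2 ^ C₀ := by positivity
    linarith
  have hsep : ∀ {m n : ℤ}, ((C₀ + 1 : ℕ) : ℤ) < m - n →
      64 * K * (L + L') ^ 2 * (2 : ℝ) ^ n ≤ (2 : ℝ) ^ m := by
    intro m n hmn
    calc 64 * K * (L + L') ^ 2 * (2 : ℝ) ^ n ≤ (2 : ℝ) ^ (C₀ + 1 : ℕ) * (2 : ℝ) ^ n := by gcongr
      _ = (2 : ℝ) ^ (((C₀ + 1 : ℕ) : ℤ) + n) := by rw [zpow_add₀ two_ne_zero, zpow_natCast]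
      _ ≤ (2 : ℝ) ^ m := zpow_le_zpow_right₀ one_le_two (by omega)
  refine ⟨C₀ + 1, by omega, fun {ρ φ₁ φ₂} hρ hφ₁ hφ₂ => ?_⟩
  have hLθ : ∀ u, |u| ≤ 2 → |θ u| ≤ L + L' ∧ |deriv θ u| ≤ L + L' ∧
      |deriv (deriv θ) u| ≤ L + L' := fun u hu =>
    ⟨by linarith [(hL u hu).1], by linarith [(hL u hu).2.1], by linarith [(hL u hu).2.2]⟩
  have hLid : ∀ u : ℝ, |u| ≤ 2 → |id u| ≤ L + L' ∧ |deriv id u| ≤ L + L' ∧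
      |deriv (deriv id) u| ≤ L + L' := fun u hu =>
    ⟨by linarith [(hL' u hu).1], by linarith [(hL' u hu).2.1], by linarith [(hL' u hu).2.2]⟩
  obtain ⟨S₁, hS₁, d₁⟩ := exists_hasPowerDecay hφ₁.contDiff hφ₁.eq_zero hθ hLθ
  obtain ⟨S₂, hS₂, d₂⟩ := exists_hasPowerDecay hφ₂.contDiff hφ₂.eq_zero hθ hLθ
  obtain ⟨T₁, hT₁, e₁⟩ := exists_hasPowerDecay hφ₁.contDiff hφ₁.eq_zero contDiff_id hLid
  obtain ⟨T₂, hT₂, e₂⟩ := exists_hasPowerDecay hφ₂.contDiff hφ₂.eq_zero contDiff_id hLid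
  obtain ⟨R, hR0, hR, hR'⟩ := PhaseBounds.exists_deriv_bound hρ
  set a := 2 * (2 * R * K ^ 2 * (S₁ * (4 * (L + L'))) * T₂) with ha
  set b := 2 * (2 * R * K ^ 2 * (2 * K) * T₁ * (S₂ * (4 * (L + L')))) with hb
  set c := R * (T₁ * T₂) * 2 ^ (C₀ + 1) with hc
  have hc0 : 0 ≤ c := by positivity
  refine ⟨(|a| + |b| + c).toNNReal, fun γ j hj h m n h₁ h₂ h₃ f g x => ?_⟩
  have hfin : ∀ {s t : ℝ}, s ≤ (|a| + |b| + c) * t → 0 ≤ t → ENNReal.ofReal s ≤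
      ((|a| + |b| + c).toNNReal : ℝ≥0∞) * ENNReal.ofReal t := by
    intro s t hst ht
    change _ ≤ ENNReal.ofReal _ * _
    rw [← ENNReal.ofReal_mul (by positivity)]
    exact ENNReal.ofReal_le_ofReal hst
  rcases lt_or_ge ((C₀ + 1 : ℕ) : ℤ) (m - n) with hlt | hge
  · refine (enorm_integral_symbolCut_le_left hj h hρ (h₁ hlt) hφ₂ hθ hθu (by linarith) d₁ e₂ hR hR'
      (hsep hlt) f g x).trans (mul_le_mul_left (hfin ?_ (by positivity)) _)
    rw [max_eq_left (by omega), ← ha]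
    gcongr
    linarith [le_abs_self a, abs_nonneg b]
  rcases lt_or_ge ((C₀ + 1 : ℕ) : ℤ) (n - m) with hlt' | hge'
  · refine (enorm_integral_symbolCut_le_right hj h hρ hφ₁ (h₂ hlt') hθ hθu (by linarith) e₁ d₂ hR
      hR' (hsep hlt') f g x).trans (mul_le_mul_left (hfin ?_ (by positivity)) _)
    rw [max_eq_right (by omega), ← hb]
    gcongr
    linarith [le_abs_self b, abs_nonneg a]
  · refine (enorm_integral_symbolCut_le hj h hρ hφ₁ hφ₂ e₁ e₂ hR m n f g x).trans
      (mul_le_mul_left (hfin ?_ (by positivity)) _)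
    -- Neither frequency dominates: the maximum is bounded, so `2^{-max(m,n)}` is bounded below and
    -- the trivial estimate is enough.
    have hmax := h₃ (by rw [abs_le]; omega)
    have h1 : 1 ≤ (2 : ℝ) ^ (C₀ + 1) * (2 : ℝ) ^ (-max m n) := by
      rw [← zpow_natCast, ← zpow_add₀ two_ne_zero]
      exact one_le_zpow₀ one_le_two (by omega)
    calc R * (T₁ * T₂) ≤ R * (T₁ * T₂) * ((2 : ℝ) ^ (C₀ + 1) * (2 : ℝ) ^ (-max m n)) :=
          le_mul_of_one_le_right (by positivity) h1
      _ = c * (2 : ℝ) ^ (-max m n) := by rw [hc]; ring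
      _ ≤ _ := by
        gcongr
        linarith [abs_nonneg a, abs_nonneg b]

end
end BilinearMax

/-! ### Measurability of the symbols and absolute convergence of the double integrals. -/

namespace BilinearMax
noncomputable section

lemma norm_symbol_le {ρ : ℝ → ℝ} (hρ : IsAveragingKernel ρ) (γ : ℝ → ℝ) (j : ℤ) (ξ η : ℝ) :
    ‖symbol γ ρ j ξ η‖ ≤ 1 := by
  rw [symbol]
  refine (norm_integral_le_integral_norm _).trans (le_of_eq ?_)
  rw [← hρ.integral_eq_one]
  congr 1
  ext t
  rw [norm_mul, norm_mul, ← mul_neg, ← Complex.ofReal_neg, mul_comm Complex.I, mul_comm Complex.I,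
    Complex.norm_exp_ofReal_mul_I, Complex.norm_exp_ofReal_mul_I, one_mul, one_mul,
    Complex.norm_real, Real.norm_of_nonneg (hρ.nonneg t)]

lemma measurable_symbol {γ ρ : ℝ → ℝ} {K : ℝ} {j : ℤ} (hj : deriv γ ((2 : ℝ) ^ (-j)) ≠ 0)
    (h : PhaseBounds (curve γ ((2 : ℝ) ^ (-j))) (curve₁ γ ((2 : ℝ) ^ (-j)))
      (curve₂ γ ((2 : ℝ) ^ (-j))) K) (hρ : IsAveragingKernel ρ) :
    Measurable fun z : ℝ × ℝ => symbol γ ρ j z.1 z.2 := by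
  have e : (fun z : ℝ × ℝ => symbol γ ρ j z.1 z.2) = fun z : ℝ × ℝ =>
      ∫ t, wave (z.1 * (2 : ℝ) ^ (-j)) (z.2 * amplitude γ j)
        (annulus.indicator (curve γ ((2 : ℝ) ^ (-j)))) t * (ρ t : ℂ) := by
    ext z
    rw [symbol_eq_integral_wave (amplitude_ne_zero hj), integral_wave_indicator]
    intro t ht
    rw [image_eq_zero_of_notMem_tsupport fun hcon => ht (hρ.tsupport_subset_annulus hcon),
      Complex.ofReal_zero]
  rw [e]
  refine StronglyMeasurable.measurable ?_
  refine StronglyMeasurable.integral_prod_right' (f := fun p : (ℝ × ℝ) × ℝ =>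
    wave (p.1.1 * (2 : ℝ) ^ (-j)) (p.1.2 * amplitude γ j)
      (annulus.indicator (curve γ ((2 : ℝ) ^ (-j)))) p.2 * (ρ p.2 : ℂ)) ?_
  have hρc := hρ.contDiff.continuous
  exact ((measurable_wave_uncurry h.measurable_indicator _ _).mul (by fun_prop)).stronglyMeasurable

lemma integrable_multiplierIntegrand (f g : 𝓢(ℝ, ℂ)) (x : ℝ) {μ : ℝ → ℝ → ℂ}
    (hm : Measurable fun z : ℝ × ℝ => μ z.1 z.2) {b : ℝ} (hb : ∀ ξ η, ‖μ ξ η‖ ≤ b) :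
    Integrable fun z : ℝ × ℝ => multiplierIntegrand μ f g x z.1 z.2 := by
  have hf := measurable_fourierHat f
  have hg := measurable_fourierHat g
  have hi : Integrable (fun z : ℝ × ℝ => ‖fourierHat f z.1 * fourierHat g z.2‖ * b)
      (volume.prod volume) :=
    ((integrable_fourierHat f).mul_prod (integrable_fourierHat g)).norm.mul_const b
  refine hi.mono' ?_ (Eventually.of_forall fun z => ?_)
  · unfold multiplierIntegrand
    exact (((((hf.comp measurable_fst).mul (hg.comp measurable_snd)).mul hm).mul
      (by fun_prop)).mul (by fun_prop)).aestronglyMeasurable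
  · rw [multiplierIntegrand, norm_mul, norm_mul, norm_mul _ (μ _ _), norm_exp_I_mul_mul,
      norm_exp_I_mul_mul, mul_one, mul_one]
    exact mul_le_mul_of_nonneg_left (hb _ _) (norm_nonneg _)

lemma linearizedOp_eq_integral {μ : ℤ → ℝ → ℝ → ℂ} {j : ℝ → ℤ} {f g : ℝ → ℂ} {x : ℝ}
    (h : Integrable fun z : ℝ × ℝ => multiplierIntegrand (μ (j x)) f g x z.1 z.2) :
    linearizedOp μ j f g x = ∫ z : ℝ × ℝ, multiplierIntegrand (μ (j x)) f g x z.1 z.2 :=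
  (integral_prod (fun z : ℝ × ℝ => multiplierIntegrand (μ (j x)) f g x z.1 z.2) h).symm

lemma measurable_symbolCut {γ ρ φ₁ φ₂ : ℝ → ℝ} {j : ℤ}
    (h : Measurable fun z : ℝ × ℝ => symbol γ ρ j z.1 z.2) (h₁ : Continuous φ₁)
    (h₂ : Continuous φ₂) (m n : ℤ) :
    Measurable fun z : ℝ × ℝ => symbolCut γ ρ φ₁ φ₂ j m n z.1 z.2 := by
  unfold symbolCut
  exact (h.mul (by fun_prop)).mul (by fun_prop)

namespace IsFrequencyCutoff

variable {φ : 𝓢(ℝ, ℝ)} (hφ : IsFrequencyCutoff φ)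
include hφ

lemma eq_zero_of_not_mem {u : ℝ} (hu : ¬ (1 / 2 ≤ |u| ∧ |u| ≤ 2)) : φ u = 0 :=
  image_eq_zero_of_notMem_tsupport fun hcon => hu (hφ.support_subset hcon)

lemma highCutoff : HighCutoff φ where
  contDiff := φ.smooth 2
  eq_zero _ hu := hφ.eq_zero_of_not_mem fun h => absurd h.2 (not_le.2 hu)
  eq_zero_of_lt _ hu := hφ.eq_zero_of_not_mem fun h => absurd h.1 (not_le.2 hu)

/-- At `u = 0` all terms vanish, so the sum is one or zero. -/
lemma exists_hasSum (u : ℝ) : ∃ s ≤ 1, HasSum (fun n : ℤ => φ (u / (2 : ℝ) ^ n)) s := by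
  rcases eq_or_ne u 0 with rfl | hu
  · refine ⟨0, zero_le_one, ?_⟩
    have : φ 0 = 0 := hφ.eq_zero_of_not_mem (by norm_num)
    simp only [zero_div, this]
    exact hasSum_zero
  · exact ⟨1, le_rfl, hφ.hasSum u hu⟩

lemma le_one (u : ℝ) : φ u ≤ 1 := by
  obtain ⟨s, hs, h⟩ := hφ.exists_hasSum u
  have := h.summable.le_tsum 0 fun _ _ => hφ.nonneg _
  rw [h.tsum_eq, zpow_zero, div_one] at this
  exact this.trans hs

lemma exists_hasSum_prod (u v : ℝ) : ∃ s ≤ 1,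
    HasSum (fun a : ℤ × ℤ => φ (u / (2 : ℝ) ^ a.1) * φ (v / (2 : ℝ) ^ a.2)) s := by
  obtain ⟨s, hs, h⟩ := hφ.exists_hasSum u
  obtain ⟨t, ht, h'⟩ := hφ.exists_hasSum v
  have ht0 : 0 ≤ t := h'.nonneg fun _ => hφ.nonneg _
  exact ⟨s * t, mul_le_one₀ hs ht0 ht, h.mul h'
    (h.summable.mul_of_nonneg h'.summable (fun _ => hφ.nonneg _) fun _ => hφ.nonneg _)⟩

end IsFrequencyCutoff

lemma div_two_zpow_add (u : ℝ) (m j : ℤ) : u / (2 : ℝ) ^ (m + j) = u / 2 ^ j / 2 ^ m := by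
  rw [add_comm, zpow_add₀ two_ne_zero, div_div]

lemma symbolPiece_eq (γ ρ φ : ℝ → ℝ) (j m n : ℤ) (ξ η : ℝ) : symbolPiece γ ρ φ j m n ξ η =
    symbol γ ρ j ξ η * ((φ (ξ / 2 ^ j / 2 ^ m) *
      φ (deriv γ ((2 : ℝ) ^ (-j)) * η / 2 ^ j / 2 ^ n) : ℝ) : ℂ) := by
  rw [symbolPiece, div_two_zpow_add, div_two_zpow_add, mul_assoc, Complex.ofReal_mul]

section Integrability

variable {γ ρ : ℝ → ℝ} {φ : 𝓢(ℝ, ℝ)} {j : ℤ}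

lemma norm_symbolPiece_le (hρ : IsAveragingKernel ρ) (hφ : IsFrequencyCutoff φ) (m n : ℤ)
    (ξ η : ℝ) : ‖symbolPiece γ ρ φ j m n ξ η‖ ≤ φ (ξ / 2 ^ j / 2 ^ m) *
      φ (deriv γ ((2 : ℝ) ^ (-j)) * η / 2 ^ j / 2 ^ n) := by
  rw [symbolPiece_eq, norm_mul, Complex.norm_real,
    Real.norm_of_nonneg (mul_nonneg (hφ.nonneg _) (hφ.nonneg _))]
  exact mul_le_of_le_one_left (mul_nonneg (hφ.nonneg _) (hφ.nonneg _)) (norm_symbol_le hρ _ _ _ _)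

lemma integrable_symbolPiece (h : Measurable fun z : ℝ × ℝ => symbol γ ρ j z.1 z.2)
    (hρ : IsAveragingKernel ρ) (hφ : IsFrequencyCutoff φ) (m n : ℤ) (f g : 𝓢(ℝ, ℂ)) (x : ℝ) :
    Integrable fun z : ℝ × ℝ =>
      multiplierIntegrand (symbolPiece γ ρ φ j m n) f g x z.1 z.2 :=
  integrable_multiplierIntegrand f g x (measurable_symbolCut h φ.continuous φ.continuous m n)
    (b := 1) fun _ _ => (norm_symbolPiece_le hρ hφ m n _ _).trans
      (mul_le_one₀ (hφ.le_one _) (hφ.nonneg _) (hφ.le_one _))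

lemma summable_norm_symbolPiece (hρ : IsAveragingKernel ρ) (hφ : IsFrequencyCutoff φ) (ξ η : ℝ) :
    Summable fun a : ℤ × ℤ => ‖symbolPiece γ ρ φ j a.1 a.2 ξ η‖ := by
  obtain ⟨s, -, h⟩ := hφ.exists_hasSum_prod (ξ / 2 ^ j) (deriv γ ((2 : ℝ) ^ (-j)) * η / 2 ^ j)
  exact h.summable.of_nonneg_of_le (fun _ => norm_nonneg _)
    fun a => norm_symbolPiece_le hρ hφ a.1 a.2 ξ η

/-- The symbol `m_j` is bounded by the mass of `ρ`, and the products of cutoffs are part of a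
partition of unity. -/
lemma norm_farSymbol_le (hρ : IsAveragingKernel ρ) (hφ : IsFrequencyCutoff φ) (C : ℕ) (ξ η : ℝ) :
    ‖farSymbol γ ρ φ C j ξ η‖ ≤ 1 := by
  obtain ⟨s, hs, h⟩ := hφ.exists_hasSum_prod (ξ / 2 ^ j) (deriv γ ((2 : ℝ) ^ (-j)) * η / 2 ^ j)
  have hsum := summable_norm_symbolPiece (γ := γ) (j := j) hρ hφ ξ η
  calc ‖farSymbol γ ρ φ C j ξ η‖
      ≤ ∑' a : farIndices C, ‖symbolPiece γ ρ φ j a.1.1 a.1.2 ξ η‖ :=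
        norm_tsum_le_tsum_norm (hsum.subtype _)
    _ ≤ ∑' a : ℤ × ℤ, ‖symbolPiece γ ρ φ j a.1 a.2 ξ η‖ :=
        hsum.tsum_subtype_le _ _ fun _ => norm_nonneg _
    _ ≤ ∑' a : ℤ × ℤ, φ (ξ / 2 ^ j / 2 ^ a.1) *
          φ (deriv γ ((2 : ℝ) ^ (-j)) * η / 2 ^ j / 2 ^ a.2) :=
        hsum.tsum_le_tsum (fun a => norm_symbolPiece_le hρ hφ a.1 a.2 ξ η) h.summable
    _ ≤ 1 := h.tsum_eq.le.trans hs

lemma integrable_farSymbol (h : Measurable fun z : ℝ × ℝ => symbol γ ρ j z.1 z.2)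
    (hρ : IsAveragingKernel ρ) (hφ : IsFrequencyCutoff φ) (C : ℕ) (f g : 𝓢(ℝ, ℂ)) (x : ℝ) :
    Integrable fun z : ℝ × ℝ => multiplierIntegrand (farSymbol γ ρ φ C j) f g x z.1 z.2 := by
  refine integrable_multiplierIntegrand f g x ?_ (norm_farSymbol_le hρ hφ C)
  unfold farSymbol
  exact Measurable.tsum fun a => measurable_symbolCut h φ.continuous φ.continuous _ _

end Integrability

end
end BilinearMax

/-! ### Pointwise bound by grand maximal functions, and norm bounds for the averages. -/

namespace BilinearMax
noncomputable section

lemma UniformCurve.abs_indicator_le {γ Q₀ Qinf : ℝ → ℝ} {j₀ : ℕ} {K : ℝ} {B : ℕ}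
    (U : UniformCurve γ Q₀ Qinf j₀ K B) {j : ℤ} (hj : (j₀ : ℤ) < |j|) (t : ℝ) :
    |annulus.indicator (curve γ ((2 : ℝ) ^ (-j))) t| ≤
      2 * cNorm 2 (profileAt Q₀ Qinf j) := by
  have h1 : (1 : ℝ) ∈ annulus := by constructor <;> norm_num
  by_cases ht : t ∈ annulus
  · rw [indicator_of_mem ht]
    exact U.abs_le j hj t ht
  · rw [indicator_of_notMem ht, abs_zero]
    exact (abs_nonneg _).trans (U.abs_le j hj 1 h1)

lemma abs_neg_two_zpow_mul_le {j m : ℤ} {t : ℝ} (ht : |t| ≤ 1) :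
    |-((2 : ℝ) ^ (-j) * t)| ≤ (2 : ℝ) ^ m * (2 : ℝ) ^ (-(m + j)) := by
  rw [← zpow_add₀ two_ne_zero, abs_neg, abs_mul, abs_of_pos (by positivity),
    show m + -(m + j) = -j by ring]
  exact mul_le_of_le_one_right (by positivity) ht

lemma abs_amplitude_mul_le {γ : ℝ → ℝ} {j n : ℤ} {u D : ℝ} (hu : |u| ≤ 2 * D) :
    |amplitude γ j * u| ≤ (2 : ℝ) ^ (n + 1) * D * ((2 : ℝ) ^ (-n) * |amplitude γ j|) := by
  rw [abs_mul, zpow_add₀ two_ne_zero, zpow_neg, zpow_one]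
  have h2 : (2 : ℝ) ^ n ≠ 0 := by positivity
  calc |amplitude γ j| * |u| ≤ |amplitude γ j| * (2 * D) := by gcongr
    _ = _ := by field_simp

/-- The pointwise bound by the grand maximal functions. -/
lemma UniformCurve.curveAverage_le {γ Q₀ Qinf : ℝ → ℝ} {j₀ : ℕ} {K : ℝ} {B : ℕ}
    (U : UniformCurve γ Q₀ Qinf j₀ K B) {j : ℤ} (hj : (j₀ : ℤ) < |j|) (m n : ℤ) {f g : ℝ → ℂ}
    (hf : Measurable f) (hg : Measurable g) (x : ℝ) :
    curveAverage γ j m n (fun y => ‖f y‖ₑ) (fun y => ‖g y‖ₑ) x ≤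
      512 * grandMaximal ((2 : ℝ) ^ m) f x *
        grandMaximal ((2 : ℝ) ^ (n + 1) * cNorm 2 (profileAt Q₀ Qinf j)) g x := by
  have hD : 0 ≤ 2 * cNorm 2 (profileAt Q₀ Qinf j) :=
    (abs_nonneg _).trans (U.abs_indicator_le hj 0)
  have hσ := abs_pos.2 (amplitude_ne_zero (U.ne_zero j hj))
  rw [curveAverage]
  set X := grandMaximal ((2 : ℝ) ^ m) f x
  set Y := grandMaximal ((2 : ℝ) ^ (n + 1) * cNorm 2 (profileAt Q₀ Qinf j)) g x
  -- The constant `512` is `16 · 16 · 2`: two kernel decompositions and the length of the window.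
  calc _ ≤ ∫⁻ _ in window, 16 * X * (16 * Y) := by
        refine setLIntegral_mono measurable_const fun t ht => mul_le_mul' ?_ ?_
        · rw [sub_eq_add_neg]
          exact avgKernel_le_grandMaximal (by positivity) (by positivity)
            (abs_neg_two_zpow_mul_le ht.2) hf x
        · exact avgKernel_le_grandMaximal (by positivity)
            (mul_nonneg (by positivity) (by linarith))
            (abs_amplitude_mul_le (U.abs_indicator_le hj t)) hg x
    _ = 16 * X * (16 * Y) * volume window := setLIntegral_const _ _
    _ ≤ 16 * X * (16 * Y) * 2 := by
        gcongr
        exact volume_window_le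
    _ = 512 * X * Y := by ring

/-- The maximal averages at the points `x - 2^{-j} t`, over the scales `|j| > j₀`. -/
def lineMaximal (j₀ : ℕ) (m : ℤ) (F : ℝ → ℝ≥0∞) (t x : ℝ) : ℝ≥0∞ :=
  kernelMaximal (ι := {j : ℤ // (j₀ : ℤ) < |j|}) (fun j => (2 : ℝ) ^ (-(m + j.1)))
      (fun j => -((2 : ℝ) ^ (-j.1) * t)) F x

/-- The maximal averages at the points `x + γ(2^{-j} t)`, over the scales `|j| > j₀`. -/
def arcMaximal (γ : ℝ → ℝ) (j₀ : ℕ) (n : ℤ) (G : ℝ → ℝ≥0∞) (t x : ℝ) : ℝ≥0∞ :=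
  kernelMaximal (ι := {j : ℤ // (j₀ : ℤ) < |j|}) (fun j => (2 : ℝ) ^ (-n) * |amplitude γ j.1|)
      (fun j => amplitude γ j.1 * annulus.indicator (curve γ ((2 : ℝ) ^ (-j.1))) t) G x

/-- The averages along the curve, with a supremum over the scales in each of the factors. -/
def curveMaximal (γ : ℝ → ℝ) (j₀ : ℕ) (m n : ℤ) (F G : ℝ → ℝ≥0∞) (x : ℝ) : ℝ≥0∞ :=
  ∫⁻ t in window, lineMaximal j₀ m F t x * arcMaximal γ j₀ n G t x

lemma curveAverage_le_curveMaximal (γ : ℝ → ℝ) {j₀ : ℕ} {j : ℤ} (hj : (j₀ : ℤ) < |j|) (m n : ℤ)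
    (F G : ℝ → ℝ≥0∞) (x : ℝ) :
    curveAverage γ j m n F G x ≤ curveMaximal γ j₀ m n F G x := by
  refine lintegral_mono fun t => mul_le_mul' ?_ ?_
  · rw [sub_eq_add_neg]
    exact le_iSup (fun i : {j : ℤ // (j₀ : ℤ) < |j|} => avgKernel ((2 : ℝ) ^ (-(m + i.1))) F
      (x + -((2 : ℝ) ^ (-i.1) * t))) ⟨j, hj⟩
  · exact le_iSup (fun i : {j : ℤ // (j₀ : ℤ) < |j|} =>
      avgKernel ((2 : ℝ) ^ (-n) * |amplitude γ i.1|) G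
        (x + amplitude γ i.1 * annulus.indicator (curve γ ((2 : ℝ) ^ (-i.1))) t)) ⟨j, hj⟩

lemma measurable_kernelMaximal_uncurry {ι : Type*} [Countable ι] (ℓ : ι → ℝ) {τ : ι → ℝ → ℝ}
    (hτ : ∀ i, Measurable (τ i)) {F : ℝ → ℝ≥0∞} (hF : Measurable F) :
    Measurable (Function.uncurry fun t x => kernelMaximal ℓ (fun i => τ i t) F x) := by
  refine Measurable.iSup fun i => (measurable_avgKernel (ℓ i) hF).comp ?_
  have := hτ i
  fun_prop

lemma encard_subtype_le {α : Type*} {P : α → Prop} {S : Set α} {B : ℕ} (h : S.encard ≤ B) :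
    {i : {a // P a} | i.1 ∈ S}.encard ≤ B := by
  rw [← Subtype.val_injective.encard_image]
  refine (encard_le_encard ?_).trans h
  rintro _ ⟨i, hi, rfl⟩
  exact hi

/-- Two powers of `2` within a factor `2` have exponents at most one apart. -/
lemma encard_zpow_scales_le (m : ℤ) (α : ℝ) :
    {j : ℤ | α ≤ (2 : ℝ) ^ (-(m + j)) ∧ (2 : ℝ) ^ (-(m + j)) ≤ 2 * α}.encard ≤ (3 : ℕ) := by
  rcases eq_empty_or_nonempty {j : ℤ | α ≤ (2 : ℝ) ^ (-(m + j)) ∧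
    (2 : ℝ) ^ (-(m + j)) ≤ 2 * α} with he | ⟨i, hi⟩
  · rw [he]
    simp
  have key : ∀ a b : ℤ, α ≤ (2 : ℝ) ^ (-(m + a)) → (2 : ℝ) ^ (-(m + b)) ≤ 2 * α → a - 1 ≤ b := by
    intro a b ha hb
    have : (2 : ℝ) ^ (-(m + b)) ≤ (2 : ℝ) ^ (1 + -(m + a)) := by
      rw [zpow_add₀ two_ne_zero, zpow_one]
      linarith
    have := (zpow_le_zpow_iff_right₀ one_lt_two).1 this
    omega
  have hsub : {j : ℤ | α ≤ (2 : ℝ) ^ (-(m + j)) ∧ (2 : ℝ) ^ (-(m + j)) ≤ 2 * α} ⊆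
      (Finset.Icc (i - 1) (i + 1) : Finset ℤ) := by
    intro j hj
    rw [Finset.coe_Icc]
    have h1 := key i j hi.1 hj.2
    have h2 := key j i hj.1 hi.2
    exact ⟨h1, by omega⟩
  refine (encard_le_encard hsub).trans ?_
  rw [encard_coe_eq_coe_finsetCard, Int.card_Icc]
  norm_cast
  omega

lemma SchwartzMap.exists_bound (f : 𝓢(ℝ, ℂ)) : ∃ b : ℝ, ∀ x, ‖f x‖ ≤ b :=
  ⟨_, fun x => f.norm_le_seminorm ℝ x⟩

lemma eLpNorm_const_mul_le {α : Type*} [MeasurableSpace α] {μ : Measure α} [SFinite μ]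
    {H : α → ℝ≥0∞} (hH : Measurable H) {r : ℝ≥0∞} (hr : 1 ≤ r) (c : ℝ≥0) :
    eLpNorm (fun x => c * H x) r μ ≤ c * eLpNorm H r μ := by
  simpa using eLpNorm_tsum_le (ι := Unit) (fun _ => hH) hr (fun _ => c) fun _ => le_rfl

section Norm

variable {γ Q₀ Qinf : ℝ → ℝ} {j₀ : ℕ} {K : ℝ} {B : ℕ}

lemma UniformCurve.measurable_indicator (U : UniformCurve γ Q₀ Qinf j₀ K B)
    (j : {j : ℤ // (j₀ : ℤ) < |j|}) :
    Measurable fun t => amplitude γ j.1 * annulus.indicator (curve γ ((2 : ℝ) ^ (-j.1))) t :=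
  (U.phase j.1 j.2).measurable_indicator.const_mul _

lemma measurable_lineMaximal (j₀ : ℕ) (m : ℤ) {F : ℝ → ℝ≥0∞} (hF : Measurable F) :
    Measurable (Function.uncurry (lineMaximal j₀ m F)) :=
  measurable_kernelMaximal_uncurry (ι := {j : ℤ // (j₀ : ℤ) < |j|}) _
    (τ := fun j t => -((2 : ℝ) ^ (-j.1) * t)) (fun j => by fun_prop) hF

lemma UniformCurve.measurable_arcMaximal (U : UniformCurve γ Q₀ Qinf j₀ K B) (n : ℤ)
    {G : ℝ → ℝ≥0∞} (hG : Measurable G) : Measurable (Function.uncurry (arcMaximal γ j₀ n G)) :=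
  measurable_kernelMaximal_uncurry (ι := {j : ℤ // (j₀ : ℤ) < |j|}) _
    (τ := fun j t => amplitude γ j.1 * annulus.indicator (curve γ ((2 : ℝ) ^ (-j.1))) t)
    U.measurable_indicator hG

lemma UniformCurve.measurable_curveMaximal (U : UniformCurve γ Q₀ Qinf j₀ K B) (m n : ℤ)
    {F G : ℝ → ℝ≥0∞} (hF : Measurable F) (hG : Measurable G) :
    Measurable (curveMaximal γ j₀ m n F G) :=
  Measurable.lintegral_prod_left' (f := Function.uncurry fun t x =>
    lineMaximal j₀ m F t x * arcMaximal γ j₀ n G t x)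
    ((measurable_lineMaximal j₀ m hF).mul (U.measurable_arcMaximal n hG))

/-- For fixed `t` the two maximal functions are separated by Hölder, and each has shifts of a
bounded number of dyadic steps relative to its radii: `m_+` steps for `f`, `n_+ + d` for `g`.
Minkowski's inequality then integrates over `t` in the window. -/
lemma UniformCurve.eLpNorm_curveMaximal_le (U : UniformCurve γ Q₀ Qinf j₀ K B) {p q r : ℝ≥0∞}
    (hp : 1 < p) (hq : 1 < q) (hr : 1 ≤ r) (hpqr : p⁻¹ + q⁻¹ = r⁻¹) :
    ∃ A : ℝ≥0, ∀ (m n : ℤ) (f g : 𝓢(ℝ, ℂ)),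
      eLpNorm (curveMaximal γ j₀ m n (fun y => ‖f y‖ₑ) fun y => ‖g y‖ₑ) r volume ≤
        A * ((m.toNat + 10 : ℕ) * (n.toNat + 10 : ℕ)) *
          (eLpNorm f p volume * eLpNorm g q volume) := by
  obtain ⟨A₁, hA₁⟩ := eLpNorm_kernelMaximal_le hp 3
  obtain ⟨A₂, hA₂⟩ := eLpNorm_kernelMaximal_le hq B
  -- `2^d` absorbs the size of both profiles in the shift of `g`.
  obtain ⟨d, hd⟩ := pow_unbounded_of_one_lt (max (2 * cNorm 2 Q₀) (2 * cNorm 2 Qinf)) one_lt_two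
  have hd' : ∀ j, 2 * cNorm 2 (profileAt Q₀ Qinf j) ≤ (2 : ℝ) ^ d := by
    intro j
    rw [profileAt]
    split_ifs
    · exact (le_max_left _ _).trans hd.le
    · exact (le_max_right _ _).trans hd.le
  refine ⟨2 * A₁ * (A₂ * (d + 1)), fun m n f g => ?_⟩
  obtain ⟨b, hb⟩ := SchwartzMap.exists_bound f
  obtain ⟨c, hc⟩ := SchwartzMap.exists_bound g
  have hf : Measurable f := f.continuous.measurable
  have hg : Measurable g := g.continuous.measurable
  have hpow : ∀ k : ℤ, (2 : ℝ) ^ k ≤ 2 ^ k.toNat := fun k => by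
    rw [← zpow_natCast]
    exact zpow_le_zpow_right₀ one_le_two (Int.self_le_toNat k)
  have key : ∀ᵐ t ∂(volume.restrict window), eLpNorm (fun x =>
      lineMaximal j₀ m (fun y => ‖f y‖ₑ) t x * arcMaximal γ j₀ n (fun y => ‖g y‖ₑ) t x) r volume ≤
      A₁ * (m.toNat + 2 : ℕ) * eLpNorm f p volume *
        (A₂ * (n.toNat + d + 2 : ℕ) * eLpNorm g q volume) := by
    refine (ae_restrict_mem measurableSet_window).mono fun t ht => ?_
    refine (eLpNorm_mul_le_ennreal hp hq hr hpqr ?_ ?_).trans (mul_le_mul' ?_ ?_)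
    · exact (measurable_lineMaximal j₀ m hf.enorm).of_uncurry_left
    · exact (U.measurable_arcMaximal n hg.enorm).of_uncurry_left
    · refine hA₁ _ inferInstance _ _ _ (fun j => by positivity) (fun α _ =>
        encard_subtype_le (S := {j : ℤ | α ≤ (2 : ℝ) ^ (-(m + j)) ∧ (2 : ℝ) ^ (-(m + j)) ≤ 2 * α})
          (encard_zpow_scales_le m α)) (fun j => ?_) f b hf hb
      refine (abs_neg_two_zpow_mul_le (m := m) ht.2).trans ?_
      gcongr
      exact hpow m
    · refine hA₂ _ inferInstance _ _ _ (fun j => ?_) (fun α hα => ?_) (fun j => ?_) g c hg hc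
      · have := abs_pos.2 (amplitude_ne_zero (U.ne_zero j.1 j.2))
        positivity
      -- The common factor `2^{-n}` in the radii is removed by rescaling `α`, which reduces the
      -- count to the variation hypothesis.
      · refine le_trans (encard_le_encard ?_) (encard_subtype_le (U.count (2 ^ n * α)
          (by positivity)))
        rintro j ⟨h1, h2⟩
        have e : (2 : ℝ) ^ n * ((2 : ℝ) ^ (-n) * |amplitude γ j.1|) = |amplitude γ j.1| := by
          rw [← mul_assoc, ← zpow_add₀ two_ne_zero, add_neg_cancel, zpow_zero, one_mul]
        constructor
        · rw [← e]
          gcongr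
        · rw [← e, mul_left_comm 2]
          exact mul_le_mul_of_nonneg_left h2 (by positivity)
      · refine (abs_amplitude_mul_le (n := n) (U.abs_indicator_le j.2 t)).trans ?_
        gcongr
        rw [zpow_add₀ two_ne_zero, zpow_one, mul_assoc, pow_add]
        exact mul_le_mul (hpow n) (hd' _) ((abs_nonneg _).trans (U.abs_indicator_le j.2 t))
          (by positivity)
  have hmeas := (measurable_lineMaximal j₀ m hf.enorm).mul (U.measurable_arcMaximal n hg.enorm)
  refine (eLpNorm_lintegral_le hmeas hr key).trans ?_
  rw [Measure.restrict_apply_univ]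
  have e1 : ((m.toNat + 2 : ℕ) : ℝ≥0∞) ≤ (m.toNat + 10 : ℕ) := by
    norm_cast
    omega
  have e2 : ((n.toNat + d + 2 : ℕ) : ℝ≥0∞) ≤ (d + 1 : ℕ) * (n.toNat + 10 : ℕ) := by
    norm_cast
    nlinarith
  calc _ ≤ (2 : ℝ≥0∞) * (A₁ * (m.toNat + 10 : ℕ) * eLpNorm f p volume *
        (A₂ * ((d + 1 : ℕ) * (n.toNat + 10 : ℕ)) * eLpNorm g q volume)) := by
        gcongr
        exact volume_window_le
    _ = _ := by
        push_cast
        ring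

end Norm

end
end BilinearMax

/-! ### Resummation of the negative indices into a low-pass band. -/

namespace BilinearMax
noncomputable section

/-- The sum of the negative dyadic pieces of a frequency cutoff is a smooth low-pass cutoff. -/
lemma IsFrequencyCutoff.exists_lowPass {φ : 𝓢(ℝ, ℝ)} (hφ : IsFrequencyCutoff φ) :
    ∃ ψ : ℝ → ℝ, LowCutoff ψ ∧
      ∀ u ≠ 0, HasSum (fun m : ℤ => if m < 0 then φ (u / (2 : ℝ) ^ m) else 0) (ψ u) := by
  let χ : ContDiffBump (0 : ℝ) := ⟨1, 2, by norm_num, by norm_num⟩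
  -- For `|u| < 2` the pieces with `m ≥ 2` vanish, so the negative pieces add up to `1 - φ(u) - φ(u
  -- / 2)`; for `|u| > 1` they all vanish, and `χ` removes the rest. At `u = 0` the value is one
  -- while every piece is zero, hence the restriction `u ≠ 0`.
  refine ⟨fun u => χ u * (1 - (φ u + φ (u / 2))), ⟨?_, fun u hu => ?_⟩, fun u hu => ?_⟩
  · have h2 : ContDiff ℝ 2 φ := φ.smooth 2
    exact χ.contDiff.mul (contDiff_const.sub (h2.add (h2.comp (contDiff_id.div_const 2))))
  · rw [χ.zero_of_le_dist (by simpa [Real.dist_eq] using hu.le), zero_mul]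
  have hlow : |u| < 2 → HasSum (fun m : ℤ => if m < 0 then φ (u / (2 : ℝ) ^ m) else 0)
      (1 - (φ u + φ (u / 2))) := by
    intro h2
    have hs : HasSum (fun m : ℤ => if m < 0 then 0 else φ (u / (2 : ℝ) ^ m))
        (∑ m ∈ ({0, 1} : Finset ℤ), if m < 0 then 0 else φ (u / (2 : ℝ) ^ m)) := by
      refine hasSum_sum_of_ne_finset_zero fun m hm => ?_
      split_ifs with h0
      · rfl
      · have hm2 : 2 ≤ m := by
          simp only [Finset.mem_insert, Finset.mem_singleton] at hm
          omega
        refine hφ.highCutoff.eq_zero_of_lt _ ?_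
        rw [abs_div, abs_of_pos (by positivity : (0 : ℝ) < 2 ^ m), div_lt_iff₀ (by positivity)]
        have : (2 : ℝ) ^ (2 : ℤ) ≤ 2 ^ m := zpow_le_zpow_right₀ one_le_two hm2
        norm_num at this
        linarith
    rw [Finset.sum_pair (by norm_num)] at hs
    norm_num at hs
    have := (hφ.hasSum u hu).sub hs
    refine Eq.mpr (congrArg (fun F => HasSum F _) (funext fun m => ?_)) this
    split_ifs <;> simp
  rcases le_or_gt |u| 1 with h1 | h1
  · simp only
    rw [χ.one_of_mem_closedBall (by simpa [Real.dist_eq] using h1), one_mul]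
    exact hlow (by linarith)
  · have hz : (fun m : ℤ => if m < 0 then φ (u / (2 : ℝ) ^ m) else 0) = fun _ => 0 := by
      funext m
      split_ifs with h0
      · refine hφ.highCutoff.eq_zero _ ?_
        rw [abs_div, abs_of_pos (by positivity : (0 : ℝ) < 2 ^ m), lt_div_iff₀ (by positivity)]
        have : (2 : ℝ) ^ m ≤ 2 ^ (-1 : ℤ) := zpow_le_zpow_right₀ one_le_two (by omega)
        norm_num at this
        linarith
      · rfl
    rw [hz] at hlow ⊢
    rcases lt_or_ge |u| 2 with h2 | h2
    · simp only
      rw [(hlow h2).unique hasSum_zero, mul_zero]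
      exact hasSum_zero
    · simp only
      rw [χ.zero_of_le_dist (by simpa [Real.dist_eq] using h2), zero_mul]
      exact hasSum_zero

/-- The bands of frequencies: the low-pass cutoff followed by the dyadic ones. -/
def band (φ ψ : ℝ → ℝ) (k : ℕ) : ℝ → ℝ := if k = 0 then ψ else φ

/-- The dyadic level of a band. -/
def level (k : ℕ) : ℤ := (k - 1 : ℕ)

/-- The bands which make up the far high frequencies. -/
def farBands (C : ℕ) : Set (ℕ × ℕ) :=
  {c | ¬ (c.1 = 0 ∧ c.2 = 0) ∧ ¬ (1 ≤ c.1 ∧ 1 ≤ c.2 ∧ |(c.1 : ℤ) - c.2| ≤ C)}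

/-- The map `m ↦ (m + 1).toNat` sends all negative indices to the band `0` and shifts the others by
one. The far indices are a union of its fibres, so they can be resummed fibre by fibre. -/
lemma mem_farBands_iff (C : ℕ) (m n : ℤ) :
    ((m + 1).toNat, (n + 1).toNat) ∈ farBands C ↔ (m, n) ∈ farIndices C := by
  simp only [farBands, farIndices, lowIndices, diagIndices, mem_compl_iff, mem_union,
    Set.mem_ofPred_eq, abs_le]
  omega

lemma HasSum.mul_of_nonneg {ι κ : Type*} {f : ι → ℝ} {g : κ → ℝ} {s t : ℝ} (hf : HasSum f s)
    (hg : HasSum g t) (hf0 : ∀ i, 0 ≤ f i) (hg0 : ∀ i, 0 ≤ g i) :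
    HasSum (fun a : ι × κ => f a.1 * g a.2) (s * t) :=
  hf.mul hg (hf.summable.mul_of_nonneg hg.summable hf0 hg0)

section Bands

variable {φ : 𝓢(ℝ, ℝ)} {ψ : ℝ → ℝ}

lemma hasSum_band (hψ : ∀ u ≠ 0, HasSum (fun m : ℤ => if m < 0 then φ (u / (2 : ℝ) ^ m) else 0) (ψ u))
    {u : ℝ} (hu : u ≠ 0) (k : ℕ) :
    HasSum (fun m : ℤ => if (m + 1).toNat = k then φ (u / (2 : ℝ) ^ m) else 0)
      (band φ ψ k (u / 2 ^ level k)) := by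
  rcases Nat.eq_zero_or_pos k with rfl | hk
  · rw [band, if_pos rfl, level]
    simp only [Nat.zero_sub, Nat.cast_zero, zpow_zero, div_one]
    refine Eq.mpr (congrArg (fun F => HasSum F _) (funext fun m => ?_)) (hψ u hu)
    have : (m + 1).toNat = 0 ↔ m < 0 := by omega
    simp only [this]
  · rw [band, if_neg hk.ne', level]
    have h1 : ∀ m : ℤ, (m + 1).toNat = k ↔ m = (k - 1 : ℕ) := fun m => by omega
    simp only [h1]
    have := hasSum_ite_eq (((k - 1 : ℕ) : ℤ)) (φ (u / (2 : ℝ) ^ (((k - 1 : ℕ) : ℤ))))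
    refine Eq.mpr (congrArg (fun F => HasSum F _) (funext fun m => ?_)) this
    split_ifs with h
    · rw [h]
    · rfl

lemma band_nonneg (hφ : IsFrequencyCutoff φ)
    (hψ : ∀ u ≠ 0, HasSum (fun m : ℤ => if m < 0 then φ (u / (2 : ℝ) ^ m) else 0) (ψ u))
    {u : ℝ} (hu : u ≠ 0) (k : ℕ) : 0 ≤ band φ ψ k (u / 2 ^ level k) :=
  (hasSum_band hψ hu k).nonneg fun m => by
    split_ifs
    exacts [hφ.nonneg _, le_rfl]

lemma hasSum_band_one (hφ : IsFrequencyCutoff φ)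
    (hψ : ∀ u ≠ 0, HasSum (fun m : ℤ => if m < 0 then φ (u / (2 : ℝ) ^ m) else 0) (ψ u))
    {u : ℝ} (hu : u ≠ 0) : HasSum (fun k => band φ ψ k (u / 2 ^ level k)) 1 := by
  refine Eq.mpr (congrArg (fun F => HasSum F _) (funext fun k => ?_))
    ((hφ.hasSum u hu).tsum_fiberwise fun m => (m + 1).toNat)
  rw [tsum_subtype (f := fun m : ℤ => φ (u / (2 : ℝ) ^ m)), ← (hasSum_band hψ hu k).tsum_eq]
  refine tsum_congr fun m => ?_
  simp only [indicator, mem_preimage, mem_singleton_iff]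

lemma div_two_zpow_ne_zero {u : ℝ} (hu : u ≠ 0) (j : ℤ) : u / (2 : ℝ) ^ j ≠ 0 :=
  div_ne_zero hu (by positivity)

lemma symbolCut_eq (γ ρ φ₁ φ₂ : ℝ → ℝ) (j m n : ℤ) (ξ η : ℝ) : symbolCut γ ρ φ₁ φ₂ j m n ξ η =
    symbol γ ρ j ξ η * ((φ₁ (ξ / 2 ^ j / 2 ^ m) *
      φ₂ (deriv γ ((2 : ℝ) ^ (-j)) * η / 2 ^ j / 2 ^ n) : ℝ) : ℂ) := by
  rw [symbolCut, div_two_zpow_add, div_two_zpow_add, mul_assoc, Complex.ofReal_mul]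

/-- `symbol` does not depend on the indices, and the sum of the products of cutoffs over a fibre is
a product of two bands. -/
lemma tsum_symbolPiece_fiber {γ ρ : ℝ → ℝ} {j : ℤ} (hj : deriv γ ((2 : ℝ) ^ (-j)) ≠ 0)
    (hφ : IsFrequencyCutoff φ)
    (hψ : ∀ u ≠ 0, HasSum (fun m : ℤ => if m < 0 then φ (u / (2 : ℝ) ^ m) else 0) (ψ u))
    (C : ℕ) {ξ η : ℝ} (hξ : ξ ≠ 0) (hη : η ≠ 0) (c : ℕ × ℕ) :
    ∑' a : ℤ × ℤ, ((fun a : ℤ × ℤ => ((a.1 + 1).toNat, (a.2 + 1).toNat)) ⁻¹' {c}).indicator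
      ((farIndices C).indicator fun a => symbolPiece γ ρ φ j a.1 a.2 ξ η) a =
    (farBands C).indicator (fun c => symbolCut γ ρ (band φ ψ c.1) (band φ ψ c.2) j
      (level c.1) (level c.2) ξ η) c := by
  have h₁ := hasSum_band hψ (div_two_zpow_ne_zero hξ j) c.1
  have h₂ := hasSum_band hψ (div_two_zpow_ne_zero (mul_ne_zero hj hη) j) c.2
  have h0 : ∀ (u : ℝ) (k : ℕ) (m : ℤ),
      0 ≤ if (m + 1).toNat = k then φ (u / (2 : ℝ) ^ m) else 0 := by
    intro u k m
    split_ifs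
    exacts [hφ.nonneg _, le_rfl]
  have h₁₂ := HasSum.mul_of_nonneg h₁ h₂ (h0 _ _) (h0 _ _)
  have hC := (Complex.hasSum_ofReal.2 h₁₂).mul_left
    ((farBands C).indicator (fun _ => symbol γ ρ j ξ η) c)
  have e : (farBands C).indicator (fun c => symbolCut γ ρ (band φ ψ c.1) (band φ ψ c.2) j
      (level c.1) (level c.2) ξ η) c = (farBands C).indicator (fun _ => symbol γ ρ j ξ η) c *
      ((band φ ψ c.1 (ξ / 2 ^ j / 2 ^ level c.1) *
        band φ ψ c.2 (deriv γ ((2 : ℝ) ^ (-j)) * η / 2 ^ j / 2 ^ level c.2) : ℝ) : ℂ) := by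
    by_cases hc : c ∈ farBands C
    · rw [indicator_of_mem hc, indicator_of_mem hc, symbolCut_eq]
    · rw [indicator_of_notMem hc, indicator_of_notMem hc, zero_mul]
  rw [e, ← hC.tsum_eq]
  refine tsum_congr fun a => ?_
  by_cases ha : ((a.1 + 1).toNat, (a.2 + 1).toNat) = c
  · rw [indicator_of_mem (show a ∈ (fun a : ℤ × ℤ => ((a.1 + 1).toNat, (a.2 + 1).toNat)) ⁻¹' {c}
      from ha), if_pos (congrArg Prod.fst ha),
      if_pos (congrArg Prod.snd ha), ← ha]
    by_cases hf : a ∈ farIndices C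
    · rw [indicator_of_mem hf, indicator_of_mem ((mem_farBands_iff C a.1 a.2).2 hf),
        symbolPiece_eq]
    · rw [indicator_of_notMem hf, indicator_of_notMem fun h =>
        hf ((mem_farBands_iff C a.1 a.2).1 h), zero_mul]
  · rw [indicator_of_notMem (show a ∉ (fun a : ℤ × ℤ => ((a.1 + 1).toNat, (a.2 + 1).toNat)) ⁻¹' {c}
      from ha)]
    have : ¬ ((a.1 + 1).toNat = c.1 ∧ (a.2 + 1).toNat = c.2) := fun h => ha (Prod.ext h.1 h.2)
    rcases not_and_or.1 this with h | h
    · rw [if_neg h, zero_mul, Complex.ofReal_zero, mul_zero]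
    · rw [if_neg h, mul_zero, Complex.ofReal_zero, mul_zero]

lemma hasSum_symbolCut_farBands {γ ρ : ℝ → ℝ} {j : ℤ} (hj : deriv γ ((2 : ℝ) ^ (-j)) ≠ 0)
    (hρ : IsAveragingKernel ρ) (hφ : IsFrequencyCutoff φ)
    (hψ : ∀ u ≠ 0, HasSum (fun m : ℤ => if m < 0 then φ (u / (2 : ℝ) ^ m) else 0) (ψ u))
    (C : ℕ) {ξ η : ℝ} (hξ : ξ ≠ 0) (hη : η ≠ 0) :
    HasSum (fun c : farBands C => symbolCut γ ρ (band φ ψ c.1.1) (band φ ψ c.1.2) j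
      (level c.1.1) (level c.1.2) ξ η) (farSymbol γ ρ φ C j ξ η) := by
  have hs : HasSum ((farIndices C).indicator fun a => symbolPiece γ ρ φ j a.1 a.2 ξ η)
      (farSymbol γ ρ φ C j ξ η) :=
    hasSum_subtype_iff_indicator.1
      ((summable_norm_symbolPiece hρ hφ ξ η).of_norm.subtype (farIndices C)).hasSum
  refine (hasSum_subtype_iff_indicator (f := fun c : ℕ × ℕ => symbolCut γ ρ (band φ ψ c.1)
    (band φ ψ c.2) j (level c.1) (level c.2) ξ η)).2 ?_
  have hfib := hs.tsum_fiberwise fun a => ((a.1 + 1).toNat, (a.2 + 1).toNat)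
  refine Eq.mpr (congrArg (fun F => HasSum F _) (funext fun c => ?_)) hfib
  rw [← tsum_symbolPiece_fiber hj hφ hψ C hξ hη c,
    tsum_subtype (f := (farIndices C).indicator fun a => symbolPiece γ ρ φ j a.1 a.2 ξ η)]

/-- The bands are again a nonnegative partition of unity off the origin. -/
lemma tsum_enorm_symbolCut_le {γ ρ : ℝ → ℝ} {j : ℤ} (hj : deriv γ ((2 : ℝ) ^ (-j)) ≠ 0)
    (hρ : IsAveragingKernel ρ) (hφ : IsFrequencyCutoff φ)
    (hψ : ∀ u ≠ 0, HasSum (fun m : ℤ => if m < 0 then φ (u / (2 : ℝ) ^ m) else 0) (ψ u))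
    (C : ℕ) {ξ η : ℝ} (hξ : ξ ≠ 0) (hη : η ≠ 0) :
    ∑' c : farBands C, ‖symbolCut γ ρ (band φ ψ c.1.1) (band φ ψ c.1.2) j
      (level c.1.1) (level c.1.2) ξ η‖ₑ ≤ 1 := by
  have hu := div_two_zpow_ne_zero hξ j
  have hv := div_two_zpow_ne_zero (mul_ne_zero hj hη) j
  have h₁ := hasSum_band_one hφ hψ hu
  have h₂ := hasSum_band_one hφ hψ hv
  have h₁₂ := h₁.mul h₂ (h₁.summable.mul_of_nonneg h₂.summable (fun k => band_nonneg hφ hψ hu k)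
    fun k => band_nonneg hφ hψ hv k)
  have h0 : ∀ c : ℕ × ℕ, 0 ≤ band φ ψ c.1 (ξ / 2 ^ j / 2 ^ level c.1) *
      band φ ψ c.2 (deriv γ ((2 : ℝ) ^ (-j)) * η / 2 ^ j / 2 ^ level c.2) := fun c =>
    mul_nonneg (band_nonneg hφ hψ hu _) (band_nonneg hφ hψ hv _)
  calc _ ≤ ∑' c : farBands C, ENNReal.ofReal (band φ ψ c.1.1 (ξ / 2 ^ j / 2 ^ level c.1.1) *
        band φ ψ c.1.2 (deriv γ ((2 : ℝ) ^ (-j)) * η / 2 ^ j / 2 ^ level c.1.2)) := by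
        refine ENNReal.tsum_le_tsum fun c => ?_
        rw [← ofReal_norm, symbolCut_eq, norm_mul, Complex.norm_real,
          Real.norm_of_nonneg (h0 c.1)]
        exact ENNReal.ofReal_le_ofReal (mul_le_of_le_one_left (h0 c.1) (norm_symbol_le hρ _ _ _ _))
    _ ≤ ∑' c : ℕ × ℕ, ENNReal.ofReal (band φ ψ c.1 (ξ / 2 ^ j / 2 ^ level c.1) *
        band φ ψ c.2 (deriv γ ((2 : ℝ) ^ (-j)) * η / 2 ^ j / 2 ^ level c.2)) :=
        ENNReal.tsum_comp_le_tsum_of_injective Subtype.val_injective _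
    _ = 1 := by
        rw [← ENNReal.ofReal_tsum_of_nonneg h0 h₁₂.summable, h₁₂.tsum_eq, mul_one,
          ENNReal.ofReal_one]

lemma band_lowCutoff (hφ : IsFrequencyCutoff φ) (hψ : LowCutoff ψ) (k : ℕ) :
    LowCutoff (band φ ψ k) := by
  rw [band]
  split_ifs
  exacts [hψ, hφ.highCutoff.toLowCutoff]

lemma enorm_integral_farSymbol_le {γ ρ : ℝ → ℝ} {j : ℤ} (hj : deriv γ ((2 : ℝ) ^ (-j)) ≠ 0)
    (hm : Measurable fun z : ℝ × ℝ => symbol γ ρ j z.1 z.2)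
    (hρ : IsAveragingKernel ρ) (hφ : IsFrequencyCutoff φ) (hψ' : LowCutoff ψ)
    (hψ : ∀ u ≠ 0, HasSum (fun m : ℤ => if m < 0 then φ (u / (2 : ℝ) ^ m) else 0) (ψ u))
    (C : ℕ) (f g : 𝓢(ℝ, ℂ)) (x : ℝ) :
    ‖∫ z : ℝ × ℝ, multiplierIntegrand (farSymbol γ ρ φ C j) f g x z.1 z.2‖ₑ ≤
      ∑' c : farBands C, ‖∫ z : ℝ × ℝ, multiplierIntegrand (symbolCut γ ρ (band φ ψ c.1.1)
        (band φ ψ c.1.2) j (level c.1.1) (level c.1.2)) f g x z.1 z.2‖ₑ := by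
  -- The resummation holds off the coordinate axes, a null set.
  have hne : ∀ᵐ z : ℝ × ℝ, z.1 ≠ 0 ∧ z.2 ≠ 0 := by
    have h0 : ∀ᵐ u : ℝ, u ≠ 0 := by simp [ae_iff]
    exact (Measure.quasiMeasurePreserving_fst.ae h0).and (Measure.quasiMeasurePreserving_snd.ae h0)
  have hf := measurable_fourierHat f
  have hg := measurable_fourierHat g
  have hmeas : ∀ c : farBands C, Measurable fun z : ℝ × ℝ => multiplierIntegrand (symbolCut γ ρ
      (band φ ψ c.1.1) (band φ ψ c.1.2) j (level c.1.1) (level c.1.2)) f g x z.1 z.2 := by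
    intro c
    unfold multiplierIntegrand
    exact ((((hf.comp measurable_fst).mul (hg.comp measurable_snd)).mul
      (measurable_symbolCut hm (band_lowCutoff hφ hψ' _).contDiff.continuous
        (band_lowCutoff hφ hψ' _).contDiff.continuous _ _)).mul (by fun_prop)).mul (by fun_prop)
  have hsum : ∑' c : farBands C, ∫⁻ z : ℝ × ℝ, ‖multiplierIntegrand (symbolCut γ ρ
      (band φ ψ c.1.1) (band φ ψ c.1.2) j (level c.1.1) (level c.1.2)) f g x z.1 z.2‖ₑ ≠ ⊤ := by
    rw [← lintegral_tsum fun c => (hmeas c).enorm.aemeasurable]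
    refine ne_top_of_le_ne_top (((integrable_fourierHat f).mul_prod
      (integrable_fourierHat g)).2.ne) (lintegral_mono_ae ?_)
    filter_upwards [hne] with z hz
    have e : ∀ c : farBands C, ‖multiplierIntegrand (symbolCut γ ρ (band φ ψ c.1.1)
        (band φ ψ c.1.2) j (level c.1.1) (level c.1.2)) f g x z.1 z.2‖ₑ =
        ‖fourierHat f z.1 * fourierHat g z.2‖ₑ * ‖symbolCut γ ρ (band φ ψ c.1.1)
        (band φ ψ c.1.2) j (level c.1.1) (level c.1.2) z.1 z.2‖ₑ := by
      intro c
      rw [multiplierIntegrand, enorm_mul, enorm_mul, enorm_mul _ (symbolCut _ _ _ _ _ _ _ _ _),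
        ← ofReal_norm (Complex.exp _), ← ofReal_norm (Complex.exp _), norm_exp_I_mul_mul,
        norm_exp_I_mul_mul, ENNReal.ofReal_one, mul_one, mul_one]
    simp_rw [e]
    rw [ENNReal.tsum_mul_left]
    exact mul_le_of_le_one_right' (tsum_enorm_symbolCut_le hj hρ hφ hψ C hz.1 hz.2)
  have heq : ∫ z : ℝ × ℝ, multiplierIntegrand (farSymbol γ ρ φ C j) f g x z.1 z.2 =
      ∑' c : farBands C, ∫ z : ℝ × ℝ, multiplierIntegrand (symbolCut γ ρ (band φ ψ c.1.1)
        (band φ ψ c.1.2) j (level c.1.1) (level c.1.2)) f g x z.1 z.2 := by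
    rw [← integral_tsum (fun c => (hmeas c).aestronglyMeasurable) hsum]
    refine integral_congr_ae ?_
    filter_upwards [hne] with z hz
    have := ((hasSum_symbolCut_farBands hj hρ hφ hψ C hz.1 hz.2).mul_left (fourierHat f z.1 *
      fourierHat g z.2 * Complex.exp (Complex.I * z.1 * x) *
        Complex.exp (Complex.I * z.2 * x))).tsum_eq
    calc _ = _ := by
          rw [multiplierIntegrand]
          ring
      _ = _ := this.symm
      _ = _ := tsum_congr fun c => by
          rw [multiplierIntegrand]
          ring
  rw [heq]
  exact enorm_tsum_le_tsum_enorm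

end Bands

end
end BilinearMax

/-! ### Summation over the bands. -/

namespace BilinearMax
noncomputable section

/-- The weights which remain, at each of the bands, after summation of the norms. -/
def bandWeight (k : ℕ) : ℝ := 2 * (3 / 4) ^ k * (k + 10)

lemma bandWeight_nonneg (k : ℕ) : 0 ≤ bandWeight k := by
  unfold bandWeight
  positivity

lemma summable_bandWeight : Summable bandWeight := by
  have h1 : Summable fun k : ℕ => (k : ℝ) * (3 / 4 : ℝ) ^ k := by
    simpa using summable_pow_mul_geometric_of_norm_lt_one 1 (r := (3 / 4 : ℝ)) (by norm_num)
  have h2 : Summable fun k : ℕ => (3 / 4 : ℝ) ^ k :=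
    summable_geometric_of_lt_one (by norm_num) (by norm_num)
  refine ((h1.mul_left 2).add (h2.mul_left 20)).congr fun k => ?_
  unfold bandWeight
  ring

/-- The weight of a pair of bands. -/
def pairWeight (c : ℕ × ℕ) : ℝ≥0 := (bandWeight c.1).toNNReal * (bandWeight c.2).toNNReal

lemma tsum_pairWeight_ne_top : ∑' c : ℕ × ℕ, (pairWeight c : ℝ≥0∞) ≠ ⊤ := by
  have e : ∀ c : ℕ × ℕ, (pairWeight c : ℝ≥0∞) =
      ENNReal.ofReal (bandWeight c.1) * ENNReal.ofReal (bandWeight c.2) := fun c => by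
    rw [pairWeight, ENNReal.coe_mul]
    rfl
  simp_rw [e]
  rw [ENNReal.tsum_prod
    (f := fun k l => ENNReal.ofReal (bandWeight k) * ENNReal.ofReal (bandWeight l))]
  simp_rw [ENNReal.tsum_mul_left]
  rw [ENNReal.tsum_mul_right]
  exact ENNReal.mul_ne_top summable_bandWeight.tsum_ofReal_ne_top
    summable_bandWeight.tsum_ofReal_ne_top

/-- The loss in the norm estimate for a pair of bands. -/
def pairLoss (c : ℕ × ℕ) : ℝ≥0 := ((level c.1).toNat + 10 : ℕ) * ((level c.2).toNat + 10 : ℕ)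

lemma pairLoss_ne_zero (c : ℕ × ℕ) : pairLoss c ≠ 0 := by
  unfold pairLoss
  positivity

/-- Decay in the maximum alone is split between both indices: `1/2 ≤ (3/4)^2` and `2 max(k, l) ≥ k +
l`. The factor `2` compensates for `level k` being `k - 1` when `k ≥ 1`. -/
lemma two_zpow_neg_max_level_le (k l : ℕ) :
    (2 : ℝ) ^ (-max (level k) (level l)) * (((level k).toNat + 10 : ℕ) * ((level l).toNat + 10 : ℕ)) ≤
      bandWeight k * bandWeight l := by
  have h1 : (2 : ℝ) ^ (-max (level k) (level l)) ≤ 2 * (1 / 2) ^ max k l := by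
    rw [one_div, inv_pow, ← zpow_natCast, ← zpow_neg, ← zpow_one_add₀ two_ne_zero]
    refine zpow_le_zpow_right₀ one_le_two ?_
    unfold level
    omega
  have h2 : (1 / 2 : ℝ) ^ max k l ≤ (3 / 4) ^ k * (3 / 4) ^ l := by
    calc (1 / 2 : ℝ) ^ max k l ≤ ((3 / 4) ^ 2) ^ max k l :=
          pow_le_pow_left₀ (by norm_num) (by norm_num) _
      _ = (3 / 4) ^ (2 * max k l) := by rw [pow_mul]
      _ ≤ (3 / 4) ^ (k + l) := pow_le_pow_of_le_one (by norm_num) (by norm_num) (by omega)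
      _ = _ := pow_add _ _ _
  have h3 : ∀ k : ℕ, (((level k).toNat + 10 : ℕ) : ℝ) ≤ k + 10 := by
    intro k
    have : (level k).toNat + 10 ≤ k + 10 := by
      unfold level
      omega
    exact_mod_cast this
  unfold bandWeight
  calc _ ≤ 2 * ((3 / 4) ^ k * (3 / 4) ^ l) * (((k : ℝ) + 10) * ((l : ℝ) + 10)) := by
        gcongr
        · exact h1.trans (by gcongr)
        · exact h3 k
        · exact h3 l
    _ ≤ 2 * (2 * ((3 / 4) ^ k * (3 / 4) ^ l) * (((k : ℝ) + 10) * ((l : ℝ) + 10))) := by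
        have : 0 ≤ 2 * ((3 / 4 : ℝ) ^ k * (3 / 4) ^ l) * (((k : ℝ) + 10) * ((l : ℝ) + 10)) := by
          positivity
        linarith
    _ = _ := by ring

lemma ofReal_le_pairWeight (c : ℕ × ℕ) :
    ENNReal.ofReal ((2 : ℝ) ^ (-(max (level c.1) (level c.2)))) ≤
      (pairWeight c : ℝ≥0∞) * ((pairLoss c)⁻¹ : ℝ≥0) := by
  rw [← ENNReal.coe_mul]
  change ((_ : ℝ≥0) : ℝ≥0∞) ≤ _
  rw [ENNReal.coe_le_coe, ← div_eq_mul_inv, le_div_iff₀ (pos_iff_ne_zero.2 (pairLoss_ne_zero c)),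
    ← NNReal.coe_le_coe, NNReal.coe_mul, Real.coe_toNNReal _ (by positivity)]
  have := two_zpow_neg_max_level_le c.1 c.2
  rw [pairWeight, pairLoss]
  simp only [NNReal.coe_mul, NNReal.coe_natCast, Real.coe_toNNReal _ (bandWeight_nonneg _)]
  exact this

/-- Two positive bands with nearby levels are excluded by `C₀ ≤ C`. So one of the bands is the
low-pass one, at level `0`, and the other level is within `C₀` of it. -/
lemma max_level_le {C₀ C : ℕ} (hC : C₀ ≤ C) {c : ℕ × ℕ} (hc : c ∈ farBands C)
    (h : |level c.1 - level c.2| ≤ C₀) : max (level c.1) (level c.2) ≤ C₀ := by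
  simp only [farBands, Set.mem_ofPred_eq, abs_le, level] at hc h ⊢
  omega

lemma max_le_of_mem_farIndices {C₀ C : ℕ} (hC : C₀ ≤ C) {m n : ℤ} (h : (m, n) ∈ farIndices C)
    (hmn : |m - n| ≤ C₀) : max m n ≤ C₀ := by
  simp only [farIndices, lowIndices, diagIndices, mem_compl_iff, mem_union,
    Set.mem_ofPred_eq, abs_le] at h hmn
  omega

lemma ofReal_weight_eq (m n : ℤ) : ENNReal.ofReal ((2 : ℝ) ^ (-(max m n)) *
    (((max m 0 : ℤ) : ℝ) + 10) * (((max n 0 : ℤ) : ℝ) + 10)) =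
      ENNReal.ofReal ((2 : ℝ) ^ (-(max m n))) * ((m.toNat + 10 : ℕ) * (n.toNat + 10 : ℕ)) := by
  have h : ∀ k : ℤ, (((max k 0 : ℤ) : ℝ) + 10) = ((k.toNat + 10 : ℕ) : ℝ) := by
    intro k
    rw [← Int.ofNat_toNat]
    push_cast
    rfl
  rw [h, h, mul_assoc, ENNReal.ofReal_mul (by positivity), ← Nat.cast_mul, ENNReal.ofReal_natCast,
    Nat.cast_mul]

section Main

variable {γ Q₀ Qinf : ℝ → ℝ} {j₀ : ℕ} {K : ℝ} {B : ℕ}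

lemma UniformCurve.enorm_farPiece_le (U : UniformCurve γ Q₀ Qinf j₀ K B) {C₀ : ℕ}
    {φ : 𝓢(ℝ, ℝ)} {ρ : ℝ → ℝ} (hφ : IsFrequencyCutoff φ) (hρ : IsAveragingKernel ρ) {A : ℝ≥0}
    (hA : Dominates K C₀ ρ φ φ A) {C : ℕ} (hC : C₀ ≤ C) {j : ℝ → ℤ} (hj : ∀ x, (j₀ : ℤ) < |j x|)
    {m n : ℤ} (hmn : (m, n) ∈ farIndices C) (f g : 𝓢(ℝ, ℂ)) (x : ℝ) :
    ‖farPiece γ ρ φ j m n f g x‖ₑ ≤ A * ENNReal.ofReal ((2 : ℝ) ^ (-(max m n))) *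
      curveAverage γ (j x) m n (fun y => ‖f y‖ₑ) (fun y => ‖g y‖ₑ) x := by
  have hm := measurable_symbol (U.ne_zero _ (hj x)) (U.phase _ (hj x)) hρ
  rw [farPiece, linearizedOp_eq_integral (μ := fun i => symbolPiece γ ρ φ i m n) (j := j)
    (integrable_symbolPiece hm hρ hφ m n f g x)]
  exact hA (U.ne_zero _ (hj x)) (U.phase _ (hj x)) m n (fun _ => hφ.highCutoff)
    (fun _ => hφ.highCutoff) (max_le_of_mem_farIndices hC hmn) f g x

lemma UniformCurve.enorm_farOp_le (U : UniformCurve γ Q₀ Qinf j₀ K B) {C₀ : ℕ}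
    {φ : 𝓢(ℝ, ℝ)} {ψ ρ : ℝ → ℝ} (hφ : IsFrequencyCutoff φ) (hψ' : LowCutoff ψ)
    (hψ : ∀ u ≠ 0, HasSum (fun m : ℤ => if m < 0 then φ (u / (2 : ℝ) ^ m) else 0) (ψ u))
    (hρ : IsAveragingKernel ρ) {A : ℝ≥0}
    (hA : ∀ k l, Dominates K C₀ ρ (band φ ψ k) (band φ ψ l) A) {C : ℕ} (hC : C₀ ≤ C)
    {j : ℝ → ℤ} (hj : ∀ x, (j₀ : ℤ) < |j x|) (f g : 𝓢(ℝ, ℂ)) (x : ℝ) :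
    ‖farOp γ ρ φ C j f g x‖ₑ ≤ ∑' c : farBands C,
      A * ENNReal.ofReal ((2 : ℝ) ^ (-(max (level c.1.1) (level c.1.2)))) *
        curveAverage γ (j x) (level c.1.1) (level c.1.2) (fun y => ‖f y‖ₑ)
          (fun y => ‖g y‖ₑ) x := by
  have hm := measurable_symbol (U.ne_zero _ (hj x)) (U.phase _ (hj x)) hρ
  -- A band whose level exceeds another level is not the low-pass one, so the dominant frequency
  -- always carries a cutoff vanishing near zero.
  have hhigh : ∀ k l : ℕ, (C₀ : ℤ) < level k - level l → HighCutoff (band φ ψ k) := by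
    intro k l h
    unfold level at h
    rw [band, if_neg (by omega)]
    exact hφ.highCutoff
  rw [farOp, linearizedOp_eq_integral (μ := farSymbol γ ρ φ C) (j := j)
    (integrable_farSymbol hm hρ hφ C f g x)]
  refine (enorm_integral_farSymbol_le (U.ne_zero _ (hj x)) hm hρ hφ hψ' hψ C f g x).trans
    (ENNReal.tsum_le_tsum fun c => ?_)
  exact hA c.1.1 c.1.2 (U.ne_zero _ (hj x)) (U.phase _ (hj x)) _ _ (hhigh _ _) (hhigh _ _)
    (max_level_le hC c.2) f g x

/-- Dividing each maximal function by its loss makes all the norms uniformly bounded. The gain times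
the loss is dominated by the summable `pairWeight`, and Minkowski's inequality for series applies.
-/
lemma UniformCurve.eLpNorm_tsum_curveAverage_le (U : UniformCurve γ Q₀ Qinf j₀ K B)
    {p q r : ℝ≥0∞} (hr : 1 ≤ r) {A₂ : ℝ≥0} (hA₂ : ∀ (m n : ℤ) (f g : 𝓢(ℝ, ℂ)),
      eLpNorm (curveMaximal γ j₀ m n (fun y => ‖f y‖ₑ) fun y => ‖g y‖ₑ) r volume ≤
        A₂ * ((m.toNat + 10 : ℕ) * (n.toNat + 10 : ℕ)) *
          (eLpNorm f p volume * eLpNorm g q volume)) (A : ℝ≥0) (C : ℕ) {j : ℝ → ℤ}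
    (hj : ∀ x, (j₀ : ℤ) < |j x|) (f g : 𝓢(ℝ, ℂ)) :
    eLpNorm (fun x => ∑' c : farBands C,
      A * ENNReal.ofReal ((2 : ℝ) ^ (-(max (level c.1.1) (level c.1.2)))) *
        curveAverage γ (j x) (level c.1.1) (level c.1.2) (fun y => ‖f y‖ₑ) (fun y => ‖g y‖ₑ) x)
      r volume ≤ A * (∑' c : ℕ × ℕ, (pairWeight c : ℝ≥0∞)) *
        (A₂ * (eLpNorm f p volume * eLpNorm g q volume)) := by
  have hMm : ∀ c : ℕ × ℕ, Measurable (curveMaximal γ j₀ (level c.1) (level c.2)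
      (fun y => ‖f y‖ₑ) fun y => ‖g y‖ₑ) := fun c =>
    U.measurable_curveMaximal _ _ f.continuous.measurable.enorm g.continuous.measurable.enorm
  have hH : ∀ c : farBands C, eLpNorm (fun x => (((pairLoss c.1)⁻¹ : ℝ≥0) : ℝ≥0∞) *
      curveMaximal γ j₀ (level c.1.1) (level c.1.2) (fun y => ‖f y‖ₑ) (fun y => ‖g y‖ₑ) x)
      r volume ≤ A₂ * (eLpNorm f p volume * eLpNorm g q volume) := by
    intro c
    refine (eLpNorm_const_mul_le (hMm c.1) hr _).trans ?_
    refine (mul_le_mul_right (hA₂ (level c.1.1) (level c.1.2) f g) _).trans (le_of_eq ?_)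
    have e : (((level c.1.1).toNat + 10 : ℕ) * ((level c.1.2).toNat + 10 : ℕ) : ℝ≥0∞) =
        (pairLoss c.1 : ℝ≥0) := by
      rw [pairLoss]
      push_cast
      rfl
    rw [e, mul_right_comm, mul_comm _ (pairLoss c.1 : ℝ≥0∞), ← mul_assoc, ← ENNReal.coe_mul,
      inv_mul_cancel₀ (pairLoss_ne_zero c.1), ENNReal.coe_one, one_mul]
  have hle : ∀ (c : ℕ × ℕ) (x : ℝ),
      A * ENNReal.ofReal ((2 : ℝ) ^ (-(max (level c.1) (level c.2)))) *
        curveAverage γ (j x) (level c.1) (level c.2) (fun y => ‖f y‖ₑ) (fun y => ‖g y‖ₑ) x ≤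
      ((A * pairWeight c : ℝ≥0) : ℝ≥0∞) * ((((pairLoss c)⁻¹ : ℝ≥0) : ℝ≥0∞) *
        curveMaximal γ j₀ (level c.1) (level c.2) (fun y => ‖f y‖ₑ) (fun y => ‖g y‖ₑ) x) := by
    intro c x
    have h := mul_le_mul' (ofReal_le_pairWeight c) (curveAverage_le_curveMaximal γ (hj x)
      (level c.1) (level c.2) (fun y => ‖f y‖ₑ) (fun y => ‖g y‖ₑ) x)
    refine (mul_assoc _ _ _).trans_le ((mul_le_mul_right h _).trans (le_of_eq ?_))
    rw [ENNReal.coe_mul]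
    ring
  calc _ ≤ eLpNorm (fun x => ∑' c : farBands C, ((A * pairWeight c.1 : ℝ≥0) : ℝ≥0∞) *
        ((((pairLoss c.1)⁻¹ : ℝ≥0) : ℝ≥0∞) * curveMaximal γ j₀ (level c.1.1) (level c.1.2)
          (fun y => ‖f y‖ₑ) (fun y => ‖g y‖ₑ) x)) r volume := by
        refine eLpNorm_mono_enorm fun x => ?_
        simp only [enorm_eq_self]
        exact ENNReal.tsum_le_tsum fun c => hle c.1 x
    _ ≤ (∑' c : farBands C, ((A * pairWeight c.1 : ℝ≥0) : ℝ≥0∞)) *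
          (A₂ * (eLpNorm f p volume * eLpNorm g q volume)) :=
        eLpNorm_tsum_le (H := fun (c : farBands C) x => (((pairLoss c.1)⁻¹ : ℝ≥0) : ℝ≥0∞) *
          curveMaximal γ j₀ (level c.1.1) (level c.1.2) (fun y => ‖f y‖ₑ) (fun y => ‖g y‖ₑ) x)
          (fun c => (hMm c.1).const_mul _) hr (fun c => A * pairWeight c.1) hH
    _ ≤ (∑' c : ℕ × ℕ, ((A * pairWeight c : ℝ≥0) : ℝ≥0∞)) *
          (A₂ * (eLpNorm f p volume * eLpNorm g q volume)) :=
        mul_le_mul_left (ENNReal.tsum_comp_le_tsum_of_injective Subtype.val_injective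
          fun c : ℕ × ℕ => ((A * pairWeight c : ℝ≥0) : ℝ≥0∞)) _
    _ = _ := by
        simp_rw [ENNReal.coe_mul]
        rw [ENNReal.tsum_mul_left]

end Main

end
end BilinearMax

/-! ### Uniform constants over the bands, and assembly of the theorem. -/

namespace BilinearMax
noncomputable section

lemma exists_dominates_band {K : ℝ} {C₀ : ℕ} {φ ψ ρ : ℝ → ℝ}
    (hdom : ∀ {ρ φ₁ φ₂ : ℝ → ℝ}, IsAveragingKernel ρ → LowCutoff φ₁ → LowCutoff φ₂ →
      ∃ A : ℝ≥0, Dominates K C₀ ρ φ₁ φ₂ A)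
    (hφ : LowCutoff φ) (hψ : LowCutoff ψ) (hρ : IsAveragingKernel ρ) :
    ∃ A : ℝ≥0, ∀ k l, Dominates K C₀ ρ (band φ ψ k) (band φ ψ l) A := by
  obtain ⟨A₀, h₀⟩ := hdom hρ hφ hφ
  obtain ⟨A₁, h₁⟩ := hdom hρ hφ hψ
  obtain ⟨A₂, h₂⟩ := hdom hρ hψ hφ
  obtain ⟨A₃, h₃⟩ := hdom hρ hψ hψ
  refine ⟨max (max A₀ A₁) (max A₂ A₃), fun k l => ?_⟩
  unfold band
  split_ifs
  · exact h₃.mono (by simp)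
  · exact h₂.mono (by simp)
  · exact h₁.mono (by simp)
  · exact h₀.mono (by simp)

section Main

variable {γ Q₀ Qinf : ℝ → ℝ} {j₀ : ℕ} {K : ℝ} {B : ℕ} {C₀ : ℕ} {φ : 𝓢(ℝ, ℝ)} {ρ : ℝ → ℝ}

lemma UniformCurve.eLpNorm_farPiece_le (U : UniformCurve γ Q₀ Qinf j₀ K B)
    (hφ : IsFrequencyCutoff φ) (hρ : IsAveragingKernel ρ) {A : ℝ≥0}
    (hA : Dominates K C₀ ρ φ φ A) {p q r : ℝ≥0∞} (hr : 1 ≤ r) {A₂ : ℝ≥0}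
    (hA₂ : ∀ (m n : ℤ) (f g : 𝓢(ℝ, ℂ)),
      eLpNorm (curveMaximal γ j₀ m n (fun y => ‖f y‖ₑ) fun y => ‖g y‖ₑ) r volume ≤
        A₂ * ((m.toNat + 10 : ℕ) * (n.toNat + 10 : ℕ)) *
          (eLpNorm f p volume * eLpNorm g q volume)) {C : ℕ} (hC : C₀ ≤ C) {j : ℝ → ℤ}
    (hj : ∀ x, (j₀ : ℤ) < |j x|) {m n : ℤ} (hmn : (m, n) ∈ farIndices C) (f g : 𝓢(ℝ, ℂ)) :
    eLpNorm (farPiece γ ρ φ j m n f g) r volume ≤ (A * A₂ : ℝ≥0) *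
      ENNReal.ofReal ((2 : ℝ) ^ (-(max m n)) * (((max m 0 : ℤ) : ℝ) + 10) *
        (((max n 0 : ℤ) : ℝ) + 10)) * eLpNorm f p volume * eLpNorm g q volume := by
  set c : ℝ≥0 := A * ((2 : ℝ) ^ (-(max m n))).toNNReal with hc
  have hce : (c : ℝ≥0∞) = A * ENNReal.ofReal ((2 : ℝ) ^ (-(max m n))) := ENNReal.coe_mul _ _
  calc eLpNorm (farPiece γ ρ φ j m n f g) r volume
      ≤ eLpNorm (fun x => (c : ℝ≥0∞) *
          curveMaximal γ j₀ m n (fun y => ‖f y‖ₑ) (fun y => ‖g y‖ₑ) x) r volume := by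
        refine eLpNorm_mono_enorm fun x => ?_
        rw [enorm_eq_self, hce]
        exact (U.enorm_farPiece_le hφ hρ hA hC hj hmn f g x).trans
          (mul_le_mul_right (curveAverage_le_curveMaximal γ (hj x) _ _ _ _ x) _)
    _ ≤ c * eLpNorm (curveMaximal γ j₀ m n (fun y => ‖f y‖ₑ) fun y => ‖g y‖ₑ) r volume :=
        eLpNorm_const_mul_le (U.measurable_curveMaximal m n f.continuous.measurable.enorm
          g.continuous.measurable.enorm) hr c
    _ ≤ _ := mul_le_mul_right (hA₂ m n f g) _
    _ = _ := by
        rw [hce, ofReal_weight_eq, ENNReal.coe_mul]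
        ring

lemma UniformCurve.eLpNorm_farOp_le (U : UniformCurve γ Q₀ Qinf j₀ K B)
    (hφ : IsFrequencyCutoff φ) {ψ : ℝ → ℝ} (hψ' : LowCutoff ψ)
    (hψ : ∀ u ≠ 0, HasSum (fun m : ℤ => if m < 0 then φ (u / (2 : ℝ) ^ m) else 0) (ψ u))
    (hρ : IsAveragingKernel ρ) {A : ℝ≥0}
    (hA : ∀ k l, Dominates K C₀ ρ (band φ ψ k) (band φ ψ l) A) {p q r : ℝ≥0∞} (hr : 1 ≤ r)
    {A₂ : ℝ≥0} (hA₂ : ∀ (m n : ℤ) (f g : 𝓢(ℝ, ℂ)),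
      eLpNorm (curveMaximal γ j₀ m n (fun y => ‖f y‖ₑ) fun y => ‖g y‖ₑ) r volume ≤
        A₂ * ((m.toNat + 10 : ℕ) * (n.toNat + 10 : ℕ)) *
          (eLpNorm f p volume * eLpNorm g q volume)) {C : ℕ} (hC : C₀ ≤ C) {j : ℝ → ℤ}
    (hj : ∀ x, (j₀ : ℤ) < |j x|) (f g : 𝓢(ℝ, ℂ)) :
    eLpNorm (farOp γ ρ φ C j f g) r volume ≤
      (A * (∑' c : ℕ × ℕ, (pairWeight c : ℝ≥0∞)).toNNReal * A₂ : ℝ≥0) *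
        eLpNorm f p volume * eLpNorm g q volume := by
  refine (eLpNorm_mono_enorm fun x => (U.enorm_farOp_le hφ hψ' hψ hρ hA hC hj f g x).trans_eq
    (enorm_eq_self _).symm).trans ((U.eLpNorm_tsum_curveAverage_le hr hA₂ A C hj f g).trans_eq ?_)
  rw [ENNReal.coe_mul, ENNReal.coe_mul, ENNReal.coe_toNNReal tsum_pairWeight_ne_top]
  ring

end Main

end
end BilinearMax

theorem mainTheorem6 (N : ℕ) (hN : 2 ≤ N) (γ Q₀ Qinf : ℝ → ℝ)
    (h₀ : BilinearMax.IsNonFlatNearZero N γ Q₀)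
    (hinf : BilinearMax.IsNonFlatNearInfinity N γ Qinf) :
    ∃ j₀ C₀ : ℕ, 1 ≤ C₀ ∧
      ∀ (φ : 𝓢(ℝ, ℝ)) (ρ : ℝ → ℝ), BilinearMax.IsFrequencyCutoff φ →
        BilinearMax.IsAveragingKernel ρ →
      -- the double integrals which define the operators converge absolutely
      (∀ (C : ℕ) (j m n : ℤ), (j₀ : ℤ) < |j| → ∀ (f g : 𝓢(ℝ, ℂ)) (x : ℝ),
        Integrable (fun z : ℝ × ℝ => BilinearMax.multiplierIntegrand
          (BilinearMax.symbolPiece γ ρ φ j m n) f g x z.1 z.2) ∧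
        Integrable (fun z : ℝ × ℝ => BilinearMax.multiplierIntegrand
          (BilinearMax.farSymbol γ ρ φ C j) f g x z.1 z.2)) ∧
      -- the pointwise estimate
      (∃ A : ℝ≥0, ∀ C : ℕ, C₀ ≤ C → ∀ j : ℝ → ℤ, Measurable j → (∀ x, (j₀ : ℤ) < |j x|) →
        ∀ m n : ℤ, (m, n) ∈ BilinearMax.farIndices C → ∀ (f g : 𝓢(ℝ, ℂ)) (x : ℝ),
          ‖BilinearMax.farPiece γ ρ φ j m n f g x‖ₑ ≤
            A * ENNReal.ofReal ((2 : ℝ) ^ (-(max m n))) *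
              BilinearMax.grandMaximal ((2 : ℝ) ^ m) f x *
              BilinearMax.grandMaximal ((2 : ℝ) ^ (n + 1) *
                BilinearMax.cNorm 2 (BilinearMax.profileAt Q₀ Qinf (j x))) g x) ∧
      -- the norm estimates
      (∀ p q r : ℝ≥0∞, 1 < p → 1 < q → 1 ≤ r → p⁻¹ + q⁻¹ = r⁻¹ →
        ∃ A : ℝ≥0, ∀ C : ℕ, C₀ ≤ C → ∀ j : ℝ → ℤ, Measurable j → (∀ x, (j₀ : ℤ) < |j x|) →
          ∀ f g : 𝓢(ℝ, ℂ),
            (∀ m n : ℤ, (m, n) ∈ BilinearMax.farIndices C →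
              eLpNorm (BilinearMax.farPiece γ ρ φ j m n f g) r volume ≤
                A * ENNReal.ofReal ((2 : ℝ) ^ (-(max m n)) *
                  (((max m 0 : ℤ) : ℝ) + 10) * (((max n 0 : ℤ) : ℝ) + 10)) *
                  eLpNorm f p volume * eLpNorm g q volume) ∧
            eLpNorm (BilinearMax.farOp γ ρ φ C j f g) r volume ≤
              A * eLpNorm f p volume * eLpNorm g q volume) := by
  obtain ⟨j₀, K, B, U⟩ := BilinearMax.exists_uniformCurve hN h₀ hinf
  obtain ⟨C₀, hC₀, hdom⟩ := BilinearMax.exists_dominates K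
  refine ⟨j₀, C₀, hC₀, fun φ ρ hφ hρ => ?_⟩
  obtain ⟨ψ, hψ', hψ⟩ := hφ.exists_lowPass
  obtain ⟨A, hA⟩ := BilinearMax.exists_dominates_band hdom hφ.highCutoff.toLowCutoff hψ' hρ
  -- The band `1` is `φ` itself.
  have hA₁ : BilinearMax.Dominates K C₀ ρ φ φ A := by
    simpa only [BilinearMax.band, one_ne_zero, if_false] using hA 1 1
  refine ⟨fun C j m n hj f g x => ?_, ⟨A * 512, ?_⟩, fun p q r hp hq hr hpqr => ?_⟩
  · have hm := BilinearMax.measurable_symbol (U.ne_zero j hj) (U.phase j hj) hρ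
    exact ⟨BilinearMax.integrable_symbolPiece hm hρ hφ m n f g x,
      BilinearMax.integrable_farSymbol hm hρ hφ C f g x⟩
  · intro C hC j _ hj m n hmn f g x
    refine (U.enorm_farPiece_le hφ hρ hA₁ hC hj hmn f g x).trans
      ((mul_le_mul_right (U.curveAverage_le (hj x) m n f.continuous.measurable
        g.continuous.measurable x) _).trans (le_of_eq ?_))
    push_cast
    ring
  · obtain ⟨A₂, hA₂⟩ := U.eLpNorm_curveMaximal_le hp hq hr hpqr
    refine ⟨max (A * A₂) (A * (∑' c : ℕ × ℕ, (BilinearMax.pairWeight c : ℝ≥0∞)).toNNReal * A₂),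
      fun C hC j _ hj f g => ⟨fun m n hmn => ?_, ?_⟩⟩
    · refine (U.eLpNorm_farPiece_le hφ hρ hA₁ hr hA₂ hC hj hmn f g).trans ?_
      gcongr
      exact le_max_left _ _
    · refine (U.eLpNorm_farOp_le hφ hψ' hψ hρ hA hr hA₂ hC hj f g).trans ?_
      gcongr
      exact le_max_right _ _
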